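/- **Setting.** Let $\Theta$ be a finite or countable set (with the discrete $\sigma$-algebra), enumerated as $\{k_1,k_2,\dots\}$, and let $E=\Theta\times\mathbb R^d$, with generic element $x=(\theta,\nu)$. Let $\lambda:E\to\,]0,\infty[$ be measurable with $\lambda\le\lambda^*$ for a constant $\lambda^*<\infty$, and let $Q$ be a Markov kernel from $E$ to $\Theta$, extended to a kernel on $E$ by $Q(x,A\times B)=Q(x,A)\,\delta_\nu(B)$ for $x=(\theta,\nu)$. For $x\in E$ and $u\in[0,1]$ let $H(x,u)$ be the element $k_i$ with $a_{i-1}(x)<u\le a_i(x)$, where $a_i(x)=\sum_{j\le i}Q(x,\{k_j\})$, $a_0=0$ (the value of $H(x,\cdot)$ on the remaining null set is irrelevant). For $\theta\in\Theta$ let $f_\theta:\mathbb R^d\to\mathbb R^d$ be bounded and Lipschitz with a constant independent of $\theta$; write $f(x)=f_\theta(\nu)$. On a probability space let $(T^*_k)_{k\ge1}$ be the successive jump times of a homogeneous Poisson process with intensity $\lambda^*$ (all of whose paths are counting paths, so that $0=T_0^*<T_1^*<T_2^*<\cdots\to\infty$), and let $(U_k)_{k\ge1}$, $(V_k)_{k\ge1}$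 be two sequences of i.i.d. random variables, uniform on $[0,1]$; the three sequences are independent. For a family of functions $\Phi_\theta:\mathbb R_+\times\mathbb R^d\to\mathbb R^d$ and $x=(\theta_0,\nu_0)\in E$, the *PDP with flow $\Phi$ started at $x$* is constructed as follows: $\tau_0=0$, $T_0=0$ and, for $n\ge1$, $$\tau_n=\inf\{k>\tau_{n-1}:\ U_k\lambda^*\le\lambda(\theta_{n-1},\Phi_{\theta_{n-1}}(T^*_k-T_{n-1},\nu_{n-1}))\},\qquad T_n=T^*_{\tau_n},$$ $$\nu_n=\Phi_{\theta_{n-1}}(T_n-T_{n-1},\nu_{n-1}),\qquad \theta_n=H((\theta_{n-1},\nu_n),V_n),$$ where $\inf\emptyset=\infty$ and $T_n=\infty$ (no further jump) if $\tau_n=\infty$. The process is $x_t=(\theta_n,\Phi_{\theta_n}(t-T_n,\nu_n))$ for $t\in[T_n,T_{n+1}[$, and $x_{s-}$ denotes its left limit at $s$. Its jump measure is $p([0,t]\times A)=\sum_{n\ge1}\mathbf 1_{T_n\le t}\mathbf 1_{(\theta_n,\nu_n)\in A}$; put $p'([0,t]\times A)=\int_0^t\lambda(x_s)Q(x_s,A)\,ds$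 and $q=p-p'$. Let $\mathcal F^p_t$ be the $\sigma$-algebra generated by the variables $p([0,s]\times A)$, $s\le t$, $A\in\mathcal B(E)$. Let $(x_t)$ be the PDP started at $x$ whose flow is $\phi_\theta(t,\nu)$, the solution at time $t$ of $y'=f_\theta(y)$, $y(0)=\nu$ (this is the PDMP). For $h>0$, let $(\overline x_t)$, with jump times $\overline T_n$ and measures $\overline p,\overline p',\overline q$, be the PDP started at the same $x$ and driven by the same noise, whose flow is the Euler polygon $\overline\phi_\theta(t,\nu)=\overline y_i+(t-ih)f_\theta(\overline y_i)$ for $t\in[ih,(i+1)h]$, where $\overline y_0=\nu$, $\overline y_{i+1}=\overline y_i+hf_\theta(\overline y_i)$. Put $\overline\eta(s)=\overline T_n+kh$ if $s\in[\overline T_n+kh,(\overline T_n+(k+1)h)\wedge\overline T_{n+1}[$. For $g:\mathbb R_+\times E\to\mathbb R$ define $$\mathcal Sg(t,x)=\lambda(x)\int_E(g(t,y)-g(t,x))\,Q(x,dy),$$ $$\mathcal Ag(t,x)=\partial_tg(t,x)+f(x)\cdot\partial_\nu g(t,x)+\mathcal Sg(t,x),\qquad \overline{\mathcal A}g(t,x,y)=\partial_tg(t,x)+f(y)\cdot\partial_\nu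 g(t,x)+\mathcal Sg(t,x).$$ **Theorem (Itô formulas).** Let $g:\mathbb R_+\times E\to\mathbb R$ be bounded and such that $(t,\nu)\mapsto g(t,\theta,\nu)$ is continuously differentiable for every $\theta\in\Theta$, with $\partial_tg$ and $\partial_\nu g$ bounded on $\mathbb R_+\times E$. Then for all $t\ge0$ $$g(t,x_t)=g(0,x)+\int_0^t\mathcal Ag(s,x_s)\,ds+M^g_t,\qquad M^g_t:=\int_0^t\int_E\big(g(s,y)-g(s,x_{s-})\big)\,q(ds\,dy),$$ $$g(t,\overline x_t)=g(0,x)+\int_0^t\overline{\mathcal A}g(s,\overline x_s,\overline x_{\overline\eta(s)})\,ds+\overline M^g_t,\qquad \overline M^g_t:=\int_0^t\int_E\big(g(s,y)-g(s,\overline x_{s-})\big)\,\overline q(ds\,dy),$$ where all the integrals converge absolutely, $(M^g_t)_{t\ge0}$ is a true $(\mathcal F^p_t)$-martingale and $(\overline M^g_t)_{t\ge0}$ is a true $(\mathcal F^{\overline p}_t)$-martingale. -/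

import Mathlib

open MeasureTheory ProbabilityTheory Filter Topology Set
open scoped NNReal ENNReal

noncomputable section

namespace PDMP

/-- The state space `E = Θ × ℝ^d`; a state is `x = (θ, ν)`. -/
abbrev State (Θ : Type*) (d : ℕ) : Type _ := Θ × EuclideanSpace ℝ (Fin d)

/-- A family of functions `Φ_θ : ℝ₊ × ℝ^d → ℝ^d`, written `Φ θ t ν`; only `t ≥ 0` is used. -/
abbrev FlowFamily (Θ : Type*) (d : ℕ) : Type _ :=
  Θ → ℝ → EuclideanSpace ℝ (Fin d) → EuclideanSpace ℝ (Fin d)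

/-- The jump characteristics: a measurable rate `λ : E → ]0, ∞[` bounded by a constant `λ*`, a
transition measure `Q(x, dθ)` from `E` to `Θ`, and an enumeration of the finite or countable set
`Θ` (the point `k_i` of rank `i` comes before the point `k_j` of rank `j` when `i < j`). -/
structure JumpCharacteristics (Θ : Type*) (d : ℕ) [MeasurableSpace Θ] where
  rate : State Θ d → ℝ
  measurable_rate : Measurable rate
  rate_pos : ∀ x, 0 < rate x
  bound : ℝ
  rate_le_bound : ∀ x, rate x ≤ bound
  Q : Kernel (State Θ d) Θ
  isMarkovKernel_Q : IsMarkovKernel Q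
  rank : Θ → ℕ
  rank_injective : Function.Injective rank

/-- One realisation of the driving noise: the points `T*_k` (`k ≥ 0`, `T*_0 = 0`) of the Poisson
process and the uniform variables `U_k`, `V_k` (`k ≥ 1`; `U 0` and `V 0` are never used). -/
structure NoisePath where
  T : ℕ → ℝ
  U : ℕ → ℝ
  V : ℕ → ℝ

/-- `W` is the driving noise of the thinning construction under `P`: `(T*_k)` are the successive
jump times of a homogeneous Poisson process of intensity `lamStar` (a counting process that is
finite at all times, with unit jumps, and whose waiting times are i.i.d. exponential), `(U_k)` and
`(V_k)` are i.i.d. uniform on `[0,1]`, and the three families are independent. -/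
structure IsThinningNoise {Ω : Type*} [MeasurableSpace Ω] (P : Measure Ω) (lamStar : ℝ)
    (W : Ω → NoisePath) : Prop where
  T_zero : ∀ ω, (W ω).T 0 = 0
  T_strictMono : ∀ ω, StrictMono (W ω).T
  T_tendsto : ∀ ω, Tendsto (W ω).T atTop atTop
  measurable_T : ∀ k, Measurable fun ω => (W ω).T (k + 1)
  measurable_U : ∀ k, Measurable fun ω => (W ω).U (k + 1)
  measurable_V : ∀ k, Measurable fun ω => (W ω).V (k + 1)
  law_T : ∀ k, HasLaw (fun ω => (W ω).T (k + 1) - (W ω).T k) (expMeasure lamStar) P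
  law_U : ∀ k, HasLaw (fun ω => (W ω).U (k + 1)) (volume.restrict (Icc (0 : ℝ) 1)) P
  law_V : ∀ k, HasLaw (fun ω => (W ω).V (k + 1)) (volume.restrict (Icc (0 : ℝ) 1)) P
  indep : iIndepFun
    (fun (i : Fin 3 × ℕ) (ω : Ω) =>
      (![(W ω).T (i.2 + 1) - (W ω).T i.2, (W ω).U (i.2 + 1), (W ω).V (i.2 + 1)] i.1 : ℝ)) P

section Construction

variable {Θ : Type*} {d : ℕ} [MeasurableSpace Θ]

/-- The transition measure on `E`, `Q(x, A × B) = Q(x, A) δ_ν(B)` for `x = (θ, ν)`. -/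
def JumpCharacteristics.QE (C : JumpCharacteristics Θ d) (x : State Θ d) : Measure (State Θ d) :=
  (C.Q x).map fun θ => (θ, x.2)

open Classical in
/-- The generalised inverse `H(x, u)` of the distribution function of `Q(x, ·)`: the point `k_i`
of `Θ` with `a_{i-1}(x) < u ≤ a_i(x)`, where `a_i(x) = Q(x, {k_1, …, k_i})`. There is at most one
such point; if there is none (a null event for uniform `u`) the `Θ`-component is left as is. -/
def JumpCharacteristics.H (C : JumpCharacteristics Θ d) (x : State Θ d) (u : ℝ) : Θ :=
  if h : ∃ θ, (C.Q x).real {j | C.rank j < C.rank θ} < u ∧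
      u ≤ (C.Q x).real {j | C.rank j ≤ C.rank θ}
  then h.choose else x.1

variable (C : JumpCharacteristics Θ d) (Φ : FlowFamily Θ d) (x₀ : State Θ d) (w : NoisePath)

/-- `inf {k > m : U_k λ* ≤ λ(θ, Φ_θ(T*_k - T*_m, ν))}` for `x = (θ, ν)`, with `inf ∅ = ∞`. -/
def nextIndex (m : ℕ) (x : State Θ d) : ℕ∞ :=
  sInf ((fun k : ℕ => (k : ℕ∞)) ''
    {k | m < k ∧ w.U k * C.bound ≤ C.rate (x.1, Φ x.1 (w.T k - w.T m) x.2)})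

open Classical in
/-- The sequence `(τ_n, (θ_n, ν_n))` started at `τ_0 = 0`, `(θ_0, ν_0) = x₀`. Once `τ_n = ∞`
(no further jump) the sequence is frozen. -/
def embedded : ℕ → ℕ∞ × State Θ d
  | 0 => (0, x₀)
  | n + 1 =>
    let m := (embedded n).1
    let x := (embedded n).2
    let k := if m = ⊤ then ⊤ else nextIndex C Φ w m.toNat x
    if k = ⊤ then (⊤, x)
    else
      let ν' := Φ x.1 (w.T k.toNat - w.T m.toNat) x.2
      (k, (C.H (x.1, ν') (w.V (n + 1)), ν'))

open Classical in
/-- The jump times `T_n = T*_{τ_n}`, with `T_n = ∞` when `τ_n = ∞`. -/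
def jumpTime (n : ℕ) : EReal :=
  if (embedded C Φ x₀ w n).1 = ⊤ then ⊤
  else ((w.T (embedded C Φ x₀ w n).1.toNat : ℝ) : EReal)

/-- The post-jump location `Y_n = (θ_n, ν_n)`. -/
def postJump (n : ℕ) : State Θ d := (embedded C Φ x₀ w n).2

/-- The index `n` with `t ∈ [T_n, T_{n+1}[`. -/
def jumpIndex (t : ℝ) : ℕ :=
  sInf {n | jumpTime C Φ x₀ w n ≤ (t : EReal) ∧ (t : EReal) < jumpTime C Φ x₀ w (n + 1)}

/-- The last jump time before or at `t`, that is `T_n` for the `n` with `t ∈ [T_n, T_{n+1}[`. -/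
def lastJump (t : ℝ) : ℝ := (jumpTime C Φ x₀ w (jumpIndex C Φ x₀ w t)).toReal

/-- The piecewise deterministic process
`x_t = (θ_n, Φ_{θ_n}(t - T_n, ν_n))` for `t ∈ [T_n, T_{n+1}[`. -/
def process (t : ℝ) : State Θ d :=
  let y := postJump C Φ x₀ w (jumpIndex C Φ x₀ w t)
  (y.1, Φ y.1 (t - lastJump C Φ x₀ w t) y.2)

open Classical in
/-- The random counting measure on `ℝ₊ × E`,
`p([0,t] × A) = ∑_{n ≥ 1} 1_{T_n ≤ t} 1_{Y_n ∈ A}`. -/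
def jumpMeasure : Measure (ℝ × State Θ d) :=
  Measure.sum fun n : ℕ =>
    if jumpTime C Φ x₀ w (n + 1) = ⊤ then 0
    else Measure.dirac ((jumpTime C Φ x₀ w (n + 1)).toReal, postJump C Φ x₀ w (n + 1))

/-- The measure `p'(ds dy) = λ(x_s) Q(x_s, dy) ds` on `ℝ₊ × E`, that is
`p'([0,t] × A) = ∫_0^t λ(x_s) Q(x_s, A) ds`. -/
def compensator : Measure (ℝ × State Θ d) :=
  (volume.restrict (Ici (0 : ℝ))).bind fun s =>
    ENNReal.ofReal (C.rate (process C Φ x₀ w s)) •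
      (C.QE (process C Φ x₀ w s)).map fun y => (s, y)

/-- The integral `∫_0^t ∫_E φ(s, y) q(ds dy)` with `q = p - p'`. -/
def compensatedIntegral (φ : ℝ × State Θ d → ℝ) (t : ℝ) : ℝ :=
  (∫ z in Ioc 0 t ×ˢ univ, φ z ∂(jumpMeasure C Φ x₀ w)) -
    ∫ z in Ioc 0 t ×ˢ univ, φ z ∂(compensator C Φ x₀ w)

/-- The integrand `(s, y) ↦ g(s, y) - g(s, x_{s-})`, where `x_{s-}` is the left limit. -/
def jumpIntegrand [TopologicalSpace Θ] (g : ℝ → State Θ d → ℝ) (z : ℝ × State Θ d) : ℝ :=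
  g z.1 z.2 - g z.1 (Function.leftLim (process C Φ x₀ w) z.1)

/-- `M^g_t = ∫_0^t ∫_E (g(s, y) - g(s, x_{s-})) q(ds dy)`. -/
def martingalePart [TopologicalSpace Θ] (g : ℝ → State Θ d → ℝ) (t : ℝ) : ℝ :=
  compensatedIntegral C Φ x₀ w (jumpIntegrand C Φ x₀ w g) t

/-- The σ-algebra `ℱ_t^p` generated by the random variables `p([0,s] × A)`, `0 ≤ s ≤ t`,
`A` a Borel set of `E`. -/
@[reducible]
def jumpSigma {Ω : Type*} (W : Ω → NoisePath) (t : ℝ) : MeasurableSpace Ω :=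
  ⨆ s ∈ Icc 0 t, ⨆ A ∈ {A : Set (State Θ d) | MeasurableSet A},
    MeasurableSpace.comap (fun ω => jumpMeasure C Φ x₀ (W ω) (Icc 0 s ×ˢ A)) inferInstance

end Construction

section Flows

variable {Θ : Type*} {d : ℕ}

/-- `y` solves `y' = F(y)` on `[0, ∞[` with `y(0) = ν` (one-sided derivative at `0`). -/
def IsODESolution (F : EuclideanSpace ℝ (Fin d) → EuclideanSpace ℝ (Fin d))
    (ν : EuclideanSpace ℝ (Fin d)) (y : ℝ → EuclideanSpace ℝ (Fin d)) : Prop :=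
  y 0 = ν ∧ ∀ t, 0 ≤ t → HasDerivWithinAt y (F (y t)) (Ici 0) t

open Classical in
/-- The flow `φ_θ(t, ν)`: the solution of `y' = f_θ(y)`, `y(0) = ν`, at time `t ≥ 0`. (It exists
and is unique when `f_θ` is Lipschitz; the other branch is then void.) -/
def odeFlow (f : Θ → EuclideanSpace ℝ (Fin d) → EuclideanSpace ℝ (Fin d)) : FlowFamily Θ d :=
  fun θ t ν => if h : ∃ y, IsODESolution (f θ) ν y then h.choose t else ν

/-- The Euler scheme `y_{i+1} = y_i + h F(y_i)`, `y_0 = ν`. -/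
def eulerSeq (F : EuclideanSpace ℝ (Fin d) → EuclideanSpace ℝ (Fin d)) (h : ℝ)
    (ν : EuclideanSpace ℝ (Fin d)) : ℕ → EuclideanSpace ℝ (Fin d)
  | 0 => ν
  | i + 1 => eulerSeq F h ν i + h • F (eulerSeq F h ν i)

/-- The Euler polygon `y_i + (t - ih) f_θ(y_i)` for `t ∈ [ih, (i+1)h]`. -/
def eulerFlow (f : Θ → EuclideanSpace ℝ (Fin d) → EuclideanSpace ℝ (Fin d)) (h : ℝ) :
    FlowFamily Θ d :=
  fun θ t ν =>
    let i := ⌊t / h⌋₊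
    eulerSeq (f θ) h ν i + (t - i * h) • f θ (eulerSeq (f θ) h ν i)

/-- `η(s) = T_n + k h` for `s ∈ [T_n + k h, (T_n + (k+1) h) ∧ T_{n+1}[`. -/
def gridTime [MeasurableSpace Θ] (C : JumpCharacteristics Θ d) (Φ : FlowFamily Θ d)
    (x₀ : State Θ d) (w : NoisePath) (h s : ℝ) : ℝ :=
  lastJump C Φ x₀ w s + ⌊(s - lastJump C Φ x₀ w s) / h⌋₊ * h

end Flows

section Operators

variable {Θ : Type*} {d : ℕ}

/-- `∂_t g(t, x)` for `g` on `ℝ₊ × E` (one-sided at `t = 0`). -/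
def dt (g : ℝ → State Θ d → ℝ) (t : ℝ) (x : State Θ d) : ℝ :=
  derivWithin (fun s => g s x) (Ici 0) t

/-- `∂_ν g(t, x)`, as a linear form on `ℝ^d`. -/
def dν (g : ℝ → State Θ d → ℝ) (t : ℝ) (x : State Θ d) : EuclideanSpace ℝ (Fin d) →L[ℝ] ℝ :=
  fderiv ℝ (fun ν => g t (x.1, ν)) x.2

/-- `g : ℝ₊ × E → ℝ` is bounded and continuously differentiable in `(t, ν)` with bounded
derivatives. Only the values `g t x` with `t ≥ 0` matter. -/
structure IsBoundedC1 (g : ℝ → State Θ d → ℝ) : Prop where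
  contDiffOn : ∀ θ, ContDiffOn ℝ 1
    (fun z : ℝ × EuclideanSpace ℝ (Fin d) => g z.1 (θ, z.2)) (Ici 0 ×ˢ univ)
  bounded : ∃ K : ℝ, ∀ t, 0 ≤ t → ∀ x, |g t x| ≤ K
  bounded_dt : ∃ K : ℝ, ∀ t, 0 ≤ t → ∀ x, |dt g t x| ≤ K
  bounded_dν : ∃ K : ℝ, ∀ t, 0 ≤ t → ∀ x, ‖dν g t x‖ ≤ K

variable [MeasurableSpace Θ] (C : JumpCharacteristics Θ d)
  (f : Θ → EuclideanSpace ℝ (Fin d) → EuclideanSpace ℝ (Fin d))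

/-- `𝒮 g(t, x) = λ(x) ∫_E (g(t, y) - g(t, x)) Q(x, dy)`. -/
def opS (g : ℝ → State Θ d → ℝ) (t : ℝ) (x : State Θ d) : ℝ :=
  C.rate x * ∫ y, (g t y - g t x) ∂(C.QE x)

/-- `𝒯 g(t, x) = ∂_t g(t, x) + f(x) ∂_ν g(t, x)`. -/
def opT (g : ℝ → State Θ d → ℝ) (t : ℝ) (x : State Θ d) : ℝ :=
  dt g t x + dν g t x (f x.1 x.2)

/-- The generator `𝒜 g = 𝒯 g + 𝒮 g`. -/
def opA (g : ℝ → State Θ d → ℝ) (t : ℝ) (x : State Θ d) : ℝ :=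
  opT f g t x + opS C g t x

/-- `𝒯bar g(t, x, y) = ∂_t g(t, x) + f(y) ∂_ν g(t, x)`. -/
def opTbar (g : ℝ → State Θ d → ℝ) (t : ℝ) (x y : State Θ d) : ℝ :=
  dt g t x + dν g t x (f y.1 y.2)

/-- `𝒜bar g(t, x, y) = 𝒯bar g(t, x, y) + 𝒮 g(t, x)`. -/
def opAbar (g : ℝ → State Θ d → ℝ) (t : ℝ) (x y : State Θ d) : ℝ :=
  opTbar f g t x y + opS C g t x

end Operators

end PDMP

end

/-! Both processes come from one thinning construction with a continuous flow, so the work is done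
for a general `IsRegularFlow` and specialised at the end. Read along the Poisson points (`thinned`),
the process is a single deterministic trajectory on each `[T*_k, T*_{k+1}[`, and jumps at `T*_{k+1}`
when that point is accepted.

The formula is pathwise. Between points, `g` along the trajectory is the integral of its right
derivative (`integral_along_flow`). Gluing the pieces leaves the jump sizes, whose sum is the
integral against `p` (`integral_jumpMeasure`), while the integral against `p'` is `∫ 𝒮g(s, x_s) ds`
(`integral_compensator`). Adding and subtracting the latter gives `ito_path`. For the Euler polygon
the velocity at time `s` is `f` at the last vertex, that is, at the state at the last grid time
(`process_gridTime`).

Probability enters only in the martingale property. `M_t - M_s` is the sum over `k` of the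
contributions of `]T*_k, T*_{k+1}] ∩ ]s, t]` (`hasSum_increment`). Given the past, each of them is a
function of a fresh exponential time `σ` and two fresh uniform variables. A proposed jump is
accepted with probability `λ/λ*` and its mode then has law `Q`, so its mean effect is `𝒮g/λ*`
(`integral_mark`); moreover `E b(σ) = λ* E ∫_0^σ b` (`integral_expMeasure`). Hence the contribution
has mean zero (`integral_stepIncrement`).

The delicate point is that the index of the next `V` is the random number of acceptances. The past
is therefore described by `pastSigma W k n` on the event that `n` points were accepted, and
`pointSigma` glues these descriptions. On `{s < T*_{k+1}}` an event of `ℱ^p_s` coincides with one of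
`pointSigma` at `k`; elsewhere the contribution vanishes. So each contribution integrates to zero
over every event of `ℱ^p_s`, and the series converges in `L¹` because the mean number of Poisson
points in `]0, t]` is finite (`summable_prob_time_le`).

Adaptedness cannot be read off the Poisson points, since the rejected ones are invisible to `p`.
Instead the jump times and locations up to `t` are rebuilt from the values `p([0,s] × A)` with `s`
rational or equal to `t`. -/

noncomputable section

namespace PDMP

/-! ### The construction indexed by Poisson points instead of jumps. -/

section Thinning

variable {Θ : Type*} {d : ℕ} [MeasurableSpace Θ]

/-- A realisation of the noise whose points `0 = T*_0 < T*_1 < ⋯` increase to infinity. -/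
structure NoisePath.IsCounting (w : NoisePath) : Prop where
  zero : w.T 0 = 0
  strictMono : StrictMono w.T
  tendsto : Tendsto w.T atTop atTop

/-- The state at time `t` of the deterministic trajectory that starts at time `r.1` from `r.2`. -/
def flowFrom (Φ : FlowFamily Θ d) (r : ℝ × State Θ d) (t : ℝ) : State Θ d :=
  -- Flows are only meaningful for nonnegative times; the cut-off makes the trajectory continuous
  -- and measurable on the whole line.
  (r.2.1, Φ r.2.1 (max (t - r.1) 0) r.2.2)

variable (C : JumpCharacteristics Θ d) (Φ : FlowFamily Θ d) (x₀ : State Θ d) (w : NoisePath)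

open Classical in
/-- The thinning construction read along the Poisson points: after the `k`-th point, the number of
accepted points, the last accepted time (or `0`), and the post-jump location at that time. -/
def thinned : ℕ → ℕ × ℝ × State Θ d
  | 0 => (0, 0, x₀)
  | k + 1 =>
    let z := thinned k
    let y := flowFrom Φ z.2 (w.T (k + 1))
    -- The index of `V` advances with the accepted points only, those of `T` and `U` with every
    -- point.
    if w.U (k + 1) * C.bound ≤ C.rate y
    then (z.1 + 1, w.T (k + 1), (C.H y (w.V (z.1 + 1)), y.2)) else z

/-- The `(k+1)`-st Poisson point is accepted. -/
def Accepts (k : ℕ) : Prop :=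
  w.U (k + 1) * C.bound ≤ C.rate (flowFrom Φ (thinned C Φ x₀ w k).2 (w.T (k + 1)))

variable {C Φ x₀ w}

theorem thinned_succ_of_accepts {k : ℕ} (h : Accepts C Φ x₀ w k) :
    thinned C Φ x₀ w (k + 1) = ((thinned C Φ x₀ w k).1 + 1, w.T (k + 1),
      (C.H (flowFrom Φ (thinned C Φ x₀ w k).2 (w.T (k + 1))) (w.V ((thinned C Φ x₀ w k).1 + 1)),
        (flowFrom Φ (thinned C Φ x₀ w k).2 (w.T (k + 1))).2)) := by
  rw [thinned]
  exact if_pos h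

theorem thinned_succ_of_not_accepts {k : ℕ} (h : ¬ Accepts C Φ x₀ w k) :
    thinned C Φ x₀ w (k + 1) = thinned C Φ x₀ w k := by
  rw [thinned]
  exact if_neg h

theorem thinned_time_le (hw : w.IsCounting) (k : ℕ) : (thinned C Φ x₀ w k).2.1 ≤ w.T k := by
  induction k with
  | zero => simp [thinned, hw.zero]
  | succ k ih =>
    by_cases h : Accepts C Φ x₀ w k
    · rw [thinned_succ_of_accepts h]
    · rw [thinned_succ_of_not_accepts h]
      exact ih.trans (hw.strictMono.monotone k.le_succ)

/-- The indices that may be accepted after the index `m` when the last location is `x`. -/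
theorem lt_nextIndex_iff {m k : ℕ} {x : State Θ d} :
    (k : ℕ∞) < nextIndex C Φ w m x ↔ ∀ j, m < j →
      w.U j * C.bound ≤ C.rate (x.1, Φ x.1 (w.T j - w.T m) x.2) → k < j := by
  rw [nextIndex]
  constructor
  · intro h j hj hacc
    have : sInf ((fun k : ℕ => (k : ℕ∞)) '' {k | m < k ∧ w.U k * C.bound ≤
        C.rate (x.1, Φ x.1 (w.T k - w.T m) x.2)}) ≤ j := sInf_le ⟨j, ⟨hj, hacc⟩, rfl⟩
    exact_mod_cast h.trans_le this
  · intro h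
    have : ((k + 1 : ℕ) : ℕ∞) ≤ sInf ((fun k : ℕ => (k : ℕ∞)) '' {k | m < k ∧ w.U k * C.bound ≤
        C.rate (x.1, Φ x.1 (w.T k - w.T m) x.2)}) := by
      apply le_sInf
      rintro _ ⟨j, ⟨hj, hacc⟩, rfl⟩
      exact Nat.cast_le.2 (h j hj hacc)
    refine lt_of_lt_of_le ?_ this
    exact_mod_cast Nat.lt_succ_self k

theorem embedded_succ_fst {n m : ℕ} (h : (embedded C Φ x₀ w n).1 = m) :
    (embedded C Φ x₀ w (n + 1)).1 = nextIndex C Φ w m (embedded C Φ x₀ w n).2 := by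
  rw [embedded]
  simp only [h, ENat.natCast_ne_top, if_false, ENat.toNat_natCast]
  split_ifs with h1
  · exact h1.symm
  · rfl

theorem embedded_succ_snd {n m k : ℕ} (h : (embedded C Φ x₀ w n).1 = m)
    (hk : (embedded C Φ x₀ w (n + 1)).1 = k) :
    (embedded C Φ x₀ w (n + 1)).2 =
      (C.H ((embedded C Φ x₀ w n).2.1, Φ (embedded C Φ x₀ w n).2.1 (w.T k - w.T m)
          (embedded C Φ x₀ w n).2.2) (w.V (n + 1)),
        Φ (embedded C Φ x₀ w n).2.1 (w.T k - w.T m) (embedded C Φ x₀ w n).2.2) := by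
  have h1 := embedded_succ_fst h
  rw [hk] at h1
  rw [embedded]
  simp only [h, ENat.natCast_ne_top, if_false, ENat.toNat_natCast, ← h1]

theorem embedded_succ_of_top {n : ℕ} (h : (embedded C Φ x₀ w n).1 = ⊤) :
    (embedded C Φ x₀ w (n + 1)).1 = ⊤ := by
  rw [embedded]
  simp [h]

theorem embedded_lt_succ {n m : ℕ} (h : (embedded C Φ x₀ w n).1 = m) :
    (m : ℕ∞) < (embedded C Φ x₀ w (n + 1)).1 := by
  rw [embedded_succ_fst h, lt_nextIndex_iff]
  exact fun j hj _ => hj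

theorem embedded_monotone : Monotone fun n => (embedded C Φ x₀ w n).1 := by
  refine monotone_nat_of_le_succ fun n => ?_
  induction h : (embedded C Φ x₀ w n).1 using ENat.recTopCoe with
  | top => rw [embedded_succ_of_top h]
  | coe m => exact (embedded_lt_succ h).le

theorem embedded_lt_of_lt {i j m : ℕ} (h : (embedded C Φ x₀ w i).1 = m) (hij : i < j) :
    (m : ℕ∞) < (embedded C Φ x₀ w j).1 :=
  (embedded_lt_succ h).trans_le (embedded_monotone hij)

/-- The dictionary between the two recursions, proved as an invariant. Here `m` is the index of the
last accepted point. The last clause, that the next accepted index exceeds `k`, is what makes the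
induction close: point `k + 1` is then the next jump exactly when it passes the test. -/
theorem embedded_thinned (hw : w.IsCounting) (k : ℕ) :
    ∃ m : ℕ, (embedded C Φ x₀ w (thinned C Φ x₀ w k).1).1 = m ∧
      (embedded C Φ x₀ w (thinned C Φ x₀ w k).1).2 = (thinned C Φ x₀ w k).2.2 ∧ m ≤ k ∧
      w.T m = (thinned C Φ x₀ w k).2.1 ∧
      (k : ℕ∞) < (embedded C Φ x₀ w ((thinned C Φ x₀ w k).1 + 1)).1 := by
  induction k with
  | zero =>
    exact ⟨0, rfl, rfl, le_rfl, hw.zero, embedded_lt_succ (n := 0) rfl⟩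
  | succ k ih =>
    obtain ⟨m, h1, h2, h3, h4, h5⟩ := ih
    have hpos : max (w.T (k + 1) - (thinned C Φ x₀ w k).2.1) 0 = w.T (k + 1) - w.T m := by
      rw [← h4]
      exact max_eq_left (sub_nonneg.2 (hw.strictMono.monotone (by omega)))
    have hflow : flowFrom Φ (thinned C Φ x₀ w k).2 (w.T (k + 1)) =
        ((thinned C Φ x₀ w k).2.2.1, Φ (thinned C Φ x₀ w k).2.2.1 (w.T (k + 1) - w.T m)
          (thinned C Φ x₀ w k).2.2.2) := by
      rw [flowFrom, hpos]
    have h6 := embedded_succ_fst h1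
    rw [h6, lt_nextIndex_iff, h2] at h5
    by_cases hacc : Accepts C Φ x₀ w k
    · have h7 : (embedded C Φ x₀ w ((thinned C Φ x₀ w k).1 + 1)).1 = ((k + 1 : ℕ) : ℕ∞) := by
        refine le_antisymm ?_ ?_
        · rw [h6, nextIndex]
          refine sInf_le ⟨k + 1, ⟨by omega, ?_⟩, rfl⟩
          rw [h2, ← hflow]
          exact hacc
        · have : (k : ℕ∞) < (embedded C Φ x₀ w ((thinned C Φ x₀ w k).1 + 1)).1 := by
            rw [h6, lt_nextIndex_iff, h2]; exact h5
          have := Order.add_one_le_of_lt this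
          exact_mod_cast this
      rw [thinned_succ_of_accepts hacc]
      refine ⟨k + 1, h7, ?_, le_rfl, rfl, embedded_lt_succ h7⟩
      rw [embedded_succ_snd h1 h7, h2, hflow]
    · rw [thinned_succ_of_not_accepts hacc]
      refine ⟨m, h1, h2, h3.trans k.le_succ, h4, ?_⟩
      rw [h6, lt_nextIndex_iff, h2]
      intro j hj hj'
      rcases (Nat.succ_le_of_lt (h5 j hj hj')).eq_or_lt with h | h
      · exfalso
        apply hacc
        rw [Accepts, hflow]
        have : j = k + 1 := h.symm
        rwa [this] at hj'
      · exact h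

/-- The invariant at `k + 1` brackets `k + 1` between consecutive terms of the increasing sequence
of accepted indices, which pins the count. Had the point been rejected, the last accepted index
would still be at most `k`. -/
theorem embedded_succ_eq_iff (hw : w.IsCounting) {n k : ℕ} :
    (embedded C Φ x₀ w (n + 1)).1 = ((k + 1 : ℕ) : ℕ∞) ↔
      Accepts C Φ x₀ w k ∧ (thinned C Φ x₀ w k).1 = n := by
  obtain ⟨m, h1, -, h3, -, h5⟩ := embedded_thinned (C := C) (Φ := Φ) (x₀ := x₀) hw k
  obtain ⟨m', h1', -, h3', -, h5'⟩ := embedded_thinned (C := C) (Φ := Φ) (x₀ := x₀) hw (k + 1)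
  constructor
  · intro h
    have hle : (thinned C Φ x₀ w (k + 1)).1 = n + 1 := by
      rcases lt_trichotomy (thinned C Φ x₀ w (k + 1)).1 (n + 1) with hl | hl | hl
      · have := embedded_monotone (C := C) (Φ := Φ) (x₀ := x₀) (w := w) (Nat.succ_le_of_lt hl)
        simp only [Nat.succ_eq_add_one] at this
        rw [h] at this
        exact absurd (h5'.trans_le this) (lt_irrefl _)
      · exact hl
      · have := embedded_lt_of_lt h hl
        rw [h1'] at this
        have : k + 1 < m' := by exact_mod_cast this
        omega
    have hacc : Accepts C Φ x₀ w k := by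
      by_contra hacc
      rw [thinned_succ_of_not_accepts hacc] at hle
      rw [hle, h] at h1
      have : k + 1 = m := by exact_mod_cast h1
      omega
    refine ⟨hacc, ?_⟩
    rw [thinned_succ_of_accepts hacc] at hle
    simpa using hle
  · rintro ⟨hacc, rfl⟩
    rw [thinned_succ_of_accepts hacc] at h1'
    simp only at h1'
    rw [h1'] at h5
    have : k < m' := by exact_mod_cast h5
    have : m' = k + 1 := by omega
    rw [h1', this]

theorem jumpTime_of_eq {n m : ℕ} (h : (embedded C Φ x₀ w n).1 = m) :
    jumpTime C Φ x₀ w n = (w.T m : EReal) := by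
  rw [jumpTime, h]
  simp

theorem jumpTime_eq_top_iff {n : ℕ} :
    jumpTime C Φ x₀ w n = ⊤ ↔ (embedded C Φ x₀ w n).1 = ⊤ := by
  rw [jumpTime]
  split_ifs with h <;> simp [h]

theorem jumpTime_zero (hw : w.IsCounting) : jumpTime C Φ x₀ w 0 = 0 := by
  rw [jumpTime_of_eq (m := 0) rfl, hw.zero]; rfl

theorem jumpTime_lt_succ (hw : w.IsCounting) {n : ℕ} (h : jumpTime C Φ x₀ w n ≠ ⊤) :
    jumpTime C Φ x₀ w n < jumpTime C Φ x₀ w (n + 1) := by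
  induction h1 : (embedded C Φ x₀ w n).1 using ENat.recTopCoe with
  | top => exact absurd (jumpTime_eq_top_iff.2 h1) h
  | coe m =>
    rw [jumpTime_of_eq h1]
    have hlt := embedded_lt_succ h1
    induction h2 : (embedded C Φ x₀ w (n + 1)).1 using ENat.recTopCoe with
    | top => rw [jumpTime_eq_top_iff.2 h2]; exact EReal.coe_lt_top _
    | coe m' =>
      rw [jumpTime_of_eq h2]
      rw [h2] at hlt
      exact EReal.coe_lt_coe_iff.2 (hw.strictMono (by exact_mod_cast hlt))

theorem jumpTime_monotone (hw : w.IsCounting) : Monotone (jumpTime C Φ x₀ w) := by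
  refine monotone_nat_of_le_succ fun n => ?_
  by_cases h : jumpTime C Φ x₀ w n = ⊤
  · rw [h, jumpTime_eq_top_iff.2 (embedded_succ_of_top (jumpTime_eq_top_iff.1 h))]
  · exact (jumpTime_lt_succ hw h).le

theorem jumpIndex_eq_of_mem (hw : w.IsCounting) {n : ℕ} {t : ℝ}
    (h1 : jumpTime C Φ x₀ w n ≤ t) (h2 : (t : EReal) < jumpTime C Φ x₀ w (n + 1)) :
    jumpIndex C Φ x₀ w t = n := by
  have : {n | jumpTime C Φ x₀ w n ≤ (t : EReal) ∧ (t : EReal) < jumpTime C Φ x₀ w (n + 1)} =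
      {n} := by
    ext j
    simp only [mem_ofPred_eq, mem_singleton_iff]
    refine ⟨fun hj => ?_, fun hj => hj ▸ ⟨h1, h2⟩⟩
    rcases lt_trichotomy j n with hl | hl | hl
    · exact absurd (hj.2.trans_le ((jumpTime_monotone hw (Nat.succ_le_of_lt hl)).trans h1))
        (lt_irrefl _)
    · exact hl
    · exact absurd (h2.trans_le ((jumpTime_monotone hw (Nat.succ_le_of_lt hl)).trans hj.1))
        (lt_irrefl _)
  rw [jumpIndex, this, csInf_singleton]

/-- On `[T*_k, T*_{k+1}[` the number of jumps is the number of points accepted so far. -/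
theorem jumpTime_thinned (hw : w.IsCounting) {k : ℕ} {t : ℝ} (h1 : w.T k ≤ t)
    (h2 : t < w.T (k + 1)) :
    jumpTime C Φ x₀ w (thinned C Φ x₀ w k).1 = ((thinned C Φ x₀ w k).2.1 : ℝ) ∧
      jumpTime C Φ x₀ w (thinned C Φ x₀ w k).1 ≤ (t : EReal) ∧
      (t : EReal) < jumpTime C Φ x₀ w ((thinned C Φ x₀ w k).1 + 1) := by
  obtain ⟨m, e1, -, e3, e4, e5⟩ := embedded_thinned (C := C) (Φ := Φ) (x₀ := x₀) hw k
  refine ⟨by rw [jumpTime_of_eq e1, e4], ?_, ?_⟩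
  · rw [jumpTime_of_eq e1]
    exact EReal.coe_le_coe_iff.2 ((hw.strictMono.monotone e3).trans h1)
  · induction h : (embedded C Φ x₀ w ((thinned C Φ x₀ w k).1 + 1)).1 using ENat.recTopCoe with
    | top => rw [jumpTime_eq_top_iff.2 h]; exact EReal.coe_lt_top _
    | coe m' =>
      rw [jumpTime_of_eq h]
      rw [h] at e5
      have : k + 1 ≤ m' := by exact_mod_cast e5
      exact EReal.coe_lt_coe_iff.2 (h2.trans_le (hw.strictMono.monotone this))

theorem lastJump_eq (hw : w.IsCounting) {k : ℕ} {t : ℝ} (h1 : w.T k ≤ t)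
    (h2 : t < w.T (k + 1)) : lastJump C Φ x₀ w t = (thinned C Φ x₀ w k).2.1 := by
  obtain ⟨e1, e2, e3⟩ := jumpTime_thinned (C := C) (Φ := Φ) (x₀ := x₀) hw h1 h2
  rw [lastJump, jumpIndex_eq_of_mem hw e2 e3, e1, EReal.toReal_coe]

theorem postJump_jumpIndex_eq (hw : w.IsCounting) {k : ℕ} {t : ℝ} (h1 : w.T k ≤ t)
    (h2 : t < w.T (k + 1)) :
    postJump C Φ x₀ w (jumpIndex C Φ x₀ w t) = (thinned C Φ x₀ w k).2.2 := by
  obtain ⟨e1, e2, e3⟩ := jumpTime_thinned (C := C) (Φ := Φ) (x₀ := x₀) hw h1 h2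
  obtain ⟨m, -, e4, -⟩ := embedded_thinned (C := C) (Φ := Φ) (x₀ := x₀) hw k
  rw [jumpIndex_eq_of_mem hw e2 e3, postJump, e4]

theorem process_eq_flowFrom (hw : w.IsCounting) {k : ℕ} {t : ℝ} (h1 : w.T k ≤ t)
    (h2 : t < w.T (k + 1)) :
    process C Φ x₀ w t = flowFrom Φ (thinned C Φ x₀ w k).2 t := by
  rw [process]
  rw [postJump_jumpIndex_eq hw h1 h2, lastJump_eq hw h1 h2, flowFrom,
    max_eq_left (sub_nonneg.2 ((thinned_time_le hw k).trans h1))]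

theorem NoisePath.IsCounting.exists_mem_Ico (hw : w.IsCounting) {t : ℝ} (ht : 0 ≤ t) :
    ∃ k, w.T k ≤ t ∧ t < w.T (k + 1) := by
  classical
  have hex : ∃ k, t < w.T k := (hw.tendsto.eventually_gt_atTop t).exists
  have hpos : Nat.find hex ≠ 0 := by
    intro h
    have := Nat.find_spec hex
    rw [h, hw.zero] at this
    exact absurd this (not_lt.2 ht)
  obtain ⟨k, hk⟩ := Nat.exists_eq_succ_of_ne_zero hpos
  refine ⟨k, not_lt.1 (Nat.find_min hex (by omega)), ?_⟩
  have := Nat.find_spec hex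
  rwa [hk] at this

-- Each jump sits at exactly one accepted point and each accepted point carries exactly one jump, so
-- the sum over jumps becomes a sum over points after exchanging a double sum.
open Classical in
theorem jumpMeasure_eq_sum (hw : w.IsCounting) :
    jumpMeasure C Φ x₀ w = Measure.sum fun k : ℕ => if Accepts C Φ x₀ w k
      then Measure.dirac (w.T (k + 1), (thinned C Φ x₀ w (k + 1)).2.2) else 0 := by
  have key : ∀ n : ℕ, (if jumpTime C Φ x₀ w (n + 1) = ⊤ then (0 : Measure (ℝ × State Θ d))
      else Measure.dirac ((jumpTime C Φ x₀ w (n + 1)).toReal, postJump C Φ x₀ w (n + 1))) =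
      Measure.sum fun k : ℕ => if Accepts C Φ x₀ w k ∧ (thinned C Φ x₀ w k).1 = n
        then Measure.dirac (w.T (k + 1), (thinned C Φ x₀ w (k + 1)).2.2) else 0 := by
    intro n
    simp only [← embedded_succ_eq_iff hw]
    induction h : (embedded C Φ x₀ w (n + 1)).1 using ENat.recTopCoe with
    | top =>
      rw [if_pos (jumpTime_eq_top_iff.2 h)]
      ext s hs
      rw [Measure.sum_apply _ hs]
      simp only [(ENat.natCast_ne_top _).symm, if_false, Measure.coe_zero, Pi.zero_apply, tsum_zero]
    | coe m =>
      have hm : m ≠ 0 := by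
        rintro rfl
        have := embedded_lt_of_lt (C := C) (Φ := Φ) (x₀ := x₀) (w := w) (i := 0) (m := 0) rfl
          n.succ_pos
        rw [h] at this
        exact absurd this (lt_irrefl _)
      obtain ⟨k, rfl⟩ := Nat.exists_eq_succ_of_ne_zero hm
      have hk := (embedded_succ_eq_iff hw).1 h
      obtain ⟨_, -, e2, -⟩ := embedded_thinned (C := C) (Φ := Φ) (x₀ := x₀) hw (k + 1)
      have e3 : (thinned C Φ x₀ w (k + 1)).1 = n + 1 := by
        rw [thinned_succ_of_accepts hk.1, hk.2]
      rw [if_neg (by rw [jumpTime_of_eq h]; exact EReal.coe_ne_top _), jumpTime_of_eq h,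
        EReal.toReal_coe, postJump, ← e3, e2]
      ext s hs
      rw [Measure.sum_apply _ hs, tsum_eq_single k]
      · simp
      · intro j hj
        rw [if_neg]
        · simp
        · intro h'
          apply hj
          have : k + 1 = j + 1 := by exact_mod_cast h'
          omega
  rw [jumpMeasure]
  simp only [key]
  rw [Measure.sum_comm]
  congr 1
  ext k s hs
  rw [Measure.sum_apply _ hs, tsum_eq_single (thinned C Φ x₀ w k).1]
  · simp
  · intro j hj
    rw [if_neg (fun h => hj h.2.symm)]
    simp

end Thinning

/-! ### Sampling from `Q(x, ·)` with a uniform variable. -/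

section InverseTransform

variable {Θ : Type*} {d : ℕ} [MeasurableSpace Θ] {C : JumpCharacteristics Θ d}

theorem JumpCharacteristics.countable (C : JumpCharacteristics Θ d) : Countable Θ :=
  C.rank_injective.countable

theorem JumpCharacteristics.bound_pos (C : JumpCharacteristics Θ d) (x : State Θ d) :
    0 < C.bound := (C.rate_pos x).trans_le (C.rate_le_bound x)

/-- `a_{i-1}(x) < u ≤ a_i(x)` for `θ = k_i`. -/
def JumpCharacteristics.Selects (C : JumpCharacteristics Θ d) (x : State Θ d) (u : ℝ) (θ : Θ) :
    Prop :=
  (C.Q x).real {j | C.rank j < C.rank θ} < u ∧ u ≤ (C.Q x).real {j | C.rank j ≤ C.rank θ}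

theorem JumpCharacteristics.Selects.unique {x : State Θ d} {u : ℝ} {θ θ' : Θ}
    (h : C.Selects x u θ) (h' : C.Selects x u θ') : θ = θ' := by
  have := C.isMarkovKernel_Q
  by_contra hne
  have hr : C.rank θ ≠ C.rank θ' := fun h => hne (C.rank_injective h)
  have aux : ∀ {θ θ' : Θ}, C.Selects x u θ → C.Selects x u θ' → ¬ C.rank θ < C.rank θ' := by
    intro θ θ' h h' hlt
    have : (C.Q x).real {j | C.rank j ≤ C.rank θ} ≤ (C.Q x).real {j | C.rank j < C.rank θ'} :=
      measureReal_mono fun j hj => lt_of_le_of_lt hj hlt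
    exact absurd (h.2.trans this) (not_le.2 h'.1)
  rcases lt_or_gt_of_ne hr with hlt | hlt
  · exact aux h h' hlt
  · exact aux h' h hlt

theorem JumpCharacteristics.Selects.H_eq {x : State Θ d} {u : ℝ} {θ : Θ}
    (h : C.Selects x u θ) : C.H x u = θ := by
  have hex : ∃ θ, C.Selects x u θ := ⟨θ, h⟩
  have : C.H x u = hex.choose := dif_pos hex
  rw [this]
  exact hex.choose_spec.unique h

theorem JumpCharacteristics.H_eq_iff {x : State Θ d} {u : ℝ} {θ : Θ} :
    C.H x u = θ ↔ C.Selects x u θ ∨ ((∀ θ', ¬ C.Selects x u θ') ∧ x.1 = θ) := by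
  by_cases hex : ∃ θ, C.Selects x u θ
  · obtain ⟨θ', h'⟩ := hex
    rw [h'.H_eq]
    constructor
    · rintro rfl; exact Or.inl h'
    · rintro (h | h)
      · exact h'.unique h
      · exact absurd h' (h.1 θ')
  · have : C.H x u = x.1 := dif_neg hex
    rw [this]
    push Not at hex
    constructor
    · exact fun h => Or.inr ⟨hex, h⟩
    · rintro (h | h)
      · exact absurd h (hex θ)
      · exact h.2

variable [DiscreteMeasurableSpace Θ]

theorem JumpCharacteristics.measurableSet_selects (θ : Θ) :
    MeasurableSet {z : State Θ d × ℝ | C.Selects z.1 z.2 θ} := by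
  have hQ : ∀ S : Set Θ, Measurable fun z : State Θ d × ℝ => (C.Q z.1).real S := fun S =>
    ((Kernel.measurable_coe C.Q (MeasurableSet.of_discrete (s := S))).comp
      measurable_fst).ennreal_toReal
  exact (measurableSet_lt (hQ _) measurable_snd).inter (measurableSet_le measurable_snd (hQ _))

theorem JumpCharacteristics.measurable_H (C : JumpCharacteristics Θ d) :
    Measurable fun z : State Θ d × ℝ => C.H z.1 z.2 := by
  have := C.countable
  refine measurable_to_countable' fun θ => ?_
  have : (fun z : State Θ d × ℝ => C.H z.1 z.2) ⁻¹' {θ} =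
      {z | C.Selects z.1 z.2 θ} ∪ ((⋂ θ', {z | C.Selects z.1 z.2 θ'}ᶜ) ∩ {z | z.1.1 = θ}) := by
    ext z
    simp only [mem_preimage, mem_singleton_iff, C.H_eq_iff, mem_union, mem_ofPred_eq, mem_inter_iff,
      mem_iInter, mem_compl_iff]
  rw [this]
  refine (C.measurableSet_selects θ).union ((MeasurableSet.iInter fun θ' =>
    (C.measurableSet_selects θ').compl).inter ?_)
  exact measurable_fst.fst (measurableSet_singleton θ)

/-- The inverse transform: `H(x, ·)` has law `Q(x, ·)` under the uniform law. -/
theorem JumpCharacteristics.map_H (C : JumpCharacteristics Θ d) (x : State Θ d) :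
    (volume.restrict (Icc (0 : ℝ) 1)).map (C.H x) = C.Q x := by
  have := C.countable
  have := C.isMarkovKernel_Q
  have hm : Measurable (C.H x) := C.measurable_H.comp measurable_prodMk_left
  symm
  -- Both sides have total mass one, so domination of `Q` by the image law suffices and the values
  -- `u` that select no point need no separate treatment.
  apply Measure.eq_of_le_of_measure_univ_eq
  · rw [Measure.le_iff]
    intro s _
    rw [← biUnion_of_singleton s]
    rw [measure_biUnion (to_countable s) (fun a _ b _ hab => by simpa using hab)
      (fun _ _ => measurableSet_singleton _), measure_biUnion (to_countable s)
      (fun a _ b _ hab => by simpa using hab) (fun _ _ => measurableSet_singleton _)]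
    refine ENNReal.tsum_le_tsum fun θ => ?_
    rw [Measure.map_apply hm (measurableSet_singleton _)]
    -- The interval on which `θ` is selected has length exactly `Q(x, {θ})`.
    have hsub : Ioc ((C.Q x).real {j | C.rank j < C.rank θ})
        ((C.Q x).real {j | C.rank j ≤ C.rank θ}) ⊆ C.H x ⁻¹' {(θ : Θ)} ∩ Icc 0 1 := by
      intro u hu
      refine ⟨JumpCharacteristics.Selects.H_eq hu, measureReal_nonneg.trans hu.1.le,
        hu.2.trans measureReal_le_one⟩
    rw [Measure.restrict_apply (hm (measurableSet_singleton _))]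
    refine le_trans (le_of_eq ?_) (measure_mono hsub)
    rw [Real.volume_Ioc]
    have hset : {j | C.rank j ≤ C.rank θ} = {j | C.rank j < C.rank θ} ∪ {(θ : Θ)} := by
      ext j
      simp only [mem_ofPred_eq, mem_union, mem_singleton_iff, le_iff_lt_or_eq,
        C.rank_injective.eq_iff]
    rw [hset, measureReal_union (by simp) (measurableSet_singleton _), add_sub_cancel_left,
      measureReal_def, ENNReal.ofReal_toReal (measure_ne_top _ _)]
  · rw [Measure.map_apply hm MeasurableSet.univ]
    simp

end InverseTransform

/-! ### Measurability and bounds for the flow, for `g` and for `𝒮g`. -/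

section Regularity

variable {Θ : Type*} {d : ℕ}

theorem IsBoundedC1.continuousOn {g : ℝ → State Θ d → ℝ} (hg : IsBoundedC1 g) (θ : Θ) : ContinuousOn
    (fun z : ℝ × EuclideanSpace ℝ (Fin d) => g z.1 (θ, z.2)) (Ici 0 ×ˢ univ) :=
  (hg.contDiffOn θ).continuousOn

theorem IsBoundedC1.exists_bound {g : ℝ → State Θ d → ℝ} (hg : IsBoundedC1 g) :
    ∃ K : ℝ, 0 ≤ K ∧ ∀ t, 0 ≤ t → ∀ x, |g t x| ≤ K := by
  obtain ⟨K, hK⟩ := hg.bounded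
  exact ⟨max K 0, le_max_right _ _, fun t ht x => (hK t ht x).trans (le_max_left _ _)⟩

/-- A flow of continuous trajectories, measurable in time and starting point. -/
structure IsRegularFlow (Φ : FlowFamily Θ d) : Prop where
  zero : ∀ θ ν, Φ θ 0 ν = ν
  continuousOn : ∀ θ ν, ContinuousOn (fun t => Φ θ t ν) (Ici 0)
  measurable : ∀ θ, Measurable fun z : ℝ × EuclideanSpace ℝ (Fin d) => Φ θ (max z.1 0) z.2

theorem continuous_flowFrom_snd {Φ : FlowFamily Θ d} (hΦ : IsRegularFlow Φ)
    (r : ℝ × State Θ d) : Continuous fun t => (flowFrom Φ r t).2 :=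
  (hΦ.continuousOn _ _).comp_continuous (by fun_prop) (fun t => mem_Ici.2 (le_max_right _ _))

theorem flowFrom_continuous [TopologicalSpace Θ] {Φ : FlowFamily Θ d} (hΦ : IsRegularFlow Φ)
    (r : ℝ × State Θ d) : Continuous (flowFrom Φ r) :=
  continuous_const.prodMk (continuous_flowFrom_snd hΦ r)

theorem flowFrom_self {Φ : FlowFamily Θ d} (hΦ : IsRegularFlow Φ) (r : ℝ × State Θ d) :
    flowFrom Φ r r.1 = r.2 := by
  simp [flowFrom, hΦ.zero]

variable [MeasurableSpace Θ]

theorem measurable_of_slices {Y β : Type*} [MeasurableSpace Y] [MeasurableSpace β] [Countable Θ]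
    [MeasurableSingletonClass Θ] {F : Θ → Y → β} (h : ∀ θ, Measurable (F θ)) :
    Measurable fun z : Θ × Y => F z.1 z.2 :=
  measurable_from_prod_countable_right h

variable [DiscreteMeasurableSpace Θ] [Countable Θ]

theorem measurable_flowFrom {Φ : FlowFamily Θ d} (hΦ : IsRegularFlow Φ) :
    Measurable fun z : (ℝ × State Θ d) × ℝ => flowFrom Φ z.1 z.2 := by
  have h1 : Measurable fun z : Θ × ℝ × EuclideanSpace ℝ (Fin d) => Φ z.1 (max z.2.1 0) z.2.2 :=
    measurable_of_slices hΦ.measurable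
  refine Measurable.prodMk (by fun_prop) ?_
  exact h1.comp (f := fun z : (ℝ × State Θ d) × ℝ => (z.1.2.1, z.2 - z.1.1, z.1.2.2))
    (by fun_prop)

variable {g : ℝ → State Θ d → ℝ}

/-- Nothing is known of `g` at negative times; `max z.1 0` gives a globally measurable version that
agrees with `g` where it matters. -/
theorem IsBoundedC1.measurable (hg : IsBoundedC1 g) :
    Measurable fun z : ℝ × State Θ d => g (max z.1 0) z.2 := by
  have h1 : Measurable fun z : Θ × ℝ × EuclideanSpace ℝ (Fin d) =>
      g (max z.2.1 0) (z.1, z.2.2) := by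
    refine measurable_of_slices (F := fun θ (z : ℝ × EuclideanSpace ℝ (Fin d)) =>
      g (max z.1 0) (θ, z.2)) fun θ => Continuous.measurable ?_
    exact (hg.continuousOn θ).comp_continuous (f := fun z : ℝ × EuclideanSpace ℝ (Fin d) =>
      (max z.1 0, z.2)) (by fun_prop) fun z => ⟨mem_Ici.2 (le_max_right _ _), mem_univ _⟩
  exact h1.comp (f := fun z : ℝ × State Θ d => (z.2.1, z.1, z.2.2)) (by fun_prop)

theorem IsBoundedC1.measurable_apply (hg : IsBoundedC1 g) {t : ℝ} (ht : 0 ≤ t) :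
    Measurable (g t) := by
  have := hg.measurable.comp (measurable_prodMk_left (x := t))
  simpa [Function.comp_def, max_eq_left ht] using this

variable {C : JumpCharacteristics Θ d}

theorem opS_eq_integral_Q (hg : IsBoundedC1 g) {t : ℝ} (ht : 0 ≤ t) (x : State Θ d) :
    opS C g t x = C.rate x * ∫ θ, (g t (θ, x.2) - g t x) ∂(C.Q x) := by
  rw [opS, JumpCharacteristics.QE, integral_map (by fun_prop)]
  exact ((hg.measurable_apply ht).sub_const _).aestronglyMeasurable

theorem measurable_opS (hg : IsBoundedC1 g) :
    Measurable fun z : ℝ × State Θ d => opS C g (max z.1 0) z.2 := by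
  have := C.isMarkovKernel_Q
  simp only [opS_eq_integral_Q hg (le_max_right _ _)]
  refine (C.measurable_rate.comp measurable_snd).mul ?_
  have hF : StronglyMeasurable fun p : (ℝ × State Θ d) × Θ =>
      g (max p.1.1 0) (p.2, p.1.2.2) - g (max p.1.1 0) p.1.2 := by
    refine Measurable.stronglyMeasurable (Measurable.sub ?_ ?_)
    · exact hg.measurable.comp (f := fun p : (ℝ × State Θ d) × Θ => (p.1.1, (p.2, p.1.2.2)))
        (by fun_prop)
    · exact hg.measurable.comp measurable_fst
  exact (StronglyMeasurable.integral_kernel_prod_right'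
    (κ := C.Q.comap (Prod.snd : ℝ × State Θ d → _) measurable_snd) hF).measurable

theorem abs_opS_le (hg : IsBoundedC1 g) {K : ℝ} (hK : ∀ t, 0 ≤ t → ∀ x, |g t x| ≤ K) {t : ℝ}
    (ht : 0 ≤ t) (x : State Θ d) : |opS C g t x| ≤ C.bound * (2 * K) := by
  have := C.isMarkovKernel_Q
  rw [opS_eq_integral_Q hg ht, abs_mul, abs_of_pos (C.rate_pos x)]
  refine mul_le_mul (C.rate_le_bound x) ?_ (abs_nonneg _) (C.bound_pos x).le
  have := norm_integral_le_of_norm_le_const (μ := C.Q x) (C := 2 * K)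
    (f := fun θ => g t (θ, x.2) - g t x) (ae_of_all _ fun θ => by
      have h1 := abs_le.1 (hK t ht (θ, x.2))
      have h2 := abs_le.1 (hK t ht x)
      rw [Real.norm_eq_abs, abs_le]
      constructor <;> linarith)
  simpa using this

end Regularity

/-! ### Integration against locally finite sums of Dirac masses. -/

section PointMeasures

variable {α ι : Type*} [MeasurableSpace α] [MeasurableSingletonClass α]

-- Only finitely many masses charge `S`, so the restricted measure is a finite sum of Dirac masses.
-- Every function is then integrable, and no regularity of `φ` enters.
open Classical in
theorem integrableOn_sum_dirac {p : ι → Prop} [DecidablePred p] {z : ι → α} {S : Set α} (hS : MeasurableSet S)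
    (hfin : {i | p i ∧ z i ∈ S}.Finite) (φ : α → ℝ) :
    IntegrableOn φ S (Measure.sum fun i => if p i then Measure.dirac (z i) else 0) ∧
      ∫ a in S, φ a ∂(Measure.sum fun i => if p i then Measure.dirac (z i) else 0) =
        ∑' i, if p i ∧ z i ∈ S then φ (z i) else 0 := by
  have hres : (Measure.sum fun i => if p i then Measure.dirac (z i) else 0).restrict S =
      ∑ i ∈ hfin.toFinset, Measure.dirac (z i) := by
    ext A hA
    rw [Measure.restrict_apply hA, Measure.sum_apply _ (hA.inter hS), Measure.finsetSum_apply,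
      tsum_eq_sum (s := hfin.toFinset)]
    · refine Finset.sum_congr rfl fun i hi => ?_
      have hi' : p i ∧ z i ∈ S := by simpa using hi
      rw [if_pos hi'.1, Measure.dirac_apply' _ (hA.inter hS), Measure.dirac_apply' _ hA]
      simp [indicator, hi'.2]
    · intro i hi
      split_ifs with h
      · have : z i ∉ S := fun h' => hi (by simpa using ⟨h, h'⟩)
        rw [Measure.dirac_apply' _ (hA.inter hS)]
        simp [this]
      · simp
  have hinteg : ∀ i ∈ hfin.toFinset, Integrable φ (Measure.dirac (z i)) := fun i _ =>
    integrable_dirac (by simp)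
  rw [IntegrableOn, hres, integral_finsetSum_measure hinteg]
  refine ⟨integrable_finsetSum_measure.2 hinteg, ?_⟩
  rw [tsum_eq_sum (s := hfin.toFinset)]
  · refine Finset.sum_congr rfl fun i hi => ?_
    have hi' : p i ∧ z i ∈ S := by simpa using hi
    rw [if_pos hi', integral_dirac]
  · intro i hi
    rw [if_neg (fun h => hi (by simpa using h))]

end PointMeasures

/-! ### The integrals against `p` and `p'` along one path. -/

section Path

variable {Θ : Type*} {d : ℕ} [MeasurableSpace Θ] {C : JumpCharacteristics Θ d}
  {Φ : FlowFamily Θ d} {x₀ : State Θ d} {w : NoisePath}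

/-- Just to the left of `s` the process still follows the trajectory of the `k`-th piece, which is
continuous. The case `s = T*_{k+1}` is included: there the left limit is the state before the
possible jump. -/
theorem leftLim_process [TopologicalSpace Θ] [DiscreteTopology Θ] (hw : w.IsCounting)
    (hΦ : IsRegularFlow Φ) {k : ℕ} {s : ℝ} (h1 : w.T k < s) (h2 : s ≤ w.T (k + 1)) :
    Function.leftLim (process C Φ x₀ w) s = flowFrom Φ (thinned C Φ x₀ w k).2 s := by
  refine leftLim_eq_of_tendsto ?_
  have hc := (flowFrom_continuous hΦ (thinned C Φ x₀ w k).2).tendsto s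
  refine (hc.mono_left nhdsWithin_le_nhds).congr' ?_
  filter_upwards [Ioo_mem_nhdsLT h1] with r hr
  exact (process_eq_flowFrom hw hr.1.le (hr.2.trans_le h2)).symm

theorem leftLim_process_eq_process [TopologicalSpace Θ] [DiscreteTopology Θ] (hw : w.IsCounting)
    (hΦ : IsRegularFlow Φ) {s : ℝ} (hs : 0 ≤ s) (h : s ∉ range w.T) :
    Function.leftLim (process C Φ x₀ w) s = process C Φ x₀ w s := by
  obtain ⟨k, h1, h2⟩ := hw.exists_mem_Ico hs
  have h1' : w.T k < s := lt_of_le_of_ne h1 fun h' => h ⟨k, h'⟩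
  rw [leftLim_process hw hΦ h1' h2.le, process_eq_flowFrom hw h1 h2]

theorem finite_points_le (hw : w.IsCounting) (t : ℝ) : {k | w.T (k + 1) ≤ t}.Finite := by
  obtain ⟨N, hN⟩ := (hw.tendsto.eventually_gt_atTop t).exists
  refine (finite_lt_nat N).subset fun k hk => ?_
  by_contra hlt
  exact absurd (hN.trans_le ((hw.strictMono.monotone (by simp at hlt; omega)).trans hk))
    (lt_irrefl _)

variable (C Φ x₀ w) in
open Classical in
/-- The increment of `g(t, x_t)` at the `(k+1)`-st Poisson point. -/
def jumpSize (g : ℝ → State Θ d → ℝ) (k : ℕ) : ℝ :=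
  if Accepts C Φ x₀ w k then g (w.T (k + 1)) (thinned C Φ x₀ w (k + 1)).2.2 -
    g (w.T (k + 1)) (flowFrom Φ (thinned C Φ x₀ w k).2 (w.T (k + 1))) else 0

-- There are finitely many points in `]0, t]`, and at an accepted one the left limit is the end of
-- the old trajectory, so the integrand there is the jump size.
open Classical in
theorem integral_jumpMeasure [TopologicalSpace Θ] [DiscreteTopology Θ]
    [MeasurableSingletonClass Θ] (hw : w.IsCounting)
    (hΦ : IsRegularFlow Φ) (g : ℝ → State Θ d → ℝ) (t : ℝ) :
    IntegrableOn (jumpIntegrand C Φ x₀ w g) (Ioc 0 t ×ˢ univ) (jumpMeasure C Φ x₀ w) ∧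
      ∫ z in Ioc 0 t ×ˢ univ, jumpIntegrand C Φ x₀ w g z ∂(jumpMeasure C Φ x₀ w) =
        ∑' k, if w.T (k + 1) ≤ t then jumpSize C Φ x₀ w g k else 0 := by
  have hpos : ∀ k, 0 < w.T (k + 1) := fun k => by
    rw [← hw.zero]; exact hw.strictMono k.succ_pos
  have hfin : {k | Accepts C Φ x₀ w k ∧ (w.T (k + 1), (thinned C Φ x₀ w (k + 1)).2.2) ∈
      Ioc 0 t ×ˢ (univ : Set (State Θ d))}.Finite :=
    (finite_points_le hw t).subset fun k hk => hk.2.1.2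
  have := integrableOn_sum_dirac (measurableSet_Ioc.prod MeasurableSet.univ) hfin
    (jumpIntegrand C Φ x₀ w g)
  rw [jumpMeasure_eq_sum hw]
  refine ⟨this.1, this.2.trans (tsum_congr fun k => ?_)⟩
  simp only [mem_prod, mem_univ, and_true, mem_Ioc, hpos, true_and]
  by_cases h : Accepts C Φ x₀ w k
  · simp only [h, true_and, jumpSize, if_true]
    split_ifs
    · rw [jumpIntegrand, leftLim_process hw hΦ (hw.strictMono k.lt_succ_self) le_rfl]
    · rfl
  · simp [h, jumpSize]

variable [DiscreteMeasurableSpace Θ] [Countable Θ]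

/-- The path is a countable gluing of measurable trajectories, the piece being chosen by the first
`k` with `max s 0 < T*_{k+1}`. -/
theorem measurable_process (hw : w.IsCounting) (hΦ : IsRegularFlow Φ) :
    Measurable fun s => process C Φ x₀ w (max s 0) := by
  classical
  have hex : ∀ s : ℝ, ∃ k, max s 0 < w.T (k + 1) := fun s => by
    obtain ⟨k, -, hk⟩ := hw.exists_mem_Ico (le_max_right s 0)
    exact ⟨k, hk⟩
  have hm := Measurable.find (f := fun k s => flowFrom Φ (thinned C Φ x₀ w k).2 (max s 0))
    (p := fun k s => max s 0 < w.T (k + 1))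
    (fun k => (measurable_flowFrom hΦ).comp
      (f := fun s : ℝ => ((thinned C Φ x₀ w k).2, max s 0)) (by fun_prop))
    (fun k => measurableSet_lt (by fun_prop) measurable_const) hex
  convert hm using 2 with s
  refine process_eq_flowFrom hw ?_ (Nat.find_spec (hex s))
  rcases Nat.eq_zero_or_pos (Nat.find (hex s)) with h | h
  · rw [h, hw.zero]; exact le_max_right _ _
  · obtain ⟨k, hk⟩ := Nat.exists_eq_succ_of_ne_zero h.ne'
    rw [hk]
    exact not_lt.1 (Nat.find_min (hex s) (by omega))

variable {g : ℝ → State Θ d → ℝ}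

theorem intervalIntegrable_opS (hw : w.IsCounting) (hΦ : IsRegularFlow Φ) (hg : IsBoundedC1 g)
    {a b : ℝ} (ha : 0 ≤ a) (hb : 0 ≤ b) :
    IntervalIntegrable (fun s => opS C g s (process C Φ x₀ w s)) volume a b := by
  obtain ⟨K, -, hK⟩ := hg.exists_bound
  have hm : Measurable fun s => opS C g (max s 0) (process C Φ x₀ w (max s 0)) :=
    (measurable_opS hg).comp (measurable_id.prodMk (measurable_process hw hΦ))
  have : IntervalIntegrable (fun s => opS C g (max s 0) (process C Φ x₀ w (max s 0)))
      volume a b := by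
    refine (intervalIntegrable_const (c := C.bound * (2 * K))).mono_fun hm.aestronglyMeasurable
      (ae_of_all _ fun s => ?_)
    simp only [Real.norm_eq_abs]
    exact (abs_opS_le hg hK (le_max_right _ _) _).trans (le_abs_self _)
  refine this.congr ?_
  intro s hs
  have : 0 ≤ s := (le_min ha hb).trans hs.1.le
  simp only [max_eq_left this]

/-- The compensator as the image of a semi-direct product. -/
theorem compensator_eq_map (hw : w.IsCounting) (hΦ : IsRegularFlow Φ) :
    compensator C Φ x₀ w =
      ((((volume.restrict (Ici (0 : ℝ))).withDensity fun s =>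
        ENNReal.ofReal (C.rate (process C Φ x₀ w (max s 0)))) ⊗ₘ
          (C.Q.comap (fun s => process C Φ x₀ w (max s 0)) (measurable_process hw hΦ))).map
        fun z : ℝ × Θ => (z.1, (z.2, (process C Φ x₀ w (max z.1 0)).2))) := by
  have := C.isMarkovKernel_Q
  have hX := measurable_process (C := C) (x₀ := x₀) hw hΦ
  have hF : Measurable fun z : ℝ × Θ => (z.1, (z.2, (process C Φ x₀ w (max z.1 0)).2)) :=
    measurable_fst.prodMk (measurable_snd.prodMk (hX.comp measurable_fst).snd)
  have hrate : Measurable fun s => ENNReal.ofReal (C.rate (process C Φ x₀ w (max s 0))) :=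
    (C.measurable_rate.comp hX).ennreal_ofReal
  have hval : ∀ s A, MeasurableSet A → (ENNReal.ofReal (C.rate (process C Φ x₀ w (max s 0))) •
        (C.QE (process C Φ x₀ w (max s 0))).map fun y => (s, y)) A =
      ENNReal.ofReal (C.rate (process C Φ x₀ w (max s 0))) *
        C.Q (process C Φ x₀ w (max s 0)) (Prod.mk s ⁻¹'
          ((fun z : ℝ × Θ => (z.1, (z.2, (process C Φ x₀ w (max z.1 0)).2))) ⁻¹' A)) := by
    intro s A hA
    rw [Measure.smul_apply, smul_eq_mul, Measure.map_apply measurable_prodMk_left hA,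
      JumpCharacteristics.QE, Measure.map_apply (by fun_prop) (measurable_prodMk_left hA)]
    rfl
  have hker : Measurable fun s => Kernel.comap C.Q _ hX s := Kernel.measurable _
  have hmeas : ∀ A, MeasurableSet A → Measurable fun s =>
      C.Q (process C Φ x₀ w (max s 0)) (Prod.mk s ⁻¹'
          ((fun z : ℝ × Θ => (z.1, (z.2, (process C Φ x₀ w (max z.1 0)).2))) ⁻¹' A)) :=
    fun A hA => Kernel.measurable_kernel_prodMk_left (κ := C.Q.comap _ hX) (hF hA)
  rw [compensator, Measure.bind_congr_right (g := fun s =>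
    ENNReal.ofReal (C.rate (process C Φ x₀ w (max s 0))) •
      (C.QE (process C Φ x₀ w (max s 0))).map fun y => (s, y))]
  · ext A hA
    rw [Measure.bind_apply hA, Measure.map_apply hF hA, Measure.compProd_apply (hF hA),
      lintegral_withDensity_eq_lintegral_mul _ hrate]
    · exact lintegral_congr fun s => hval s A hA
    · exact hmeas A hA
    · refine Measurable.aemeasurable (Measure.measurable_of_measurable_coe _ fun A hA => ?_)
      simp only [hval _ A hA]
      exact hrate.mul (hmeas A hA)
  · filter_upwards [ae_restrict_mem measurableSet_Ici] with s hs
    rw [max_eq_left (mem_Ici.1 hs)]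

theorem compensator_prod_univ_le (hw : w.IsCounting) (hΦ : IsRegularFlow Φ) {S : Set ℝ}
    (hS : MeasurableSet S) :
    compensator C Φ x₀ w (S ×ˢ univ) ≤ ENNReal.ofReal C.bound * volume S := by
  have := C.isMarkovKernel_Q
  have hX := measurable_process (C := C) (x₀ := x₀) hw hΦ
  have hF : Measurable fun z : ℝ × Θ => (z.1, (z.2, (process C Φ x₀ w (max z.1 0)).2)) :=
    measurable_fst.prodMk (measurable_snd.prodMk (hX.comp measurable_fst).snd)
  rw [compensator_eq_map hw hΦ, Measure.map_apply hF (hS.prod MeasurableSet.univ)]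
  have : (fun z : ℝ × Θ => (z.1, (z.2, (process C Φ x₀ w (max z.1 0)).2))) ⁻¹' (S ×ˢ univ) =
      S ×ˢ univ := by ext; simp
  rw [this, Measure.compProd_apply_prod hS MeasurableSet.univ]
  simp only [measure_univ, lintegral_one, Measure.restrict_apply MeasurableSet.univ, univ_inter]
  rw [withDensity_apply _ hS]
  calc ∫⁻ a in S, ENNReal.ofReal (C.rate (process C Φ x₀ w (max a 0))) ∂volume.restrict (Ici 0)
      ≤ ∫⁻ _ in S, ENNReal.ofReal C.bound ∂volume.restrict (Ici 0) :=
        lintegral_mono fun a => ENNReal.ofReal_le_ofReal (C.rate_le_bound _)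
    _ = ENNReal.ofReal C.bound * volume.restrict (Ici 0) S := by
        rw [setLIntegral_const]
    _ ≤ ENNReal.ofReal C.bound * volume S := by
        gcongr
        exact Measure.restrict_le_self

/-- The time marginal of the compensator is dominated by a multiple of Lebesgue measure, so the
countable set of Poisson points is null and off it the left limit is the value itself. The bounded
integrand that remains is integrated by disintegration: the rate times the integral against `Q` is
`𝒮g`. -/
theorem integral_compensator [TopologicalSpace Θ] [DiscreteTopology Θ]
    (hw : w.IsCounting) (hΦ : IsRegularFlow Φ) (hg : IsBoundedC1 g) {t : ℝ} (ht : 0 ≤ t) :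
    IntegrableOn (jumpIntegrand C Φ x₀ w g) (Ioc 0 t ×ˢ univ) (compensator C Φ x₀ w) ∧
      ∫ z in Ioc 0 t ×ˢ univ, jumpIntegrand C Φ x₀ w g z ∂(compensator C Φ x₀ w) =
        ∫ s in (0 : ℝ)..t, opS C g s (process C Φ x₀ w s) := by
  have := C.isMarkovKernel_Q
  obtain ⟨K, hK0, hK⟩ := hg.exists_bound
  have hX := measurable_process (C := C) (x₀ := x₀) hw hΦ
  have hF : Measurable fun z : ℝ × Θ => (z.1, (z.2, (process C Φ x₀ w (max z.1 0)).2)) :=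
    measurable_fst.prodMk (measurable_snd.prodMk (hX.comp measurable_fst).snd)
  have hrate : Measurable fun s => ENNReal.ofReal (C.rate (process C Φ x₀ w (max s 0))) :=
    (C.measurable_rate.comp hX).ennreal_ofReal
  have hS : MeasurableSet (Ioc 0 t ×ˢ (univ : Set (State Θ d))) :=
    measurableSet_Ioc.prod MeasurableSet.univ
  set φ : ℝ × State Θ d → ℝ := fun z =>
    g (max z.1 0) z.2 - g (max z.1 0) (process C Φ x₀ w (max z.1 0)) with hφ
  have hφm : Measurable φ := hg.measurable.sub
    (hg.measurable.comp (measurable_fst.prodMk (hX.comp measurable_fst)))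
  have hφb : ∀ z, ‖φ z‖ ≤ 2 * K := fun z => by
    have h1 := abs_le.1 (hK _ (le_max_right z.1 0) z.2)
    have h2 := abs_le.1 (hK _ (le_max_right z.1 0) (process C Φ x₀ w (max z.1 0)))
    rw [Real.norm_eq_abs, abs_le]
    constructor <;> linarith
  have hnull : compensator C Φ x₀ w (range w.T ×ˢ univ) = 0 := by
    refine le_antisymm ((compensator_prod_univ_le hw hΦ (countable_range _).measurableSet).trans
      ?_) bot_le
    rw [(countable_range w.T).measure_zero, mul_zero]
  have hae : jumpIntegrand C Φ x₀ w g =ᵐ[(compensator C Φ x₀ w).restrict (Ioc 0 t ×ˢ univ)] φ := by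
    rw [Filter.EventuallyEq, ae_restrict_iff' hS]
    have : ∀ᵐ z ∂(compensator C Φ x₀ w), z ∉ range w.T ×ˢ (univ : Set (State Θ d)) :=
      measure_eq_zero_iff_ae_notMem.1 hnull
    filter_upwards [this] with z hz hzS
    have hz0 : 0 ≤ z.1 := hzS.1.1.le
    rw [jumpIntegrand, leftLim_process_eq_process hw hΦ hz0 (fun h => hz ⟨h, mem_univ _⟩), hφ]
    simp only [max_eq_left hz0]
  have hfin : compensator C Φ x₀ w (Ioc 0 t ×ˢ univ) ≠ ⊤ :=
    ne_top_of_le_ne_top (ENNReal.mul_ne_top ENNReal.ofReal_ne_top (by simp))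
      (compensator_prod_univ_le hw hΦ measurableSet_Ioc)
  have hinteg : IntegrableOn φ (Ioc 0 t ×ˢ univ) (compensator C Φ x₀ w) :=
    Measure.integrableOn_of_bounded hfin hφm.aestronglyMeasurable (ae_of_all _ hφb)
  refine ⟨hinteg.congr hae.symm, ?_⟩
  rw [integral_congr_ae hae]
  have hpre : (fun z : ℝ × Θ => (z.1, (z.2, (process C Φ x₀ w (max z.1 0)).2))) ⁻¹'
      (Ioc 0 t ×ˢ univ) = Ioc 0 t ×ˢ univ := by ext; simp
  rw [compensator_eq_map hw hΦ] at hinteg ⊢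
  rw [setIntegral_map hS hφm.aestronglyMeasurable hF.aemeasurable, hpre]
  rw [IntegrableOn, Measure.restrict_map hF hS, integrable_map_measure
    hφm.aestronglyMeasurable hF.aemeasurable, hpre] at hinteg
  simp only [Function.comp_def] at hinteg
  rw [Measure.setIntegral_compProd measurableSet_Ioc MeasurableSet.univ hinteg,
    restrict_withDensity measurableSet_Ioc, integral_withDensity_eq_integral_toReal_smul hrate
      (ae_of_all _ fun _ => ENNReal.ofReal_lt_top), intervalIntegral.integral_of_le ht,
    Measure.restrict_restrict measurableSet_Ioc,
    inter_eq_left.2 (fun s hs => mem_Ici.2 (mem_Ioc.1 hs).1.le)]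
  refine setIntegral_congr_fun measurableSet_Ioc fun s hs => ?_
  have hs0 : 0 ≤ s := hs.1.le
  simp only [hφ, max_eq_left hs0, Measure.restrict_univ, Kernel.comap_apply,
    ENNReal.toReal_ofReal (C.rate_pos _).le, smul_eq_mul]
  rw [opS_eq_integral_Q hg hs0]

end Path

/-! ### Differentiation of `g` along a trajectory. -/

section ChainRule

variable {Θ : Type*} {d : ℕ} {g : ℝ → State Θ d → ℝ}

theorem IsBoundedC1.hasFDerivWithinAt (hg : IsBoundedC1 g) (θ : Θ) {t : ℝ} (ht : 0 ≤ t)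
    (ν : EuclideanSpace ℝ (Fin d)) :
    HasFDerivWithinAt (fun z : ℝ × EuclideanSpace ℝ (Fin d) => g z.1 (θ, z.2))
      (fderivWithin ℝ (fun z : ℝ × EuclideanSpace ℝ (Fin d) => g z.1 (θ, z.2))
        (Ici 0 ×ˢ univ) (t, ν)) (Ici 0 ×ˢ univ) (t, ν) :=
  ((hg.contDiffOn θ).differentiableOn one_ne_zero (t, ν)
    ⟨mem_Ici.2 ht, mem_univ _⟩).hasFDerivWithinAt

/-- Both partial derivatives are evaluations of one derivative within the closed half-space. This
transfers its continuity to them and combines them linearly in the chain rule. -/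
theorem IsBoundedC1.dt_eq (hg : IsBoundedC1 g) (θ : Θ) {t : ℝ} (ht : 0 ≤ t)
    (ν : EuclideanSpace ℝ (Fin d)) :
    dt g t (θ, ν) = fderivWithin ℝ (fun z : ℝ × EuclideanSpace ℝ (Fin d) => g z.1 (θ, z.2))
        (Ici 0 ×ˢ univ) (t, ν) (1, 0) := by
  have h1 : HasDerivWithinAt (fun s : ℝ => (s, ν)) ((1 : ℝ), (0 : EuclideanSpace ℝ (Fin d)))
      (Ici 0) t := (hasDerivWithinAt_id t _).prodMk (hasDerivWithinAt_const t _ ν)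
  have h2 := (hg.hasFDerivWithinAt θ ht ν).comp_hasDerivWithinAt t h1
    (t := Ici 0 ×ˢ univ) (fun s hs => mk_mem_prod hs (mem_univ _))
  exact h2.derivWithin (uniqueDiffOn_Ici 0 t (mem_Ici.2 ht))

theorem IsBoundedC1.dν_eq (hg : IsBoundedC1 g) (θ : Θ) {t : ℝ} (ht : 0 ≤ t)
    (ν y : EuclideanSpace ℝ (Fin d)) :
    dν g t (θ, ν) y = fderivWithin ℝ (fun z : ℝ × EuclideanSpace ℝ (Fin d) => g z.1 (θ, z.2))
        (Ici 0 ×ˢ univ) (t, ν) (0, y) := by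
  have h1 : HasFDerivWithinAt (fun μ : EuclideanSpace ℝ (Fin d) => (t, μ))
      (ContinuousLinearMap.inr ℝ ℝ (EuclideanSpace ℝ (Fin d))) univ ν :=
    (hasFDerivAt_prodMk_right t ν).hasFDerivWithinAt
  have h2 := ((hg.hasFDerivWithinAt θ ht ν).comp ν h1
    (fun s _ => ⟨mem_Ici.2 ht, mem_univ _⟩)).hasFDerivAt univ_mem
  have h3 : dν g t (θ, ν) = _ := h2.fderiv
  rw [h3]
  simp

theorem IsBoundedC1.continuousOn_fderivWithin (hg : IsBoundedC1 g) (θ : Θ) :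
    ContinuousOn (fderivWithin ℝ (fun z : ℝ × EuclideanSpace ℝ (Fin d) => g z.1 (θ, z.2))
        (Ici 0 ×ˢ univ)) (Ici 0 ×ˢ univ) :=
  (hg.contDiffOn θ).continuousOn_fderivWithin ((uniqueDiffOn_Ici 0).prod uniqueDiffOn_univ) le_rfl

theorem IsBoundedC1.hasDerivWithinAt_comp (hg : IsBoundedC1 g) (θ : Θ) {t : ℝ} (ht : 0 ≤ t)
    {y : ℝ → EuclideanSpace ℝ (Fin d)} {y' : EuclideanSpace ℝ (Fin d)}
    (hy : HasDerivWithinAt y y' (Ioi t) t) :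
    HasDerivWithinAt (fun s => g s (θ, y s)) (dt g t (θ, y t) + dν g t (θ, y t) y') (Ioi t) t := by
  have h1 : HasDerivWithinAt (fun s : ℝ => (s, y s)) ((1 : ℝ), y') (Ioi t) t :=
    (hasDerivWithinAt_id t _).prodMk hy
  have h2 := (hg.hasFDerivWithinAt θ ht (y t)).comp_hasDerivWithinAt t h1
    (t := Ici 0 ×ˢ univ)
    (fun s hs => mk_mem_prod (mem_Ici.2 (ht.trans (mem_Ioi.1 hs).le)) (mem_univ _))
  refine h2.congr_deriv ?_
  rw [hg.dt_eq θ ht, hg.dν_eq θ ht, ← map_add]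
  simp

/-- `v` is the right derivative in time of the flow `Φ`, bounded for each `θ`. -/
structure HasVelocity (Φ v : FlowFamily Θ d) : Prop where
  hasDerivWithinAt : ∀ θ ν t, 0 ≤ t → HasDerivWithinAt (fun s => Φ θ s ν) (v θ t ν) (Ioi t) t
  measurable : ∀ θ ν, Measurable fun t => v θ (max t 0) ν
  bounded : ∀ θ, ∃ K : ℝ, ∀ t, 0 ≤ t → ∀ ν, ‖v θ t ν‖ ≤ K

variable {Φ v : FlowFamily Θ d}

/-- The Euler polygon has corners, so only a right derivative is available at every time. The
fundamental theorem of calculus for a continuous function with an integrable right derivative is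
enough. -/
theorem integral_along_flow (hΦ : IsRegularFlow Φ) (hv : HasVelocity Φ v)
    (hg : IsBoundedC1 g) (r : ℝ × State Θ d) {a b : ℝ} (ha : 0 ≤ a) (hra : r.1 ≤ a) (hab : a ≤ b) :
    IntervalIntegrable (fun s => dt g s (flowFrom Φ r s) +
        dν g s (flowFrom Φ r s) (v r.2.1 (s - r.1) r.2.2)) volume a b ∧
      ∫ s in a..b, (dt g s (flowFrom Φ r s) + dν g s (flowFrom Φ r s) (v r.2.1 (s - r.1) r.2.2)) =
        g b (flowFrom Φ r b) - g a (flowFrom Φ r a) := by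
  obtain ⟨K, hK⟩ := hg.bounded_dν
  obtain ⟨K', hK'⟩ := hv.bounded r.2.1
  set y : ℝ → EuclideanSpace ℝ (Fin d) := fun s => Φ r.2.1 (max (s - r.1) 0) r.2.2 with hy
  have hyc : Continuous y := continuous_flowFrom_snd hΦ r
  have hflow : ∀ s, flowFrom Φ r s = (r.2.1, y s) := fun s => rfl
  have hmaps : MapsTo (fun s : ℝ => (s, y s)) (Icc a b) (Ici 0 ×ˢ univ) := fun s hs =>
    ⟨mem_Ici.2 (ha.trans hs.1), mem_univ _⟩
  have hD : ContinuousOn (fun s => fderivWithin ℝ (fun z : ℝ × EuclideanSpace ℝ (Fin d) =>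
      g z.1 (r.2.1, z.2)) (Ici 0 ×ˢ univ) (s, y s)) (Icc a b) :=
    (hg.continuousOn_fderivWithin r.2.1).comp (by fun_prop) hmaps
  have hF : IntervalIntegrable (fun s => dt g s (flowFrom Φ r s) +
        dν g s (flowFrom Φ r s) (v r.2.1 (s - r.1) r.2.2)) volume a b := by
    refine IntervalIntegrable.add ?_ ?_
    · refine ContinuousOn.intervalIntegrable ?_
      rw [uIcc_of_le hab]
      refine (hD.clm_apply (continuousOn_const (c := ((1 : ℝ), (0 : EuclideanSpace ℝ (Fin d))))))
        |>.congr fun s hs => ?_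
      rw [hflow, hg.dt_eq _ (ha.trans hs.1)]
    -- The velocity may be discontinuous in time, so this term is treated as measurable and bounded
    -- rather than continuous.
    · rw [intervalIntegrable_iff_integrableOn_Icc_of_le hab]
      refine Integrable.of_bound (C := K * K') ?_ ?_
      · have h1 : AEStronglyMeasurable (fun s => fderivWithin ℝ
            (fun z : ℝ × EuclideanSpace ℝ (Fin d) => g z.1 (r.2.1, z.2)) (Ici 0 ×ˢ univ) (s, y s)
              ((0 : ℝ), v r.2.1 (max (s - r.1) 0) r.2.2)) (volume.restrict (Icc a b)) := by
          have h2 := hD.aestronglyMeasurable (μ := volume) measurableSet_Icc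
          have h3 : AEStronglyMeasurable (fun s => ((0 : ℝ), v r.2.1 (max (s - r.1) 0) r.2.2))
              (volume.restrict (Icc a b)) := by
            refine Measurable.aestronglyMeasurable (measurable_const.prodMk ?_)
            exact (hv.measurable r.2.1 r.2.2).comp (measurable_id.sub_const r.1)
          exact (ContinuousLinearMap.apply ℝ ℝ).aestronglyMeasurable_comp₂ h3 h2
        refine h1.congr ?_
        filter_upwards [ae_restrict_mem measurableSet_Icc] with s hs
        rw [hflow, hg.dν_eq _ (ha.trans hs.1), max_eq_left (sub_nonneg.2 (hra.trans hs.1))]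
      · filter_upwards [ae_restrict_mem measurableSet_Icc] with s hs
        refine (ContinuousLinearMap.le_opNorm _ _).trans ?_
        exact mul_le_mul (hK s (ha.trans hs.1) _) (hK' _ (sub_nonneg.2 (hra.trans hs.1)) _)
          (norm_nonneg _) ((norm_nonneg _).trans (hK s (ha.trans hs.1) (flowFrom Φ r s)))
  refine ⟨hF, ?_⟩
  refine intervalIntegral.integral_eq_sub_of_hasDeriv_right
    (f := fun s => g s (flowFrom Φ r s)) ?_ ?_ hF
  · rw [uIcc_of_le hab]
    exact (hg.continuousOn r.2.1).comp (by fun_prop) hmaps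
  · rw [min_eq_left hab, max_eq_right hab]
    intro s hs
    have hs0 : 0 ≤ s - r.1 := sub_nonneg.2 (hra.trans hs.1.le)
    have h1 := (hv.hasDerivWithinAt r.2.1 r.2.2 (s - r.1) hs0).scomp s
      (h := fun u => u - r.1) (h' := (1 : ℝ)) ((hasDerivWithinAt_id s (Ioi s)).sub_const r.1)
      (fun u hu => by simpa using hu)
    rw [one_smul] at h1
    have h2 : HasDerivWithinAt y (v r.2.1 (s - r.1) r.2.2) (Ioi s) s := by
      refine h1.congr (fun u hu => ?_) ?_
      · simp only [hy, Function.comp]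
        rw [max_eq_left (hs0.trans (sub_le_sub_right (mem_Ioi.1 hu).le _))]
      · simp only [hy, Function.comp]
        rw [max_eq_left hs0]
    exact hg.hasDerivWithinAt_comp r.2.1 (ha.trans hs.1.le) h2

end ChainRule

/-! ### Change of variables along a path with jumps. -/

section PathwiseIto

variable {Θ : Type*} {d : ℕ} [MeasurableSpace Θ]
  {C : JumpCharacteristics Θ d} {Φ v : FlowFamily Θ d} {x₀ : State Θ d} {w : NoisePath}
  {g : ℝ → State Θ d → ℝ}

variable (C Φ v x₀ w g) in
/-- The derivative of `g(s, x_s)` along the flow between the jumps. -/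
def driftAlong (s : ℝ) : ℝ :=
  dt g s (process C Φ x₀ w s) + dν g s (process C Φ x₀ w s)
    (v (process C Φ x₀ w s).1 (s - lastJump C Φ x₀ w s)
      (postJump C Φ x₀ w (jumpIndex C Φ x₀ w s)).2)

theorem integral_driftAlong_piece (hw : w.IsCounting) (hΦ : IsRegularFlow Φ)
    (hv : HasVelocity Φ v) (hg : IsBoundedC1 g) {k : ℕ} {t : ℝ} (h1 : w.T k ≤ t)
    (h2 : t ≤ w.T (k + 1)) :
    IntervalIntegrable (driftAlong C Φ v x₀ w g) volume (w.T k) t ∧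
      ∫ s in (w.T k)..t, driftAlong C Φ v x₀ w g s =
        g t (flowFrom Φ (thinned C Φ x₀ w k).2 t) -
          g (w.T k) (flowFrom Φ (thinned C Φ x₀ w k).2 (w.T k)) := by
  have h0 : 0 ≤ w.T k := by rw [← hw.zero]; exact hw.strictMono.monotone k.zero_le
  obtain ⟨e1, e2⟩ := integral_along_flow hΦ hv hg (thinned C Φ x₀ w k).2 h0
    (thinned_time_le hw k) h1
  have hae : ∀ᵐ s ∂volume, s ∈ uIoc (w.T k) t →
      dt g s (flowFrom Φ (thinned C Φ x₀ w k).2 s) + dν g s (flowFrom Φ (thinned C Φ x₀ w k).2 s)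
        (v (thinned C Φ x₀ w k).2.2.1 (s - (thinned C Φ x₀ w k).2.1) (thinned C Φ x₀ w k).2.2.2) =
      driftAlong C Φ v x₀ w g s := by
    -- At `T*_{k+1}` the process already follows the next piece; a single time is negligible in the
    -- integral.
    have : ∀ᵐ s ∂(volume : Measure ℝ), s ≠ w.T (k + 1) := by
      simp [ae_iff]
    filter_upwards [this] with s hs hs'
    rw [uIoc_of_le h1] at hs'
    have hlt : s < w.T (k + 1) := lt_of_le_of_ne (hs'.2.trans h2) hs
    rw [driftAlong, process_eq_flowFrom hw hs'.1.le hlt, lastJump_eq hw hs'.1.le hlt,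
      postJump_jumpIndex_eq hw hs'.1.le hlt]
    rfl
  refine ⟨e1.congr_ae ((ae_restrict_iff' measurableSet_uIoc).2 hae), ?_⟩
  rw [← e2]
  exact intervalIntegral.integral_congr_ae (hae.mono fun s hs h => (hs h).symm)

/-- After a rejection the old trajectory simply continues; after an acceptance the new one starts at
this very point from the post-jump location. -/
theorem flowFrom_thinned_succ (hΦ : IsRegularFlow Φ) (k : ℕ) :
    g (w.T (k + 1)) (flowFrom Φ (thinned C Φ x₀ w (k + 1)).2 (w.T (k + 1))) =
      g (w.T (k + 1)) (flowFrom Φ (thinned C Φ x₀ w k).2 (w.T (k + 1))) +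
        jumpSize C Φ x₀ w g k := by
  by_cases h : Accepts C Φ x₀ w k
  · have : (thinned C Φ x₀ w (k + 1)).2.1 = w.T (k + 1) := by rw [thinned_succ_of_accepts h]
    have h2 := flowFrom_self hΦ (thinned C Φ x₀ w (k + 1)).2
    rw [this] at h2
    rw [h2, jumpSize, if_pos h]
    ring
  · rw [thinned_succ_of_not_accepts h, jumpSize, if_neg h, add_zero]

theorem integral_driftAlong_points (hw : w.IsCounting) (hΦ : IsRegularFlow Φ)
    (hv : HasVelocity Φ v) (hg : IsBoundedC1 g) (k : ℕ) :
    IntervalIntegrable (driftAlong C Φ v x₀ w g) volume 0 (w.T k) ∧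
      g (w.T k) (flowFrom Φ (thinned C Φ x₀ w k).2 (w.T k)) =
        g 0 x₀ + (∫ s in (0 : ℝ)..(w.T k), driftAlong C Φ v x₀ w g s) +
          ∑ j ∈ Finset.range k, jumpSize C Φ x₀ w g j := by
  induction k with
  | zero =>
    rw [hw.zero]
    refine ⟨IntervalIntegrable.refl, ?_⟩
    simp [thinned, flowFrom, hΦ.zero]
  | succ k ih =>
    obtain ⟨e1, e2⟩ := integral_driftAlong_piece (C := C) (x₀ := x₀) hw hΦ hv hg (k := k)
      (hw.strictMono k.lt_succ_self).le le_rfl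
    refine ⟨ih.1.trans e1, ?_⟩
    rw [← intervalIntegral.integral_add_adjacent_intervals ih.1 e1, e2,
      flowFrom_thinned_succ (g := g) hΦ, ih.2, Finset.sum_range_succ]
    ring

open Classical in
/-- The change of variables formula along a path. -/
theorem integral_driftAlong (hw : w.IsCounting) (hΦ : IsRegularFlow Φ)
    (hv : HasVelocity Φ v) (hg : IsBoundedC1 g) {t : ℝ} (ht : 0 ≤ t) :
    IntervalIntegrable (driftAlong C Φ v x₀ w g) volume 0 t ∧
      g t (process C Φ x₀ w t) =
        g 0 x₀ + (∫ s in (0 : ℝ)..t, driftAlong C Φ v x₀ w g s) +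
          ∑' k, if w.T (k + 1) ≤ t then jumpSize C Φ x₀ w g k else 0 := by
  obtain ⟨k, h1, h2⟩ := hw.exists_mem_Ico ht
  obtain ⟨e1, e2⟩ := integral_driftAlong_points (C := C) (x₀ := x₀) hw hΦ hv hg k
  obtain ⟨e3, e4⟩ := integral_driftAlong_piece (C := C) (x₀ := x₀) hw hΦ hv hg h1 h2.le
  refine ⟨e1.trans e3, ?_⟩
  have hsum : (∑' j, if w.T (j + 1) ≤ t then jumpSize C Φ x₀ w g j else 0) =
      ∑ j ∈ Finset.range k, jumpSize C Φ x₀ w g j := by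
    rw [tsum_eq_sum (s := Finset.range k)]
    · refine Finset.sum_congr rfl fun j hj => if_pos ?_
      exact (hw.strictMono.monotone (Nat.succ_le_of_lt (Finset.mem_range.1 hj))).trans h1
    · intro j hj
      refine if_neg (not_le.2 (h2.trans_le (hw.strictMono.monotone ?_)))
      simp at hj
      omega
  rw [hsum, process_eq_flowFrom hw h1 h2,
    ← intervalIntegral.integral_add_adjacent_intervals e1 e3, e4, e2]
  ring

end PathwiseIto

/-! ### The Itô formula for a general flow with a velocity. -/

section MartingalePart

variable {Θ : Type*} {d : ℕ} [MeasurableSpace Θ] [DiscreteMeasurableSpace Θ] [Countable Θ]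
  [TopologicalSpace Θ] [DiscreteTopology Θ] {C : JumpCharacteristics Θ d}
  {Φ v : FlowFamily Θ d} {x₀ : State Θ d} {w : NoisePath} {g : ℝ → State Θ d → ℝ}

open Classical in
theorem martingalePart_eq (hw : w.IsCounting) (hΦ : IsRegularFlow Φ) (hg : IsBoundedC1 g) {t : ℝ}
    (ht : 0 ≤ t) :
    martingalePart C Φ x₀ w g t =
      (∑' k, if w.T (k + 1) ≤ t then jumpSize C Φ x₀ w g k else 0) -
        ∫ s in (0 : ℝ)..t, opS C g s (process C Φ x₀ w s) := by
  rw [martingalePart, compensatedIntegral, (integral_jumpMeasure hw hΦ g t).2,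
    (integral_compensator hw hΦ hg ht).2]

/-- The Itô formula along a path. -/
theorem ito_path (hw : w.IsCounting) (hΦ : IsRegularFlow Φ) (hv : HasVelocity Φ v)
    (hg : IsBoundedC1 g) {t : ℝ} (ht : 0 ≤ t) :
    IntervalIntegrable (fun s => driftAlong C Φ v x₀ w g s + opS C g s (process C Φ x₀ w s))
        volume 0 t ∧
      g t (process C Φ x₀ w t) = g 0 x₀ +
        (∫ s in (0 : ℝ)..t, (driftAlong C Φ v x₀ w g s + opS C g s (process C Φ x₀ w s))) +
          martingalePart C Φ x₀ w g t := by
  obtain ⟨e1, e2⟩ := integral_driftAlong (C := C) (x₀ := x₀) hw hΦ hv hg ht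
  have e3 := intervalIntegrable_opS (C := C) (x₀ := x₀) hw hΦ hg le_rfl ht
  refine ⟨e1.add e3, ?_⟩
  rw [martingalePart_eq hw hΦ hg ht, intervalIntegral.integral_add e1 e3, e2]
  ring

end MartingalePart

/-! ### Compensation of one exponential waiting time and its mark. -/

section ExponentialLaw

/-- The compensator of an exponential waiting time. -/
theorem integral_expMeasure {r : ℝ} (hr : 0 < r) {b : ℝ → ℝ} (hb : Integrable b volume) :
    ∫ σ, b σ ∂(expMeasure r) = r * ∫ σ, (∫ ρ in Ioc 0 σ, b ρ) ∂(expMeasure r) := by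
  have := isProbabilityMeasure_expMeasure hr
  -- With the right end open, the condition on `σ` for fixed `ρ > 0` is `σ ∈ Ioi ρ`, the complement
  -- of the set measured by the distribution function.
  have h1 : ∀ σ, ∫ ρ in Ioc 0 σ, b ρ = ∫ ρ, (Ioo 0 σ).indicator b ρ := fun σ => by
    rw [integral_indicator measurableSet_Ioo, integral_Ioc_eq_integral_Ioo]
  simp only [h1]
  have hset : MeasurableSet {z : ℝ × ℝ | 0 < z.2 ∧ z.2 < z.1} :=
    (measurableSet_lt measurable_const measurable_snd).inter
      (measurableSet_lt measurable_snd measurable_fst)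
  have hind : (Function.uncurry fun σ ρ => (Ioo 0 σ).indicator b ρ) =
      {z : ℝ × ℝ | 0 < z.2 ∧ z.2 < z.1}.indicator fun z => b z.2 := by
    ext ⟨σ, ρ⟩
    simp [indicator, mem_Ioo]
  have hinteg : Integrable (Function.uncurry fun σ ρ => (Ioo 0 σ).indicator b ρ)
      ((expMeasure r).prod volume) := by
    rw [hind]
    exact (hb.comp_snd (expMeasure r)).indicator hset
  -- After the exchange the inner integral is the survival probability `e^{-rρ}` times `b ρ`, and `r
  -- e^{-rρ}` is the exponential density: the hazard rate is the constant `r`.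
  rw [integral_integral_swap hinteg]
  have h2 : ∀ ρ, ∫ σ, (Ioo 0 σ).indicator b ρ ∂(expMeasure r) =
      if 0 < ρ then Real.exp (-(r * ρ)) * b ρ else 0 := by
    intro ρ
    by_cases hρ : 0 < ρ
    · have : (fun σ => (Ioo 0 σ).indicator b ρ) = (Ioi ρ).indicator fun _ => b ρ := by
        ext σ
        simp [indicator, mem_Ioo, hρ]
      rw [this, integral_indicator measurableSet_Ioi, setIntegral_const, if_pos hρ, smul_eq_mul]
      congr 1
      have hc := cdf_expMeasure_eq hr ρ
      rw [cdf_eq_real, if_pos hρ.le] at hc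
      rw [← compl_Iic, probReal_compl_eq_one_sub measurableSet_Iic, hc]
      ring
    · have : (fun σ => (Ioo 0 σ).indicator b ρ) = fun _ => 0 := by
        ext σ
        simp [indicator, mem_Ioo, hρ]
      rw [this, integral_zero, if_neg hρ]
  simp only [h2]
  have hdens : expMeasure r = volume.withDensity (exponentialPDF r) := rfl
  have hpdf : Measurable (exponentialPDF r) := (measurable_exponentialPDFReal r).ennreal_ofReal
  rw [hdens, integral_withDensity_eq_integral_toReal_smul hpdf
    (ae_of_all _ fun _ => ENNReal.ofReal_lt_top), ← integral_const_mul]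
  refine integral_congr_ae ?_
  have : ∀ᵐ s ∂(volume : Measure ℝ), s ≠ 0 := by simp [ae_iff]
  filter_upwards [this] with s hs
  rcases lt_or_gt_of_ne hs with h | h
  · rw [exponentialPDF_of_neg h, if_neg (not_lt.2 h.le)]
    simp
  · rw [exponentialPDF_of_nonneg h.le, if_pos h, ENNReal.toReal_ofReal (by positivity),
      smul_eq_mul]
    ring

/-- The law of the noise that decides about the next Poisson point: a waiting time and two
uniform variables. -/
def stepLaw (r : ℝ) : Measure (ℝ × ℝ × ℝ) :=
  (expMeasure r).prod ((volume.restrict (Icc (0 : ℝ) 1)).prod (volume.restrict (Icc (0 : ℝ) 1)))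

instance isProbabilityMeasure_uniform :
    IsProbabilityMeasure (volume.restrict (Icc (0 : ℝ) 1)) := ⟨by simp⟩

theorem isProbabilityMeasure_stepLaw {r : ℝ} (hr : 0 < r) : IsProbabilityMeasure (stepLaw r) := by
  have := isProbabilityMeasure_expMeasure hr
  rw [stepLaw]
  infer_instance

/-- A mark whose mean given the waiting time `σ` is `b σ / r` is compensated by `∫_0^σ b`. -/
theorem integral_stepLaw_eq {r : ℝ} (hr : 0 < r) {J : ℝ × ℝ × ℝ → ℝ} {b : ℝ → ℝ} {K : ℝ}
    (hJ : Measurable J) (hJb : ∀ z, |J z| ≤ K) (hb : Integrable b volume) (hbm : Measurable b)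
    (h : ∀ σ, ∫ z, J (σ, z) ∂((volume.restrict (Icc (0 : ℝ) 1)).prod
      (volume.restrict (Icc (0 : ℝ) 1))) = b σ / r) :
    ∫ z, (J z - ∫ ρ in Ioc 0 z.1, b ρ) ∂(stepLaw r) = 0 := by
  have := isProbabilityMeasure_expMeasure hr
  have := isProbabilityMeasure_stepLaw hr
  have hJi : Integrable J (stepLaw r) :=
    Integrable.of_bound hJ.aestronglyMeasurable K (ae_of_all _ hJb)
  have hsm : StronglyMeasurable fun σ => ∫ ρ in Ioc 0 σ, b ρ := by
    simp only [← integral_indicator (measurableSet_Ioc (α := ℝ))]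
    have hset : MeasurableSet {z : ℝ × ℝ | 0 < z.2 ∧ z.2 ≤ z.1} :=
      (measurableSet_lt measurable_const measurable_snd).inter
        (measurableSet_le measurable_snd measurable_fst)
    have : StronglyMeasurable ({z : ℝ × ℝ | 0 < z.2 ∧ z.2 ≤ z.1}.indicator fun z => b z.2) :=
      ((hbm.comp measurable_snd).indicator hset).stronglyMeasurable
    have heq : (fun σ => ∫ ρ, (Ioc 0 σ).indicator b ρ) = fun σ =>
        ∫ ρ, {z : ℝ × ℝ | 0 < z.2 ∧ z.2 ≤ z.1}.indicator (fun z => b z.2) (σ, ρ) := by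
      funext σ
      refine integral_congr_ae (ae_of_all _ fun ρ => ?_)
      simp [indicator, mem_Ioc]
    rw [heq]
    exact this.integral_prod_right' (ν := volume)
  have hbi : Integrable (fun σ => ∫ ρ in Ioc 0 σ, b ρ) (expMeasure r) := by
    refine Integrable.of_bound hsm.aestronglyMeasurable (∫ ρ, ‖b ρ‖) (ae_of_all _ fun σ => ?_)
    exact (norm_integral_le_integral_norm _).trans
      (setIntegral_le_integral hb.norm (ae_of_all _ fun _ => norm_nonneg _))
  have hbi' : Integrable (fun z : ℝ × ℝ × ℝ => ∫ ρ in Ioc 0 z.1, b ρ) (stepLaw r) :=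
    hbi.comp_fst _
  rw [integral_sub hJi hbi']
  have e1 : ∫ z, J z ∂(stepLaw r) = (∫ σ, b σ ∂(expMeasure r)) / r := by
    rw [stepLaw, integral_prod _ hJi]
    simp only [h]
    rw [integral_div]
  have e2 : ∫ z : ℝ × ℝ × ℝ, (∫ ρ in Ioc 0 z.1, b ρ) ∂(stepLaw r) =
      ∫ σ, (∫ ρ in Ioc 0 σ, b ρ) ∂(expMeasure r) := by
    rw [stepLaw, integral_fun_fst (fun σ => ∫ ρ in Ioc 0 σ, b ρ)]
    simp
  rw [e1, e2, integral_expMeasure hr hb]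
  field_simp
  ring

end ExponentialLaw

/-! ### The mean effect of a proposed jump. -/

section Marks

variable {Θ : Type*} {d : ℕ} [MeasurableSpace Θ]
  {C : JumpCharacteristics Θ d} {Φ : FlowFamily Θ d} {g : ℝ → State Θ d → ℝ}

variable (C g) in
open Classical in
/-- The increment of `g` at a proposed jump at time `t` from the state `y`, decided by the
uniform variables `u` (acceptance) and `v` (new mode). -/
def mark (t : ℝ) (y : State Θ d) (u v : ℝ) : ℝ :=
  if u * C.bound ≤ C.rate y then g (max t 0) (C.H y v, y.2) - g (max t 0) y else 0

theorem abs_mark_le {K : ℝ} (hK0 : 0 ≤ K) (hK : ∀ t, 0 ≤ t → ∀ x, |g t x| ≤ K) (t : ℝ)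
    (y : State Θ d) (u v : ℝ) : |mark C g t y u v| ≤ 2 * K := by
  rw [mark]
  split_ifs
  · have h1 := abs_le.1 (hK _ (le_max_right t 0) (C.H y v, y.2))
    have h2 := abs_le.1 (hK _ (le_max_right t 0) y)
    rw [abs_le]
    constructor <;> linarith
  · simpa using hK0

variable [DiscreteMeasurableSpace Θ] [Countable Θ]

theorem measurable_mark (hg : IsBoundedC1 g) :
    Measurable fun z : (ℝ × State Θ d) × ℝ × ℝ => mark C g z.1.1 z.1.2 z.2.1 z.2.2 := by
  unfold mark
  refine Measurable.ite ?_ (Measurable.sub ?_ ?_) measurable_const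
  · exact measurableSet_le (measurable_snd.fst.mul_const _)
      (C.measurable_rate.comp measurable_fst.snd)
  · have hH : Measurable fun z : (ℝ × State Θ d) × ℝ × ℝ => C.H z.1.2 z.2.2 :=
      C.measurable_H.comp (measurable_fst.snd.prodMk measurable_snd.snd)
    exact hg.measurable.comp (measurable_fst.fst.prodMk (hH.prodMk measurable_fst.snd.snd))
  · exact hg.measurable.comp measurable_fst

/-- The two uniform variables are independent. The first accepts with probability `λ(y)/λ*`, a
number in `[0, 1]` because `λ ≤ λ*`; the second yields a mode of law `Q(y, ·)` by `map_H`. The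
integral is the product of the two means. -/
theorem integral_mark (hg : IsBoundedC1 g) (t : ℝ) (y : State Θ d) :
    ∫ z : ℝ × ℝ, mark C g t y z.1 z.2 ∂((volume.restrict (Icc (0 : ℝ) 1)).prod
      (volume.restrict (Icc (0 : ℝ) 1))) = opS C g (max t 0) y / C.bound := by
  classical
  have hpos := C.bound_pos y
  have h1 : (fun z : ℝ × ℝ => mark C g t y z.1 z.2) = fun z =>
      (Iic (C.rate y / C.bound)).indicator (fun _ => (1 : ℝ)) z.1 *
        (g (max t 0) (C.H y z.2, y.2) - g (max t 0) y) := by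
    ext z
    simp only [mark, indicator, mem_Iic, le_div_iff₀ hpos]
    split_ifs <;> simp
  rw [h1, integral_prod_mul (fun u => (Iic (C.rate y / C.bound)).indicator (fun _ => (1 : ℝ)) u)
    (fun v => g (max t 0) (C.H y v, y.2) - g (max t 0) y)]
  have h2 : ∫ u, (Iic (C.rate y / C.bound)).indicator (fun _ => (1 : ℝ)) u
      ∂(volume.restrict (Icc (0 : ℝ) 1)) = C.rate y / C.bound := by
    have hle : C.rate y / C.bound ≤ 1 := (div_le_one hpos).2 (C.rate_le_bound y)
    have hset : Iic (C.rate y / C.bound) ∩ Icc 0 1 = Icc 0 (C.rate y / C.bound) := by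
      ext u
      simp only [mem_inter_iff, mem_Iic, mem_Icc]
      constructor
      · rintro ⟨h1, h2, -⟩; exact ⟨h2, h1⟩
      · rintro ⟨h1, h2⟩; exact ⟨h2, h1, h2.trans hle⟩
    rw [integral_indicator measurableSet_Iic, Measure.restrict_restrict measurableSet_Iic, hset]
    simp [(C.rate_pos y).le, hpos.le, div_nonneg]
  have h3 : ∫ v, (g (max t 0) (C.H y v, y.2) - g (max t 0) y) ∂(volume.restrict (Icc (0 : ℝ) 1)) =
      ∫ θ, (g (max t 0) (θ, y.2) - g (max t 0) y) ∂(C.Q y) := by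
    have hm : Measurable (C.H y) := C.measurable_H.comp measurable_prodMk_left
    rw [← C.map_H y, integral_map hm.aemeasurable]
    exact (measurable_of_countable _).aestronglyMeasurable
  rw [h2, h3, opS_eq_integral_Q hg (le_max_right _ _)]
  ring

end Marks

/-! ### Independence of the past and the noise of the next step. -/

section Noise

variable {Ω : Type*} {mΩ : MeasurableSpace Ω} {P : Measure Ω} {lam : ℝ} {W : Ω → NoisePath}

theorem IsThinningNoise.isCounting (hW : IsThinningNoise P lam W) (ω : Ω) : (W ω).IsCounting :=
  ⟨hW.T_zero ω, hW.T_strictMono ω, hW.T_tendsto ω⟩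

variable (W) in
/-- The independent variables that make up the noise: the waiting times, the `U_k` and
the `V_k`. -/
def noiseVar (i : Fin 3 × ℕ) (ω : Ω) : ℝ :=
  ![(W ω).T (i.2 + 1) - (W ω).T i.2, (W ω).U (i.2 + 1), (W ω).V (i.2 + 1)] i.1

theorem IsThinningNoise.measurable_time (hW : IsThinningNoise P lam W) (k : ℕ) :
    Measurable fun ω => (W ω).T k := by
  cases k with
  | zero => simp only [hW.T_zero]; exact measurable_const
  | succ k => exact hW.measurable_T k

theorem IsThinningNoise.measurable_noiseVar (hW : IsThinningNoise P lam W) (i : Fin 3 × ℕ) :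
    Measurable (noiseVar W i) := by
  obtain ⟨i, j⟩ := i
  fin_cases i
  · exact (hW.measurable_T j).sub (hW.measurable_time j)
  · exact hW.measurable_U j
  · exact hW.measurable_V j

/-- The variables that are used up to the `k`-th Poisson point when `n` points are accepted. -/
def pastIndices (k n : ℕ) : Set (Fin 3 × ℕ) := {i | i.2 < if i.1 = 2 then n else k}

variable (W) in
/-- The σ-algebra of `T*_j`, `U_j` for `j ≤ k` and `V_j` for `j ≤ n`. -/
@[reducible]
def pastSigma (k n : ℕ) : MeasurableSpace Ω :=
  ⨆ i ∈ pastIndices k n, MeasurableSpace.comap (noiseVar W i) inferInstance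

theorem pastSigma_mono {k n k' n' : ℕ} (hk : k ≤ k') (hn : n ≤ n') :
    pastSigma W k n ≤ pastSigma W k' n' := by
  refine biSup_mono fun i hi => ?_
  simp only [pastIndices, mem_ofPred_eq] at hi ⊢
  split_ifs at hi ⊢ <;> omega

theorem IsThinningNoise.pastSigma_le (hW : IsThinningNoise P lam W) (k n : ℕ) :
    pastSigma W k n ≤ mΩ :=
  iSup₂_le fun i _ => (hW.measurable_noiseVar i).comap_le

theorem measurable_noiseVar_pastSigma {k n : ℕ} {i : Fin 3 × ℕ} (hi : i ∈ pastIndices k n) :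
    Measurable[pastSigma W k n] (noiseVar W i) :=
  Measurable.of_comap_le (le_biSup (fun i => MeasurableSpace.comap (noiseVar W i) inferInstance) hi)

theorem IsThinningNoise.measurable_time_pastSigma (hW : IsThinningNoise P lam W) {j k : ℕ} (n : ℕ)
    (hj : j ≤ k) : Measurable[pastSigma W k n] fun ω => (W ω).T j := by
  induction j with
  | zero => simp only [hW.T_zero]; exact measurable_const
  | succ j ih =>
    have h1 := ih (by omega)
    have h2 : Measurable[pastSigma W k n] (noiseVar W (0, j)) :=
      measurable_noiseVar_pastSigma (by simp [pastIndices]; omega)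
    have h3 : (fun ω => (W ω).T (j + 1)) = fun ω => (W ω).T j + noiseVar W (0, j) ω := by
      ext ω
      simp [noiseVar]
    rw [h3]
    exact h1.add h2

theorem measurable_U_pastSigma {j k : ℕ} (n : ℕ) (hj : j < k) :
    Measurable[pastSigma W k n] fun ω => (W ω).U (j + 1) :=
  measurable_noiseVar_pastSigma (i := (1, j)) (by simpa [pastIndices] using hj)

theorem measurable_V_pastSigma {j n : ℕ} (k : ℕ) (hj : j < n) :
    Measurable[pastSigma W k n] fun ω => (W ω).V (j + 1) :=
  measurable_noiseVar_pastSigma (i := (2, j)) (by simpa [pastIndices] using hj)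

variable (W) in
/-- The noise that decides about the `(k+1)`-st Poisson point when `n` points were accepted. -/
def stepNoise (k n : ℕ) (ω : Ω) : ℝ × ℝ × ℝ :=
  (noiseVar W (0, k) ω, noiseVar W (1, k) ω, noiseVar W (2, n) ω)

/-- The indices `(0, k)`, `(1, k)`, `(2, n)` are the first ones outside `pastIndices k n`, and
σ-algebras generated by disjoint blocks of an independent family are independent. -/
theorem IsThinningNoise.indepFun_stepNoise (hW : IsThinningNoise P lam W) {α : Type*}
    {mα : MeasurableSpace α} {k n : ℕ} {X : Ω → α} (hX : Measurable[pastSigma W k n] X) :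
    IndepFun X (stepNoise W k n) P := by
  have hdisj : Disjoint (pastIndices k n) ({(0, k), (1, k), (2, n)} : Set (Fin 3 × ℕ)) := by
    rw [Set.disjoint_right]
    rintro i (rfl | rfl | rfl) <;> simp [pastIndices]
  have hind : iIndepFun (noiseVar W) P := hW.indep
  have h := indep_iSup_of_disjoint (fun i => (hW.measurable_noiseVar i).comap_le)
    ((iIndepFun_iff_iIndep _ _ _).1 hind) hdisj
  rw [IndepFun_iff_Indep]
  refine indep_of_indep_of_le_left (indep_of_indep_of_le_right h ?_) hX.comap_le
  have hi : ∀ i ∈ ({(0, k), (1, k), (2, n)} : Set (Fin 3 × ℕ)),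
      Measurable[⨆ i ∈ ({(0, k), (1, k), (2, n)} : Set (Fin 3 × ℕ)),
        MeasurableSpace.comap (noiseVar W i) inferInstance] (noiseVar W i) := fun i hi =>
    Measurable.of_comap_le
      (le_biSup (fun i => MeasurableSpace.comap (noiseVar W i) inferInstance) hi)
  refine Measurable.comap_le ?_
  exact (hi _ (by simp)).prodMk ((hi _ (by simp)).prodMk (hi _ (by simp)))

variable [IsProbabilityMeasure P]

theorem IsThinningNoise.map_stepNoise (hW : IsThinningNoise P lam W) (k n : ℕ) :
    P.map (stepNoise W k n) = stepLaw lam := by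
  have hind : iIndepFun (noiseVar W) P := hW.indep
  have hm := hW.measurable_noiseVar
  have h1 : IndepFun (noiseVar W (0, k)) (fun ω => (noiseVar W (1, k) ω, noiseVar W (2, n) ω)) P :=
    (hind.indepFun_prodMk hm (1, k) (2, n) (0, k) (by simp) (by simp)).symm
  have h2 : IndepFun (noiseVar W (1, k)) (noiseVar W (2, n)) P := hind.indepFun (by simp)
  have h3 := (indepFun_iff_map_prod_eq_prod_map_map (hm _).aemeasurable (hm _).aemeasurable).1 h2
  have h4 := (indepFun_iff_map_prod_eq_prod_map_map (hm _).aemeasurable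
    ((hm _).prodMk (hm _)).aemeasurable).1 h1
  have e0 : P.map (noiseVar W (0, k)) = expMeasure lam := (hW.law_T k).map_eq
  have e1 : P.map (noiseVar W (1, k)) = volume.restrict (Icc (0 : ℝ) 1) := (hW.law_U k).map_eq
  have e2 : P.map (noiseVar W (2, n)) = volume.restrict (Icc (0 : ℝ) 1) := (hW.law_V n).map_eq
  rw [h3, e0, e1, e2] at h4
  exact h4

/-- Averaging over the noise of the next step, which is independent of the past. -/
theorem IsThinningNoise.integral_step_eq_zero (hW : IsThinningNoise P lam W) {α : Type*}
    {mα : MeasurableSpace α} {k n : ℕ} {X : Ω → α} (hX : Measurable[pastSigma W k n] X)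
    {F : α × ℝ × ℝ × ℝ → ℝ} (hF : Measurable F)
    (hinteg : Integrable (fun ω => F (X ω, stepNoise W k n ω)) P)
    (h0 : ∀ a, ∫ z, F (a, z) ∂(stepLaw lam) = 0) :
    ∫ ω, F (X ω, stepNoise W k n ω) ∂P = 0 := by
  have hXm : Measurable X := hX.mono (hW.pastSigma_le k n) le_rfl
  have hS : Measurable (stepNoise W k n) := (hW.measurable_noiseVar _).prodMk
    ((hW.measurable_noiseVar _).prodMk (hW.measurable_noiseVar _))
  have hlaw := (indepFun_iff_map_prod_eq_prod_map_map hXm.aemeasurable hS.aemeasurable).1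
    (hW.indepFun_stepNoise hX)
  have hprob : IsProbabilityMeasure (P.map (stepNoise W k n)) :=
    Measure.isProbabilityMeasure_map hS.aemeasurable
  have hinteg' : Integrable F (P.map fun ω => (X ω, stepNoise W k n ω)) :=
    (integrable_map_measure hF.aestronglyMeasurable (hXm.prodMk hS).aemeasurable).2 hinteg
  rw [← integral_map (φ := fun ω => (X ω, stepNoise W k n ω)) (hXm.prodMk hS).aemeasurable
    hF.aestronglyMeasurable]
  rw [hlaw] at hinteg' ⊢
  rw [integral_prod _ hinteg', hW.map_stepNoise]
  simp [h0]

end Noise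

/-! ### The history up to the `k`-th Poisson point. -/

section PointFiltration

variable {Θ : Type*} {d : ℕ} [MeasurableSpace Θ] [DiscreteMeasurableSpace Θ] [Countable Θ]
  {C : JumpCharacteristics Θ d} {Φ : FlowFamily Θ d} {x₀ : State Θ d}
  {Ω : Type*} {mΩ : MeasurableSpace Ω} {P : Measure Ω} {lam : ℝ} {W : Ω → NoisePath}

theorem measurableSet_accept {α : Type*} {mα : MeasurableSpace α} (hΦ : IsRegularFlow Φ)
    {r : α → ℝ × State Θ d} {t u : α → ℝ} (hr : Measurable r) (ht : Measurable t)
    (hu : Measurable u) :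
    MeasurableSet {a | u a * C.bound ≤ C.rate (flowFrom Φ (r a) (t a))} :=
  measurableSet_le (hu.mul_const _)
    (C.measurable_rate.comp ((measurable_flowFrom hΦ).comp (hr.prodMk ht)))

theorem measurable_newState {α : Type*} {mα : MeasurableSpace α} (hΦ : IsRegularFlow Φ)
    {r : α → ℝ × State Θ d} {t v : α → ℝ} (hr : Measurable r) (ht : Measurable t)
    (hv : Measurable v) :
    Measurable fun a => (t a, (C.H (flowFrom Φ (r a) (t a)) (v a),
      (flowFrom Φ (r a) (t a)).2)) := by
  have hf : Measurable fun a => flowFrom Φ (r a) (t a) :=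
    (measurable_flowFrom hΦ).comp (hr.prodMk ht)
  exact ht.prodMk ((C.measurable_H.comp (hf.prodMk hv)).prodMk hf.snd)

variable (C Φ x₀ W) in
open Classical in
/-- The last jump time and location after `k` points, on the event that `n` points were
accepted. -/
def truncated (k n : ℕ) (ω : Ω) : ℝ × State Θ d :=
  if (thinned C Φ x₀ (W ω) k).1 = n then (thinned C Φ x₀ (W ω) k).2 else (0, x₀)

/-- How many `V_j` have been used after `k` points depends on the path, so measurability is shown
separately on each event of `n` acceptances. A count of `n + 1` after `k + 1` points arises from `n
+ 1` by rejection or from `n` by acceptance; only the second way consumes `V_{n+1}`. -/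
theorem measurable_truncated (hW : IsThinningNoise P lam W) (hΦ : IsRegularFlow Φ) (k n : ℕ) :
    MeasurableSet[pastSigma W k n] {ω | (thinned C Φ x₀ (W ω) k).1 = n} ∧
      Measurable[pastSigma W k n] (truncated C Φ x₀ W k n) := by
  classical
  induction k generalizing n with
  | zero =>
    refine ⟨?_, ?_⟩
    · simp only [thinned]
      exact MeasurableSet.const _
    · have : truncated C Φ x₀ W 0 n = fun _ => (0, x₀) := by
        ext1 ω
        rw [truncated]
        split_ifs <;> rfl
      rw [this]
      exact measurable_const
  | succ k ih =>
    have hT : ∀ n, Measurable[pastSigma W (k + 1) n] fun ω => (W ω).T (k + 1) := fun n =>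
      hW.measurable_time_pastSigma n le_rfl
    have hU : ∀ n, Measurable[pastSigma W (k + 1) n] fun ω => (W ω).U (k + 1) := fun n =>
      measurable_U_pastSigma n k.lt_succ_self
    have hE : ∀ n, MeasurableSet[pastSigma W (k + 1) n]
        {ω | (thinned C Φ x₀ (W ω) k).1 = n} := fun n =>
      pastSigma_mono k.le_succ le_rfl _ (ih n).1
    have hZ : ∀ n, Measurable[pastSigma W (k + 1) n] (truncated C Φ x₀ W k n) := fun n =>
      (ih n).2.mono (pastSigma_mono k.le_succ le_rfl) le_rfl
    have hacc : ∀ n, MeasurableSet[pastSigma W (k + 1) n] {ω | (W ω).U (k + 1) * C.bound ≤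
        C.rate (flowFrom Φ (truncated C Φ x₀ W k n ω) ((W ω).T (k + 1)))} := fun n =>
      measurableSet_accept hΦ (hZ n) (hT n) (hU n)
    have hnot : ∀ n, MeasurableSet[pastSigma W (k + 1) n]
        {ω | (thinned C Φ x₀ (W ω) k).1 = n ∧ ¬ Accepts C Φ x₀ (W ω) k} := by
      intro n
      have : {ω | (thinned C Φ x₀ (W ω) k).1 = n ∧ ¬ Accepts C Φ x₀ (W ω) k} =
          {ω | (thinned C Φ x₀ (W ω) k).1 = n} \ {ω | (W ω).U (k + 1) * C.bound ≤
            C.rate (flowFrom Φ (truncated C Φ x₀ W k n ω) ((W ω).T (k + 1)))} := by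
        ext ω
        simp only [mem_ofPred_eq, Set.mem_sdiff]
        refine and_congr_right fun h => ?_
        rw [truncated, if_pos h, Accepts]
      rw [this]
      exact (hE n).diff (hacc n)
    have hyes : ∀ n, MeasurableSet[pastSigma W (k + 1) n]
        {ω | (thinned C Φ x₀ (W ω) k).1 = n ∧ Accepts C Φ x₀ (W ω) k} := by
      intro n
      have : {ω | (thinned C Φ x₀ (W ω) k).1 = n ∧ Accepts C Φ x₀ (W ω) k} =
          {ω | (thinned C Φ x₀ (W ω) k).1 = n} ∩ {ω | (W ω).U (k + 1) * C.bound ≤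
            C.rate (flowFrom Φ (truncated C Φ x₀ W k n ω) ((W ω).T (k + 1)))} := by
        ext ω
        simp only [mem_ofPred_eq, mem_inter_iff]
        refine and_congr_right fun h => ?_
        rw [truncated, if_pos h, Accepts]
      rw [this]
      exact (hE n).inter (hacc n)
    cases n with
    | zero =>
      have h1 : {ω | (thinned C Φ x₀ (W ω) (k + 1)).1 = 0} =
          {ω | (thinned C Φ x₀ (W ω) k).1 = 0 ∧ ¬ Accepts C Φ x₀ (W ω) k} := by
        ext ω
        by_cases h : Accepts C Φ x₀ (W ω) k
        · simp [thinned_succ_of_accepts h, h]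
        · simp [thinned_succ_of_not_accepts h, h]
      have h2 : truncated C Φ x₀ W (k + 1) 0 = fun ω =>
          if (thinned C Φ x₀ (W ω) k).1 = 0 ∧ ¬ Accepts C Φ x₀ (W ω) k
          then truncated C Φ x₀ W k 0 ω else (0, x₀) := by
        ext1 ω
        by_cases h : Accepts C Φ x₀ (W ω) k
        · simp [truncated, thinned_succ_of_accepts h, h]
        · by_cases h' : (thinned C Φ x₀ (W ω) k).1 = 0 <;>
            simp [truncated, thinned_succ_of_not_accepts h, h, h']
      rw [h1, h2]
      exact ⟨hnot 0, Measurable.ite (hnot 0) (hZ 0) measurable_const⟩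
    | succ n =>
      have hyes' : MeasurableSet[pastSigma W (k + 1) (n + 1)]
          {ω | (thinned C Φ x₀ (W ω) k).1 = n ∧ Accepts C Φ x₀ (W ω) k} :=
        pastSigma_mono le_rfl n.le_succ _ (hyes n)
      have h1 : {ω | (thinned C Φ x₀ (W ω) (k + 1)).1 = n + 1} =
          {ω | (thinned C Φ x₀ (W ω) k).1 = n + 1 ∧ ¬ Accepts C Φ x₀ (W ω) k} ∪
            {ω | (thinned C Φ x₀ (W ω) k).1 = n ∧ Accepts C Φ x₀ (W ω) k} := by
        ext ω
        by_cases h : Accepts C Φ x₀ (W ω) k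
        · simp [thinned_succ_of_accepts h, h]
        · simp [thinned_succ_of_not_accepts h, h]
      have h2 : truncated C Φ x₀ W (k + 1) (n + 1) = fun ω =>
          if (thinned C Φ x₀ (W ω) k).1 = n + 1 ∧ ¬ Accepts C Φ x₀ (W ω) k
          then truncated C Φ x₀ W k (n + 1) ω
          else if (thinned C Φ x₀ (W ω) k).1 = n ∧ Accepts C Φ x₀ (W ω) k
          then ((W ω).T (k + 1),
            (C.H (flowFrom Φ (truncated C Φ x₀ W k n ω) ((W ω).T (k + 1))) ((W ω).V (n + 1)),
              (flowFrom Φ (truncated C Φ x₀ W k n ω) ((W ω).T (k + 1))).2))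
          else (0, x₀) := by
        ext1 ω
        by_cases h : Accepts C Φ x₀ (W ω) k
        · by_cases h' : (thinned C Φ x₀ (W ω) k).1 = n
          · simp [truncated, thinned_succ_of_accepts h, h, h']
          · simp [truncated, thinned_succ_of_accepts h, h, h']
        · by_cases h' : (thinned C Φ x₀ (W ω) k).1 = n + 1 <;>
            simp [truncated, thinned_succ_of_not_accepts h, h, h']
      rw [h1, h2]
      refine ⟨(hnot (n + 1)).union hyes', Measurable.ite (hnot (n + 1)) (hZ (n + 1)) ?_⟩
      refine Measurable.ite hyes' ?_ measurable_const
      exact measurable_newState hΦ ((hZ n).mono (pastSigma_mono le_rfl n.le_succ) le_rfl)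
        (hT (n + 1)) (measurable_V_pastSigma (k + 1) n.lt_succ_self)

/-- The history up to the `k`-th Poisson point: the events that, on the event that `n` points were
accepted, only depend on `T*_j`, `U_j` for `j ≤ k` and on `V_j` for `j ≤ n`. -/
@[reducible]
def pointSigma (hW : IsThinningNoise P lam W) (C : JumpCharacteristics Θ d) (x₀ : State Θ d)
    (hΦ : IsRegularFlow Φ) (k : ℕ) : MeasurableSpace Ω where
  -- This is the σ-algebra of a stopping time: for fixed `k`, the number of acceptances is one with
  -- respect to the increasing family `n ↦ pastSigma W k n`.
  MeasurableSet' B := ∀ n, MeasurableSet[pastSigma W k n]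
    (B ∩ {ω | (thinned C Φ x₀ (W ω) k).1 = n})
  measurableSet_empty n := by simp
  measurableSet_compl B hB n := by
    have : Bᶜ ∩ {ω | (thinned C Φ x₀ (W ω) k).1 = n} = {ω | (thinned C Φ x₀ (W ω) k).1 = n} \
        (B ∩ {ω | (thinned C Φ x₀ (W ω) k).1 = n}) := by
      ext ω; simp; tauto
    rw [this]
    exact (measurable_truncated hW hΦ k n).1.diff (hB n)
  measurableSet_iUnion B hB n := by
    rw [iUnion_inter]
    exact MeasurableSet.iUnion fun i => hB i n

theorem pointSigma_le (hW : IsThinningNoise P lam W) (hΦ : IsRegularFlow Φ) (k : ℕ) :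
    pointSigma hW C x₀ hΦ k ≤ mΩ := by
  intro B hB
  have : B = ⋃ n, (B ∩ {ω | (thinned C Φ x₀ (W ω) k).1 = n}) := by
    ext ω; simp
  rw [this]
  exact MeasurableSet.iUnion fun n => hW.pastSigma_le k n _ (hB n)

theorem pastSigma_zero_le_pointSigma (hW : IsThinningNoise P lam W) (hΦ : IsRegularFlow Φ)
    (k : ℕ) : pastSigma W k 0 ≤ pointSigma hW C x₀ hΦ k := fun B hB n =>
  (pastSigma_mono le_rfl n.zero_le B hB).inter (measurable_truncated hW hΦ k n).1

theorem measurable_thinned (hW : IsThinningNoise P lam W) (hΦ : IsRegularFlow Φ) (k : ℕ) :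
    Measurable[pointSigma hW C x₀ hΦ k] fun ω => thinned C Φ x₀ (W ω) k := by
  intro D hD n
  have : (fun ω => thinned C Φ x₀ (W ω) k) ⁻¹' D ∩ {ω | (thinned C Φ x₀ (W ω) k).1 = n} =
      (fun ω => (n, truncated C Φ x₀ W k n ω)) ⁻¹' D ∩
        {ω | (thinned C Φ x₀ (W ω) k).1 = n} := by
    ext ω
    simp only [mem_inter_iff, mem_preimage, mem_ofPred_eq]
    refine and_congr_left fun h => ?_
    rw [truncated, if_pos h, ← h]
  rw [this]
  obtain ⟨h1, h2⟩ := measurable_truncated (C := C) (x₀ := x₀) hW hΦ k n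
  exact (measurable_const.prodMk h2 hD).inter h1

/-- The count never decreases, so the event of `n` acceptances after `k + 1` points splits over the
earlier counts `m ≤ n`, and `pastSigma W k m` lies in `pastSigma W (k + 1) n`. -/
theorem pointSigma_mono (hW : IsThinningNoise P lam W) (hΦ : IsRegularFlow Φ) :
    Monotone (pointSigma hW C x₀ hΦ) := by
  refine monotone_nat_of_le_succ fun k B hB n => ?_
  have h1 := (measurable_truncated (C := C) (x₀ := x₀) hW hΦ (k + 1) n).1
  have : B ∩ {ω | (thinned C Φ x₀ (W ω) (k + 1)).1 = n} =
      ⋃ m ≤ n, (B ∩ {ω | (thinned C Φ x₀ (W ω) k).1 = m}) ∩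
        {ω | (thinned C Φ x₀ (W ω) (k + 1)).1 = n} := by
    ext ω
    simp only [mem_inter_iff, mem_ofPred_eq, mem_iUnion, exists_prop]
    constructor
    · rintro ⟨hω, h⟩
      refine ⟨_, ?_, ⟨hω, rfl⟩, h⟩
      rw [← h]
      by_cases ha : Accepts C Φ x₀ (W ω) k
      · simp [thinned_succ_of_accepts ha]
      · simp [thinned_succ_of_not_accepts ha]
    · rintro ⟨m, -, h, h'⟩
      exact ⟨h.1, h'⟩
  rw [this]
  exact MeasurableSet.iUnion fun m => MeasurableSet.iUnion fun hm =>
    (pastSigma_mono k.le_succ hm _ (hB m)).inter h1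

end PointFiltration

theorem integrable_of_hasSum {α : Type*} {mα : MeasurableSpace α} {μ : Measure α}
    {F : ℕ → α → ℝ} {S : α → ℝ} (hF : ∀ k, Integrable (F k) μ)
    (hsum : Summable fun k => ∫ a, ‖F k a‖ ∂μ) (hS : ∀ a, HasSum (fun k => F k a) (S a)) :
    Integrable S μ := by
  refine ⟨?_, ?_⟩
  · refine aestronglyMeasurable_of_tendsto_ae atTop
      (f := fun n a => ∑ k ∈ Finset.range n, F k a) (fun n => ?_)
      (ae_of_all _ fun a => (hS a).tendsto_sum_nat)
    exact Finset.aestronglyMeasurable_fun_sum _ fun k _ => (hF k).1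
  · have h1 : ∀ a, ‖S a‖ₑ ≤ ∑' k, ‖F k a‖ₑ := fun a => by
      rw [← (hS a).tsum_eq]
      exact enorm_tsum_le_tsum_enorm
    calc ∫⁻ a, ‖S a‖ₑ ∂μ ≤ ∫⁻ a, ∑' k, ‖F k a‖ₑ ∂μ := lintegral_mono h1
      _ = ∑' k, ∫⁻ a, ‖F k a‖ₑ ∂μ := lintegral_tsum fun k => (hF k).1.enorm
      _ = ∑' k, ENNReal.ofReal (∫ a, ‖F k a‖ ∂μ) := by
        refine tsum_congr fun k => ?_
        rw [ofReal_integral_norm_eq_lintegral_enorm (hF k)]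
      _ < ⊤ := hsum.tsum_ofReal_lt_top

/-! ### The mean number of Poisson points in a bounded interval. -/

section PoissonCount

variable {w : NoisePath}

/-- The time spent in `[0, t]` between two Poisson points. -/
def sojourn (w : NoisePath) (t : ℝ) (k : ℕ) : ℝ := min (w.T (k + 1)) t - min (w.T k) t

theorem sojourn_nonneg (hw : w.IsCounting) (t : ℝ) (k : ℕ) : 0 ≤ sojourn w t k :=
  sub_nonneg.2 (min_le_min_right _ (hw.strictMono.monotone k.le_succ))

theorem sum_sojourn_le (hw : w.IsCounting) {t : ℝ} (ht : 0 ≤ t) (n : ℕ) :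
    ∑ k ∈ Finset.range n, sojourn w t k ≤ t := by
  unfold sojourn
  rw [Finset.sum_range_sub (fun k => min (w.T k) t), hw.zero, min_eq_left ht, sub_zero]
  exact min_le_right _ _

theorem NoisePath.IsCounting.nonneg (hw : w.IsCounting) (k : ℕ) : 0 ≤ w.T k := by
  rw [← hw.zero]; exact hw.strictMono.monotone k.zero_le

theorem sojourn_le (hw : w.IsCounting) {t : ℝ} (ht : 0 ≤ t) (k : ℕ) : sojourn w t k ≤ t := by
  have := le_min (hw.nonneg k) ht
  have := min_le_right (w.T (k + 1)) t
  rw [sojourn]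
  linarith

theorem measureReal_Ioc_inter (hw : w.IsCounting) (t : ℝ) (k : ℕ) :
    volume.real (Ioc (w.T k) (w.T (k + 1)) ∩ Ioc 0 t) = sojourn w t k := by
  have h1 := hw.strictMono.monotone k.le_succ
  rw [Nat.succ_eq_add_one] at h1
  rw [Ioc_inter_Ioc, sup_of_le_left (hw.nonneg k), Measure.real, Real.volume_Ioc,
    ENNReal.toReal_ofReal', sojourn]
  change max (min (w.T (k + 1)) t - w.T k) 0 = _
  rcases le_total (w.T k) t with h | h
  · rw [min_eq_left h, max_eq_left (sub_nonneg.2 (le_min h1 h))]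
  · rw [min_eq_right h, min_eq_right (h.trans h1), sub_self, max_eq_right (by linarith)]

theorem setIntegral_translate (c : ℝ → ℝ) (a b : ℝ) (hab : a ≤ b) :
    ∫ ρ in Ioc 0 (b - a), c (a + ρ) = ∫ ρ in Ioc a b, c ρ := by
  rw [← intervalIntegral.integral_of_le (sub_nonneg.2 hab),
    intervalIntegral.integral_comp_add_left, ← intervalIntegral.integral_of_le (by linarith)]
  simp

variable {Ω : Type*} {mΩ : MeasurableSpace Ω} {P : Measure Ω} [IsProbabilityMeasure P] {lam : ℝ}
  {W : Ω → NoisePath}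

theorem integrable_sojourn (hW : IsThinningNoise P lam W) {t : ℝ} (ht : 0 ≤ t) (k : ℕ) :
    Integrable (fun ω => sojourn (W ω) t k) P := by
  refine Integrable.of_bound (C := t) (Measurable.aestronglyMeasurable ?_) (ae_of_all _ fun ω => ?_)
  · exact ((hW.measurable_time (k + 1)).min measurable_const).sub
      ((hW.measurable_time k).min measurable_const)
  · rw [Real.norm_eq_abs, abs_of_nonneg (sojourn_nonneg (hW.isCounting ω) t k)]
    exact sojourn_le (hW.isCounting ω) ht k

theorem summable_integral_sojourn (hW : IsThinningNoise P lam W) {t : ℝ} (ht : 0 ≤ t) :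
    Summable fun k => ∫ ω, sojourn (W ω) t k ∂P := by
  refine summable_of_sum_range_le (c := t)
    (fun k => integral_nonneg fun ω => sojourn_nonneg (hW.isCounting ω) t k) fun n => ?_
  rw [← integral_finsetSum _ fun k _ => integrable_sojourn hW ht k]
  calc ∫ ω, ∑ k ∈ Finset.range n, sojourn (W ω) t k ∂P ≤ ∫ _, t ∂P :=
        integral_mono (integrable_finsetSum _ fun k _ => integrable_sojourn hW ht k)
          (integrable_const _) fun ω => sum_sojourn_le (hW.isCounting ω) ht n
    _ = t := by simp

theorem integrable_indicator_Ioc (a s t K : ℝ) {c : ℝ → ℝ} (hc : Measurable c)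
    (hK : ∀ ρ, |c ρ| ≤ K) : Integrable (fun ρ => (Ioc s t).indicator c (a + ρ)) volume := by
  have : Integrable ((Ioc s t).indicator c) volume := by
    rw [integrable_indicator_iff measurableSet_Ioc]
    exact Integrable.of_bound hc.aestronglyMeasurable K (ae_of_all _ hK)
  exact this.comp_add_left a

/-- The moving interval becomes an indicator on the product space, to which Fubini's measurability
statement applies. -/
theorem measurable_integral_Ioc {α : Type*} {mα : MeasurableSpace α} {b : α → ℝ → ℝ} {σ : α → ℝ}
    (hb : Measurable (Function.uncurry b)) (hσ : Measurable σ) :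
    Measurable fun a => ∫ ρ in Ioc 0 (σ a), b a ρ := by
  simp only [← integral_indicator (measurableSet_Ioc (α := ℝ))]
  have hset : MeasurableSet {z : α × ℝ | 0 < z.2 ∧ z.2 ≤ σ z.1} :=
    (measurableSet_lt measurable_const measurable_snd).inter
      (measurableSet_le measurable_snd (hσ.comp measurable_fst))
  have h1 : StronglyMeasurable ({z : α × ℝ | 0 < z.2 ∧ z.2 ≤ σ z.1}.indicator
      (Function.uncurry b)) := (hb.indicator hset).stronglyMeasurable
  have heq : (fun a => ∫ ρ, (Ioc 0 (σ a)).indicator (b a) ρ) = fun a =>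
      ∫ ρ, {z : α × ℝ | 0 < z.2 ∧ z.2 ≤ σ z.1}.indicator (Function.uncurry b) (a, ρ) := by
    funext a
    refine integral_congr_ae (ae_of_all _ fun ρ => ?_)
    simp [indicator, mem_Ioc, Function.uncurry]
  rw [heq]
  exact (h1.integral_prod_right' (ν := volume)).measurable

/-- The mean number of Poisson points in `]0, t]` is finite. -/
theorem summable_prob_time_le (hW : IsThinningNoise P lam W) (hlam : 0 < lam) {t : ℝ}
    (ht : 0 ≤ t) :
    Summable fun k => ∫ ω, (Ioc 0 t).indicator (fun _ => (1 : ℝ)) ((W ω).T (k + 1)) ∂P := by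
  have key : ∀ k, ∫ ω, (Ioc 0 t).indicator (fun _ => (1 : ℝ)) ((W ω).T (k + 1)) ∂P =
      lam * ∫ ω, sojourn (W ω) t k ∂P := by
    intro k
    -- The exponential compensation formula with a mark equal to one: the probability that `T*_{k+1}
    -- ≤ t` is `lam` times the mean time of `[0, t]` spent between the two points, and these times
    -- telescope.
    set F : ℝ × ℝ × ℝ × ℝ → ℝ := fun z => (Ioc 0 t).indicator (fun _ => (1 : ℝ)) (z.1 + z.2.1) -
      ∫ ρ in Ioc 0 z.2.1, (Ioc 0 t).indicator (fun _ => lam) (z.1 + ρ) with hFdef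
    have hone : Measurable ((Ioc 0 t).indicator fun _ => (1 : ℝ)) :=
      measurable_const.indicator measurableSet_Ioc
    have hlm : Measurable ((Ioc 0 t).indicator fun _ => lam) :=
      measurable_const.indicator measurableSet_Ioc
    have hF : Measurable F := by
      refine (hone.comp (measurable_fst.add measurable_snd.fst)).sub
        (measurable_integral_Ioc ?_ measurable_snd.fst)
      exact hlm.comp (measurable_fst.fst.add measurable_snd)
    have hval : ∀ ω, F ((W ω).T k, stepNoise W k 0 ω) =
        (Ioc 0 t).indicator (fun _ => (1 : ℝ)) ((W ω).T (k + 1)) - lam * sojourn (W ω) t k := by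
      intro ω
      have hw := hW.isCounting ω
      have h1 : (stepNoise W k 0 ω).1 = (W ω).T (k + 1) - (W ω).T k := by
        simp [stepNoise, noiseVar]
      simp only [hFdef, h1, add_sub_cancel]
      rw [setIntegral_translate _ _ _ (hw.strictMono.monotone k.le_succ),
        setIntegral_indicator measurableSet_Ioc, setIntegral_const, measureReal_Ioc_inter hw t,
        smul_eq_mul, mul_comm]
    have hi1 : Integrable (fun ω => (Ioc 0 t).indicator (fun _ => (1 : ℝ)) ((W ω).T (k + 1))) P := by
      refine Integrable.of_bound (C := 1) (hone.comp (hW.measurable_T k)).aestronglyMeasurable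
        (ae_of_all _ fun ω => ?_)
      rw [indicator]
      split_ifs <;> simp
    have hi2 := (integrable_sojourn hW ht k).const_mul lam
    have h0 : ∀ a, ∫ z, F (a, z) ∂(stepLaw lam) = 0 := by
      intro a
      refine integral_stepLaw_eq hlam (K := 1)
        (J := fun z => (Ioc 0 t).indicator (fun _ => (1 : ℝ)) (a + z.1))
        (hone.comp (measurable_const.add measurable_fst)) (fun z => ?_)
        (integrable_indicator_Ioc a 0 t lam measurable_const fun _ => (abs_of_pos hlam).le)
        (hlm.comp (measurable_const.add measurable_id)) fun σ => ?_
      · rw [indicator]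
        split_ifs <;> simp
      · simp only [integral_const, probReal_univ, one_smul, indicator]
        split_ifs
        · rw [div_self hlam.ne']
        · simp
    -- `F` ignores the `V` component, so the choice `n = 0` is arbitrary.
    have := hW.integral_step_eq_zero (n := 0) (X := fun ω => (W ω).T k)
      (hW.measurable_time_pastSigma 0 le_rfl) hF
      (by simp only [hval]; exact hi1.sub hi2) h0
    simp only [hval] at this
    rw [integral_sub hi1 hi2, integral_const_mul] at this
    linarith
  simp only [key]
  exact (summable_integral_sojourn hW ht).mul_left lam

end PoissonCount

/-! ### Decomposition of the compensated integral over the Poisson points. -/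

section Increments

variable {Θ : Type*} {d : ℕ} [MeasurableSpace Θ] {C : JumpCharacteristics Θ d}
  {Φ : FlowFamily Θ d} {x₀ : State Θ d} {w : NoisePath} {g : ℝ → State Θ d → ℝ}

variable (C Φ x₀ w g) in
/-- The increment over `]s, t]` of the compensated integral between two Poisson points. -/
def increment (s t : ℝ) (k : ℕ) : ℝ :=
  (Ioc s t).indicator (fun _ => jumpSize C Φ x₀ w g k) (w.T (k + 1)) -
    ∫ ρ in Ioc (w.T k) (w.T (k + 1)) ∩ Ioc s t, opS C g ρ (process C Φ x₀ w ρ)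

variable (C Φ g) in
/-- The increment as a function of the past and of the noise of the step. -/
def stepIncrement (s t : ℝ) (z : (ℝ × ℝ × State Θ d) × ℝ × ℝ × ℝ) : ℝ :=
  (Ioc s t).indicator (fun τ => mark C g τ (flowFrom Φ z.1.2 τ) z.2.2.1 z.2.2.2) (z.1.1 + z.2.1) -
    ∫ ρ in Ioc 0 z.2.1,
      (Ioc s t).indicator (fun τ => opS C g (max τ 0) (flowFrom Φ z.1.2 τ)) (z.1.1 + ρ)

theorem jumpSize_eq_mark (hw : w.IsCounting) (k : ℕ) :
    jumpSize C Φ x₀ w g k = mark C g (w.T (k + 1))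
      (flowFrom Φ (thinned C Φ x₀ w k).2 (w.T (k + 1))) (w.U (k + 1))
        (w.V ((thinned C Φ x₀ w k).1 + 1)) := by
  rw [jumpSize, mark, max_eq_left (hw.nonneg _)]
  by_cases h : Accepts C Φ x₀ w k
  · have h' := h
    rw [Accepts] at h'
    rw [if_pos h, if_pos h', thinned_succ_of_accepts h]
  · have h' := h
    rw [Accepts] at h'
    rw [if_neg h, if_neg h']

/-- Separates what is known after `k` points from the three fresh variables of the step, the form in
which independence can be used. -/
theorem increment_eq_stepIncrement (hw : w.IsCounting) (s t : ℝ) (k : ℕ) :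
    increment C Φ x₀ w g s t k = stepIncrement C Φ g s t ((w.T k, (thinned C Φ x₀ w k).2),
      (w.T (k + 1) - w.T k, w.U (k + 1), w.V ((thinned C Φ x₀ w k).1 + 1))) := by
  rw [increment, stepIncrement]
  simp only [add_sub_cancel]
  congr 1
  · simp only [indicator]
    split_ifs
    · exact jumpSize_eq_mark hw k
    · rfl
  · rw [setIntegral_translate _ _ _ (hw.strictMono.monotone k.le_succ),
      setIntegral_indicator measurableSet_Ioc]
    refine setIntegral_congr_ae (measurableSet_Ioc.inter measurableSet_Ioc) ?_
    have : ∀ᵐ ρ ∂(volume : Measure ℝ), ρ ≠ w.T (k + 1) := by simp [ae_iff]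
    filter_upwards [this] with ρ h1 h2
    have hlt := lt_of_le_of_ne h2.1.2 h1
    rw [process_eq_flowFrom hw h2.1.1.le hlt, max_eq_left ((hw.nonneg k).trans h2.1.1.le)]

/-- It is because of this vanishing that an event known at time `s` need only be described on `{s <
T*_{k+1}}`. -/
theorem increment_eq_zero (s t : ℝ) {k : ℕ} (h : w.T (k + 1) ≤ s) :
    increment C Φ x₀ w g s t k = 0 := by
  rw [increment, indicator_of_notMem (fun h' => absurd h (not_le.2 h'.1))]
  have : Ioc (w.T k) (w.T (k + 1)) ∩ Ioc s t = ∅ := by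
    ext ρ
    simp only [mem_inter_iff, mem_Ioc, mem_empty_iff_false, iff_false]
    rintro ⟨h1, h2⟩
    linarith [h1.2, h2.1]
  simp [this]

variable [DiscreteMeasurableSpace Θ] [Countable Θ]

/-- Both terms of the bound are summable in mean over `k`: the first counts Poisson points in `]0,
t]`, the second adds up to at most a multiple of `t`. -/
theorem abs_increment_le (hw : w.IsCounting) (hg : IsBoundedC1 g) {K : ℝ}
    (hK0 : 0 ≤ K) (hK : ∀ t, 0 ≤ t → ∀ x, |g t x| ≤ K) {s t : ℝ} (hs : 0 ≤ s) (k : ℕ) :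
    ‖increment C Φ x₀ w g s t k‖ ≤ 2 * K * (Ioc 0 t).indicator (fun _ => (1 : ℝ)) (w.T (k + 1)) +
      C.bound * (2 * K) * sojourn w t k := by
  have hpos := C.bound_pos x₀
  rw [increment]
  refine (norm_sub_le _ _).trans (add_le_add ?_ ?_)
  · have hsub : Ioc s t ⊆ Ioc 0 t := Ioc_subset_Ioc_left hs
    simp only [indicator]
    split_ifs with h1 h2 h2
    · rw [jumpSize_eq_mark hw, mul_one]
      exact abs_mark_le hK0 hK _ _ _ _
    · exact absurd (hsub h1) h2
    · simpa using hK0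
    · simp
  · have h1 : volume (Ioc (w.T k) (w.T (k + 1)) ∩ Ioc s t) < ⊤ :=
      (measure_mono inter_subset_left).trans_lt (by simp)
    refine (norm_setIntegral_le_of_norm_le_const h1 (C := C.bound * (2 * K))
      fun ρ hρ => abs_opS_le hg hK (hs.trans hρ.2.1.le) _).trans ?_
    refine mul_le_mul_of_nonneg_left ?_ (by positivity)
    rw [← measureReal_Ioc_inter hw t k]
    refine measureReal_mono (inter_subset_inter_right _ (Ioc_subset_Ioc_left hs)) ?_
    exact ((measure_mono inter_subset_left).trans_lt (by simp)).ne

theorem measurable_stepIncrement (hΦ : IsRegularFlow Φ) (hg : IsBoundedC1 g) (s t : ℝ) :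
    Measurable (stepIncrement C Φ g s t) := by
  have hfl := measurable_flowFrom hΦ
  refine Measurable.sub ?_ (measurable_integral_Ioc ?_ measurable_snd.fst)
  · have h1 : Measurable fun z : (ℝ × ℝ × State Θ d) × ℝ × ℝ × ℝ =>
        mark C g (z.1.1 + z.2.1) (flowFrom Φ z.1.2 (z.1.1 + z.2.1)) z.2.2.1 z.2.2.2 := by
      have hτ : Measurable fun z : (ℝ × ℝ × State Θ d) × ℝ × ℝ × ℝ => z.1.1 + z.2.1 :=
        measurable_fst.fst.add measurable_snd.fst
      exact (measurable_mark hg).comp ((hτ.prodMk (hfl.comp (measurable_fst.snd.prodMk hτ))).prodMk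
        measurable_snd.snd)
    exact h1.indicator ((measurable_fst.fst.add measurable_snd.fst) measurableSet_Ioc)
  · have hτ : Measurable fun z : ((ℝ × ℝ × State Θ d) × ℝ × ℝ × ℝ) × ℝ => z.1.1.1 + z.2 :=
      measurable_fst.fst.fst.add measurable_snd
    have h1 : Measurable fun z : ((ℝ × ℝ × State Θ d) × ℝ × ℝ × ℝ) × ℝ =>
        opS C g (max (z.1.1.1 + z.2) 0) (flowFrom Φ z.1.1.2 (z.1.1.1 + z.2)) :=
      (measurable_opS hg).comp (hτ.prodMk (hfl.comp (measurable_fst.fst.snd.prodMk hτ)))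
    exact h1.indicator (hτ measurableSet_Ioc)

/-- The increments are centred. -/
theorem integral_stepIncrement (hΦ : IsRegularFlow Φ) (hg : IsBoundedC1 g) (s t : ℝ)
    (a : ℝ × ℝ × State Θ d) :
    ∫ z, stepIncrement C Φ g s t (a, z) ∂(stepLaw C.bound) = 0 := by
  obtain ⟨K, hK0, hK⟩ := hg.exists_bound
  have hfl : Measurable fun τ => flowFrom Φ a.2 τ :=
    (measurable_flowFrom hΦ).comp measurable_prodMk_left
  have hopS : Measurable fun τ => opS C g (max τ 0) (flowFrom Φ a.2 τ) :=
    (measurable_opS hg).comp (measurable_id.prodMk hfl)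
  refine integral_stepLaw_eq (C.bound_pos a.2.2) (K := 2 * K)
    (J := fun z => (Ioc s t).indicator
      (fun τ => mark C g τ (flowFrom Φ a.2 τ) z.2.1 z.2.2) (a.1 + z.1)) ?_ (fun z => ?_)
    (integrable_indicator_Ioc a.1 s t (C.bound * (2 * K)) hopS
      fun ρ => abs_opS_le hg hK (le_max_right _ _) _)
    ((hopS.indicator measurableSet_Ioc).comp (measurable_const.add measurable_id)) fun σ => ?_
  · have hτ : Measurable fun z : ℝ × ℝ × ℝ => a.1 + z.1 := measurable_const.add measurable_fst
    have h1 : Measurable fun z : ℝ × ℝ × ℝ =>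
        mark C g (a.1 + z.1) (flowFrom Φ a.2 (a.1 + z.1)) z.2.1 z.2.2 :=
      (measurable_mark hg).comp ((hτ.prodMk (hfl.comp hτ)).prodMk measurable_snd)
    exact h1.indicator (hτ measurableSet_Ioc)
  · simp only [indicator]
    split_ifs
    · exact abs_mark_le hK0 hK _ _ _ _
    · simpa using hK0
  · simp only [indicator]
    split_ifs
    · exact integral_mark hg _ _
    · simp

/-- The intervals `]T*_k, T*_{k+1}]` partition `]0, ∞[`. The jump terms are finite in number, and
the drift terms add up by countable additivity of the integral. -/
theorem hasSum_increment [TopologicalSpace Θ] [DiscreteTopology Θ] (hw : w.IsCounting)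
    (hΦ : IsRegularFlow Φ) (hg : IsBoundedC1 g) {s t : ℝ}
    (hs : 0 ≤ s) (hst : s ≤ t) :
    HasSum (increment C Φ x₀ w g s t)
      (martingalePart C Φ x₀ w g t - martingalePart C Φ x₀ w g s) := by
  classical
  have ht := hs.trans hst
  have hfin : ∀ t, HasSum (fun k => if w.T (k + 1) ≤ t then jumpSize C Φ x₀ w g k else 0)
      (∑' k, if w.T (k + 1) ≤ t then jumpSize C Φ x₀ w g k else 0) := fun t => by
    refine (summable_of_hasFiniteSupport ((finite_points_le hw t).subset fun k hk => ?_)).hasSum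
    by_contra h
    exact hk (if_neg h)
  have h1 : HasSum (fun k => (Ioc s t).indicator (fun _ => jumpSize C Φ x₀ w g k) (w.T (k + 1)))
      ((∑' k, if w.T (k + 1) ≤ t then jumpSize C Φ x₀ w g k else 0) -
        ∑' k, if w.T (k + 1) ≤ s then jumpSize C Φ x₀ w g k else 0) := by
    refine ((hfin t).sub (hfin s)).congr_fun fun k => ?_
    simp only [indicator, mem_Ioc]
    by_cases h2 : w.T (k + 1) ≤ s
    · simp [h2, h2.trans hst, not_lt.2 h2]
    · simp [h2, not_le.1 h2]
  have hunion : ⋃ k, (Ioc (w.T k) (w.T (k + 1)) ∩ Ioc s t) = Ioc s t := by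
    ext ρ
    simp only [mem_iUnion, mem_inter_iff, exists_and_right, and_iff_right_iff_imp]
    intro hρ
    obtain ⟨k, hk1, hk2⟩ := hw.exists_mem_Ico (hs.trans hρ.1.le)
    rcases hk1.lt_or_eq with h | h
    · exact ⟨k, h, hk2.le⟩
    · cases k with
      | zero =>
        rw [hw.zero] at h
        exact absurd hρ.1 (not_lt.2 (h ▸ hs))
      | succ k => exact ⟨k, h ▸ hw.strictMono k.lt_succ_self, h.ge⟩
  have hdisj : Pairwise (Function.onFun Disjoint fun k =>
      Ioc (w.T k) (w.T (k + 1)) ∩ Ioc s t) := by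
    intro i j hij
    refine Disjoint.mono inter_subset_left inter_subset_left ?_
    have := hw.strictMono.monotone.pairwise_disjoint_on_Ioc_succ hij
    simpa [Function.onFun] using this
  have hinteg := intervalIntegrable_opS (C := C) (x₀ := x₀) hw hΦ hg hs ht
  have h2 := hasSum_integral_iUnion (μ := volume)
    (f := fun ρ => opS C g ρ (process C Φ x₀ w ρ))
    (fun k => measurableSet_Ioc.inter measurableSet_Ioc) hdisj (by
      rw [hunion]
      exact (intervalIntegrable_iff_integrableOn_Ioc_of_le hst).1 hinteg)
  rw [hunion] at h2
  have h3 := h1.sub h2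
  have hval : martingalePart C Φ x₀ w g t - martingalePart C Φ x₀ w g s =
      ((∑' k, if w.T (k + 1) ≤ t then jumpSize C Φ x₀ w g k else 0) -
        ∑' k, if w.T (k + 1) ≤ s then jumpSize C Φ x₀ w g k else 0) -
      ∫ ρ in Ioc s t, opS C g ρ (process C Φ x₀ w ρ) := by
    rw [martingalePart_eq hw hΦ hg ht, martingalePart_eq hw hΦ hg hs,
      ← intervalIntegral.integral_of_le hst,
      ← intervalIntegral.integral_add_adjacent_intervals
        (intervalIntegrable_opS (C := C) (x₀ := x₀) hw hΦ hg le_rfl hs) hinteg]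
    ring
  rw [hval]
  exact h3

end Increments

/-! ### Comparison of the jump filtration with the history at Poisson points. -/

section JumpFiltration

variable {Θ : Type*} {d : ℕ} [MeasurableSpace Θ] {C : JumpCharacteristics Θ d}
  {Φ : FlowFamily Θ d} {x₀ : State Θ d} {w : NoisePath}

/-- Rewrites acceptance in terms of the counts, so that its measurability follows from that of
`thinned`. -/
theorem accepts_iff_count {k : ℕ} :
    Accepts C Φ x₀ w k ↔ (thinned C Φ x₀ w (k + 1)).1 = (thinned C Φ x₀ w k).1 + 1 := by
  by_cases h : Accepts C Φ x₀ w k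
  · simp [thinned_succ_of_accepts h, h]
  · simp [thinned_succ_of_not_accepts h, h]

open Classical in
theorem jumpMeasure_apply (hw : w.IsCounting) (s : ℝ) {A : Set (State Θ d)}
    (hA : MeasurableSet A) :
    jumpMeasure C Φ x₀ w (Icc 0 s ×ˢ A) = ∑' k, if Accepts C Φ x₀ w k ∧ w.T (k + 1) ≤ s ∧
      (thinned C Φ x₀ w (k + 1)).2.2 ∈ A then 1 else 0 := by
  have hm : MeasurableSet (Icc 0 s ×ˢ A) := measurableSet_Icc.prod hA
  rw [jumpMeasure_eq_sum hw, Measure.sum_apply _ hm]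
  refine tsum_congr fun k => ?_
  by_cases h : Accepts C Φ x₀ w k
  · rw [if_pos h, Measure.dirac_apply' _ hm]
    simp [indicator, h, hw.nonneg]
  · simp [h]

theorem jumpSigma_mono {Ω : Type*} (W : Ω → NoisePath) {s t : ℝ} (hst : s ≤ t) :
    jumpSigma C Φ x₀ W s ≤ jumpSigma C Φ x₀ W t :=
  biSup_mono fun _ hr => Icc_subset_Icc_right hst hr

variable [DiscreteMeasurableSpace Θ] [Countable Θ]
  {Ω : Type*} {mΩ : MeasurableSpace Ω} {P : Measure Ω} {lam : ℝ} {W : Ω → NoisePath}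

theorem measurableSet_acceptedIn (hW : IsThinningNoise P lam W) (hΦ : IsRegularFlow Φ) (k : ℕ)
    (s : ℝ) {A : Set (State Θ d)} (hA : MeasurableSet A) :
    MeasurableSet[pointSigma hW C x₀ hΦ (k + 1)] {ω | Accepts C Φ x₀ (W ω) k ∧
      (W ω).T (k + 1) ≤ s ∧ (thinned C Φ x₀ (W ω) (k + 1)).2.2 ∈ A} := by
  have h1 : Measurable[pointSigma hW C x₀ hΦ (k + 1)] fun ω => thinned C Φ x₀ (W ω) (k + 1) :=
    measurable_thinned hW hΦ (k + 1)
  have h2 : Measurable[pointSigma hW C x₀ hΦ (k + 1)] fun ω => thinned C Φ x₀ (W ω) k :=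
    (measurable_thinned hW hΦ k).mono (pointSigma_mono hW hΦ k.le_succ) le_rfl
  have h3 : Measurable[pointSigma hW C x₀ hΦ (k + 1)] fun ω => (W ω).T (k + 1) :=
    (hW.measurable_time_pastSigma 0 le_rfl).mono (pastSigma_zero_le_pointSigma hW hΦ (k + 1)) le_rfl
  simp only [accepts_iff_count]
  exact (measurableSet_eq_fun h1.fst (h2.fst.add_const 1)).inter
    ((measurableSet_le h3 measurable_const).inter (h1.snd.snd hA))

theorem measurable_jumpMeasure (hW : IsThinningNoise P lam W) (hΦ : IsRegularFlow Φ) (s : ℝ)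
    {A : Set (State Θ d)} (hA : MeasurableSet A) :
    Measurable fun ω => jumpMeasure C Φ x₀ (W ω) (Icc 0 s ×ˢ A) := by
  classical
  simp only [jumpMeasure_apply (hW.isCounting _) s hA]
  refine Measurable.tsum fun k => Measurable.ite ?_ measurable_const measurable_const
  exact pointSigma_le hW hΦ (k + 1) _ (measurableSet_acceptedIn hW hΦ k s hA)

theorem jumpSigma_le (hW : IsThinningNoise P lam W) (hΦ : IsRegularFlow Φ) (t : ℝ) :
    jumpSigma C Φ x₀ W t ≤ mΩ :=
  iSup₂_le fun s _ => iSup₂_le fun _ hA => (measurable_jumpMeasure hW hΦ s hA).comap_le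

/-- Before the `(k+1)`-st Poisson point, the history of the jumps is determined by the first `k`
points. -/
theorem exists_pointSigma_of_jumpSigma (hW : IsThinningNoise P lam W) (hΦ : IsRegularFlow Φ)
    (k : ℕ) {s : ℝ} {B : Set Ω} (hB : MeasurableSet[jumpSigma C Φ x₀ W s] B) :
    ∃ B', MeasurableSet[pointSigma hW C x₀ hΦ k] B' ∧
      ∀ ω, s < (W ω).T (k + 1) → (ω ∈ B ↔ ω ∈ B') := by
  classical
  set D : Set Ω := {ω | s < (W ω).T (k + 1)} with hD
  -- The sets whose trace on `D` is the trace of a set of `pointSigma` form a σ-algebra, here a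
  -- `map` of a `comap`; only the generators have to be examined.
  have key : jumpSigma C Φ x₀ W s ≤ MeasurableSpace.map (Subtype.val : D → Ω)
      (MeasurableSpace.comap Subtype.val (pointSigma hW C x₀ hΦ k)) := by
    refine iSup₂_le fun r hr => iSup₂_le fun A hA => ?_
    rw [← measurable_iff_comap_le]
    have hA' : MeasurableSet A := hA
    -- On `D` the `(k+1)`-st point comes after `s ≥ r`, so the jumps up to `r` are among the first
    -- `k` points.
    set F : Ω → ℝ≥0∞ := fun ω => ∑ j ∈ Finset.range k, if Accepts C Φ x₀ (W ω) j ∧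
      (W ω).T (j + 1) ≤ r ∧ (thinned C Φ x₀ (W ω) (j + 1)).2.2 ∈ A then 1 else 0 with hF
    have hFm : Measurable[pointSigma hW C x₀ hΦ k] F := by
      refine Finset.measurable_fun_sum _ fun j hj => Measurable.ite ?_ measurable_const
        measurable_const
      exact pointSigma_mono hW hΦ (Nat.succ_le_of_lt (Finset.mem_range.1 hj)) _
        (measurableSet_acceptedIn hW hΦ j r hA')
    have heq : ∀ ω : D, jumpMeasure C Φ x₀ (W ω) (Icc 0 r ×ˢ A) = F ω := by
      rintro ⟨ω, hω⟩
      have hω' : s < (W ω).T (k + 1) := hω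
      rw [jumpMeasure_apply (hW.isCounting _) r hA', hF]
      refine tsum_eq_sum fun j hj => if_neg ?_
      rintro ⟨-, h2, -⟩
      have hkj : k + 1 ≤ j + 1 := by simpa using hj
      exact absurd ((hr.2.trans_lt hω').trans_le
        ((hW.isCounting ω).strictMono.monotone hkj)) (not_lt.2 h2)
    intro S hS
    refine ⟨F ⁻¹' S, hFm hS, ?_⟩
    ext ω
    simp only [mem_preimage, heq]
  obtain ⟨B', hB', h⟩ := key B hB
  refine ⟨B', hB', fun ω hω => ?_⟩
  have := congrArg (fun S => (⟨ω, hω⟩ : D) ∈ S) h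
  simpa using this.symm

end JumpFiltration

/-! ### Centred increments over events of the past. -/

section MartingaleProperty

variable {Θ : Type*} {d : ℕ} [MeasurableSpace Θ]
  {C : JumpCharacteristics Θ d} {Φ : FlowFamily Θ d} {x₀ : State Θ d} {g : ℝ → State Θ d → ℝ}
  {Ω : Type*} {mΩ : MeasurableSpace Ω} {P : Measure Ω} {W : Ω → NoisePath}

theorem increment_eq_truncated (hW : IsThinningNoise P C.bound W) (s t : ℝ) {k n : ℕ} {ω : Ω}
    (h : (thinned C Φ x₀ (W ω) k).1 = n) :
    increment C Φ x₀ (W ω) g s t k = stepIncrement C Φ g s t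
      (((W ω).T k, truncated C Φ x₀ W k n ω), stepNoise W k n ω) := by
  rw [increment_eq_stepIncrement (hW.isCounting ω), truncated, if_pos h, h]
  simp [stepNoise, noiseVar]

variable [DiscreteMeasurableSpace Θ] [Countable Θ]

theorem measurable_increment (hW : IsThinningNoise P C.bound W) (hΦ : IsRegularFlow Φ)
    (hg : IsBoundedC1 g) (s t : ℝ) (k : ℕ) :
    Measurable fun ω => increment C Φ x₀ (W ω) g s t k := by
  have h1 : ∀ n, Measurable fun ω => stepIncrement C Φ g s t
      (((W ω).T k, truncated C Φ x₀ W k n ω), stepNoise W k n ω) := fun n => by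
    refine (measurable_stepIncrement hΦ hg s t).comp (((hW.measurable_time k).prodMk
      ((measurable_truncated hW hΦ k n).2.mono (hW.pastSigma_le k n) le_rfl)).prodMk ?_)
    exact (hW.measurable_noiseVar _).prodMk
      ((hW.measurable_noiseVar _).prodMk (hW.measurable_noiseVar _))
  have h2 : Measurable fun ω => (thinned C Φ x₀ (W ω) k).1 :=
    ((measurable_thinned hW hΦ k).mono (pointSigma_le hW hΦ k) le_rfl).fst
  have h3 := (measurable_of_slices (F := fun n ω => stepIncrement C Φ g s t
      (((W ω).T k, truncated C Φ x₀ W k n ω), stepNoise W k n ω)) h1).comp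
        (h2.prodMk measurable_id)
  convert h3 using 2 with ω
  exact increment_eq_truncated hW s t rfl

variable [IsProbabilityMeasure P]

theorem integrable_increment (hW : IsThinningNoise P C.bound W) (hΦ : IsRegularFlow Φ)
    (hg : IsBoundedC1 g) {s t : ℝ} (hs : 0 ≤ s) (hst : s ≤ t) :
    (∀ k, Integrable (fun ω => increment C Φ x₀ (W ω) g s t k) P) ∧
      Summable fun k => ∫ ω, ‖increment C Φ x₀ (W ω) g s t k‖ ∂P := by
  obtain ⟨K, hK0, hK⟩ := hg.exists_bound
  have ht := hs.trans hst
  have hpos := C.bound_pos x₀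
  have hi1 : ∀ k, Integrable (fun ω =>
      2 * K * (Ioc 0 t).indicator (fun _ => (1 : ℝ)) ((W ω).T (k + 1))) P := fun k => by
    refine Integrable.const_mul (Integrable.of_bound (C := 1) (Measurable.aestronglyMeasurable
      ((measurable_const.indicator measurableSet_Ioc).comp (hW.measurable_T k)))
      (ae_of_all _ fun ω => ?_)) _
    simp only [Function.comp, indicator]
    split_ifs <;> simp
  have hi2 : ∀ k, Integrable (fun ω => C.bound * (2 * K) * sojourn (W ω) t k) P := fun k =>
    (integrable_sojourn hW ht k).const_mul _
  have hle : ∀ k ω, ‖increment C Φ x₀ (W ω) g s t k‖ ≤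
      2 * K * (Ioc 0 t).indicator (fun _ => (1 : ℝ)) ((W ω).T (k + 1)) +
        C.bound * (2 * K) * sojourn (W ω) t k := fun k ω =>
    abs_increment_le (hW.isCounting ω) hg hK0 hK hs k
  have hinteg : ∀ k, Integrable (fun ω => increment C Φ x₀ (W ω) g s t k) P := fun k =>
    ((hi1 k).add (hi2 k)).mono' (measurable_increment hW hΦ hg s t k).aestronglyMeasurable
      (ae_of_all _ (hle k))
  refine ⟨hinteg, ?_⟩
  refine Summable.of_nonneg_of_le (fun k => integral_nonneg fun ω => norm_nonneg _)
    (fun k => integral_mono (hinteg k).norm ((hi1 k).add (hi2 k)) (hle k)) ?_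
  have : ∀ k, ∫ ω, ((fun ω => 2 * K * (Ioc 0 t).indicator (fun _ => (1 : ℝ)) ((W ω).T (k + 1))) +
        fun ω => C.bound * (2 * K) * sojourn (W ω) t k) ω ∂P =
      2 * K * (∫ ω, (Ioc 0 t).indicator (fun _ => (1 : ℝ)) ((W ω).T (k + 1)) ∂P) +
        C.bound * (2 * K) * ∫ ω, sojourn (W ω) t k ∂P := fun k => by
    rw [integral_add' (hi1 k) (hi2 k), integral_const_mul, integral_const_mul]
  simp only [this]
  exact ((summable_prob_time_le hW hpos ht).mul_left _).add
    ((summable_integral_sojourn hW ht).mul_left _)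

/-- On `D` the count is the constant `n`, so the `V` used by the step is the deterministic `V_{n+1}`
and the step noise is independent of the past. -/
theorem setIntegral_increment_pastSigma (hW : IsThinningNoise P C.bound W)
    (hΦ : IsRegularFlow Φ) (hg : IsBoundedC1 g) {s t : ℝ} (hs : 0 ≤ s) (hst : s ≤ t) {k n : ℕ}
    {D : Set Ω} (hD : MeasurableSet[pastSigma W k n] D)
    (hDn : ∀ ω ∈ D, (thinned C Φ x₀ (W ω) k).1 = n) :
    ∫ ω in D, increment C Φ x₀ (W ω) g s t k ∂P = 0 := by
  have hD' := hW.pastSigma_le k n _ hD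
  rw [← integral_indicator hD']
  -- The indicator of `D` is carried along as part of the past; for a frozen past it is a constant
  -- factor of a centred variable.
  set X : Ω → (ℝ × ℝ × State Θ d) × ℝ := fun ω =>
    (((W ω).T k, truncated C Φ x₀ W k n ω), D.indicator (fun _ => (1 : ℝ)) ω) with hXdef
  have hX : Measurable[pastSigma W k n] X :=
    ((hW.measurable_time_pastSigma n le_rfl).prodMk (measurable_truncated hW hΦ k n).2).prodMk
      (measurable_const.indicator hD)
  have hF : Measurable fun z : ((ℝ × ℝ × State Θ d) × ℝ) × ℝ × ℝ × ℝ =>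
      z.1.2 * stepIncrement C Φ g s t (z.1.1, z.2) :=
    measurable_fst.snd.mul ((measurable_stepIncrement hΦ hg s t).comp
      (measurable_fst.fst.prodMk measurable_snd))
  have hval : ∀ ω, (X ω).2 * stepIncrement C Φ g s t ((X ω).1, stepNoise W k n ω) =
      D.indicator (fun ω => increment C Φ x₀ (W ω) g s t k) ω := by
    intro ω
    by_cases hω : ω ∈ D
    · simp only [hXdef, indicator_of_mem hω, one_mul]
      exact (increment_eq_truncated hW s t (hDn ω hω)).symm
    · simp only [hXdef, indicator_of_notMem hω, zero_mul]
  have h := hW.integral_step_eq_zero hX hF (by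
      simp only [hval]
      exact ((integrable_increment hW hΦ hg hs hst).1 k).indicator hD') (fun a => by
      simp only [integral_const_mul, integral_stepIncrement hΦ hg, mul_zero])
  simpa only [hval] using h

/-- `B` may be replaced by an event of `pointSigma`, because the two differ only where the increment
vanishes; that event is then cut according to the number of acceptances. -/
theorem setIntegral_increment_eq_zero (hW : IsThinningNoise P C.bound W)
    (hΦ : IsRegularFlow Φ) (hg : IsBoundedC1 g) {s t : ℝ} (hs : 0 ≤ s) (hst : s ≤ t) (k : ℕ)
    {B : Set Ω} (hB : MeasurableSet[jumpSigma C Φ x₀ W s] B) :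
    ∫ ω in B, increment C Φ x₀ (W ω) g s t k ∂P = 0 := by
  obtain ⟨B', hB', hBB'⟩ := exists_pointSigma_of_jumpSigma hW hΦ k hB
  have hBm := jumpSigma_le hW hΦ s _ hB
  have hBm' := pointSigma_le hW hΦ k _ hB'
  have h1 : ∫ ω in B, increment C Φ x₀ (W ω) g s t k ∂P =
      ∫ ω in B', increment C Φ x₀ (W ω) g s t k ∂P := by
    rw [← integral_indicator hBm, ← integral_indicator hBm']
    refine integral_congr_ae (ae_of_all _ fun ω => ?_)
    by_cases hω : s < (W ω).T (k + 1)
    · by_cases hb : ω ∈ B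
      · simp only [indicator_of_mem hb, indicator_of_mem ((hBB' ω hω).1 hb)]
      · simp only [indicator_of_notMem hb, indicator_of_notMem (mt (hBB' ω hω).2 hb)]
    · simp only [indicator, increment_eq_zero s t (not_lt.1 hω), ite_self]
  have h2 : B' = ⋃ n, (B' ∩ {ω | (thinned C Φ x₀ (W ω) k).1 = n}) := by ext ω; simp
  rw [h1, h2, integral_iUnion (fun n => hW.pastSigma_le k n _ (hB' n)) ?_
    ((integrable_increment hW hΦ hg hs hst).1 k).integrableOn]
  · simp only [setIntegral_increment_pastSigma hW hΦ hg hs hst (hB' _) (fun ω hω => hω.2), tsum_zero]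
  · intro i j hij
    rw [Function.onFun, Set.disjoint_left]
    rintro ω ⟨-, h3⟩ ⟨-, h4⟩
    exact hij (h3.symm.trans h4)

variable [TopologicalSpace Θ] [DiscreteTopology Θ]

theorem integrable_martingalePart_sub (hW : IsThinningNoise P C.bound W) (hΦ : IsRegularFlow Φ)
    (hg : IsBoundedC1 g) {s t : ℝ} (hs : 0 ≤ s) (hst : s ≤ t) :
    Integrable (fun ω => martingalePart C Φ x₀ (W ω) g t - martingalePart C Φ x₀ (W ω) g s) P :=
  integrable_of_hasSum (integrable_increment hW hΦ hg hs hst).1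
    (integrable_increment hW hΦ hg hs hst).2
    fun ω => hasSum_increment (hW.isCounting ω) hΦ hg hs hst

theorem integrable_martingalePart (hW : IsThinningNoise P C.bound W) (hΦ : IsRegularFlow Φ)
    (hg : IsBoundedC1 g) {t : ℝ} (ht : 0 ≤ t) :
    Integrable (fun ω => martingalePart C Φ x₀ (W ω) g t) P := by
  have h := integrable_martingalePart_sub (x₀ := x₀) hW hΦ hg le_rfl ht
  have h0 : ∀ ω, martingalePart C Φ x₀ (W ω) g 0 = 0 := fun ω => by
    simp [martingalePart, compensatedIntegral]
  simpa only [h0, sub_zero] using h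

theorem setIntegral_martingalePart (hW : IsThinningNoise P C.bound W) (hΦ : IsRegularFlow Φ)
    (hg : IsBoundedC1 g) {s t : ℝ} (hs : 0 ≤ s) (hst : s ≤ t) {B : Set Ω}
    (hB : MeasurableSet[jumpSigma C Φ x₀ W s] B) :
    ∫ ω in B, martingalePart C Φ x₀ (W ω) g s ∂P =
      ∫ ω in B, martingalePart C Φ x₀ (W ω) g t ∂P := by
  obtain ⟨h1, h2⟩ := integrable_increment (x₀ := x₀) hW hΦ hg hs hst
  have h3 := hasSum_integral_of_summable_integral_norm (μ := P.restrict B)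
    (F := fun k ω => increment C Φ x₀ (W ω) g s t k) (fun k => (h1 k).integrableOn)
    (Summable.of_nonneg_of_le (fun k => integral_nonneg fun ω => norm_nonneg _)
      (fun k => setIntegral_le_integral (h1 k).norm (ae_of_all _ fun ω => norm_nonneg _)) h2)
  simp only [setIntegral_increment_eq_zero hW hΦ hg hs hst _ hB,
    (hasSum_increment (hW.isCounting _) hΦ hg hs hst).tsum_eq] at h3
  have h4 := h3.unique hasSum_zero
  rw [integral_sub (integrable_martingalePart hW hΦ hg (hs.trans hst)).integrableOn
    (integrable_martingalePart hW hΦ hg hs).integrableOn] at h4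
  linarith

end MartingaleProperty

/-! ### Counting the jumps. -/

section JumpIndex

variable {Θ : Type*} {d : ℕ} [MeasurableSpace Θ] {C : JumpCharacteristics Θ d}
  {Φ : FlowFamily Θ d} {x₀ : State Θ d} {w : NoisePath}

theorem jumpIndex_spec (hw : w.IsCounting) {s : ℝ} (hs : 0 ≤ s) :
    jumpTime C Φ x₀ w (jumpIndex C Φ x₀ w s) ≤ s ∧
      (s : EReal) < jumpTime C Φ x₀ w (jumpIndex C Φ x₀ w s + 1) := by
  obtain ⟨k, h1, h2⟩ := hw.exists_mem_Ico hs
  obtain ⟨-, e2, e3⟩ := jumpTime_thinned (C := C) (Φ := Φ) (x₀ := x₀) hw h1 h2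
  rw [jumpIndex_eq_of_mem hw e2 e3]
  exact ⟨e2, e3⟩

theorem jumpTime_le_iff (hw : w.IsCounting) {s : ℝ} (hs : 0 ≤ s) (n : ℕ) :
    jumpTime C Φ x₀ w n ≤ s ↔ n ≤ jumpIndex C Φ x₀ w s := by
  obtain ⟨h1, h2⟩ := jumpIndex_spec (C := C) (Φ := Φ) (x₀ := x₀) hw hs
  constructor
  · intro h
    by_contra hlt
    exact absurd (h2.trans_le ((jumpTime_monotone hw (by omega)).trans h)) (lt_irrefl _)
  · exact fun h => (jumpTime_monotone hw h).trans h1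

theorem jumpTime_nonneg (hw : w.IsCounting) (n : ℕ) : 0 ≤ jumpTime C Φ x₀ w n := by
  rw [← jumpTime_zero (C := C) (Φ := Φ) (x₀ := x₀) hw]
  exact jumpTime_monotone hw n.zero_le

theorem coe_toReal_jumpTime (hw : w.IsCounting) {n : ℕ} (h : jumpTime C Φ x₀ w n ≠ ⊤) :
    ((jumpTime C Φ x₀ w n).toReal : EReal) = jumpTime C Φ x₀ w n :=
  EReal.coe_toReal h (ne_of_gt (lt_of_lt_of_le EReal.bot_lt_zero (jumpTime_nonneg hw n)))

theorem ne_top_of_le_coe {a : EReal} {s : ℝ} (h : a ≤ s) : a ≠ ⊤ :=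
  ne_of_lt (h.trans_lt (EReal.coe_lt_top s))

theorem toReal_jumpTime_le_iff (hw : w.IsCounting) {n : ℕ} (h : jumpTime C Φ x₀ w n ≠ ⊤) (s : ℝ) :
    (jumpTime C Φ x₀ w n).toReal ≤ s ↔ jumpTime C Φ x₀ w n ≤ s := by
  rw [← EReal.coe_le_coe_iff, coe_toReal_jumpTime hw h]

open Classical in
theorem jumpMeasure_eq_sum_range (hw : w.IsCounting) {s : ℝ} (hs : 0 ≤ s) {A : Set (State Θ d)}
    (hA : MeasurableSet A) :
    jumpMeasure C Φ x₀ w (Icc 0 s ×ˢ A) = ∑ j ∈ Finset.range (jumpIndex C Φ x₀ w s),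
      if postJump C Φ x₀ w (j + 1) ∈ A then 1 else 0 := by
  have hm : MeasurableSet (Icc 0 s ×ˢ A) := measurableSet_Icc.prod hA
  rw [jumpMeasure, Measure.sum_apply _ hm, tsum_eq_sum (s := Finset.range (jumpIndex C Φ x₀ w s))]
  · refine Finset.sum_congr rfl fun j hj => ?_
    have h1 : jumpTime C Φ x₀ w (j + 1) ≤ s :=
      (jumpTime_le_iff hw hs _).2 (Nat.succ_le_of_lt (Finset.mem_range.1 hj))
    have h2 := ne_top_of_le_coe h1
    rw [if_neg h2, Measure.dirac_apply' _ hm]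
    simp [indicator, (toReal_jumpTime_le_iff hw h2 s).2 h1,
      EReal.toReal_nonneg (jumpTime_nonneg hw (j + 1))]
  · intro j hj
    split_ifs with h
    · simp
    · rw [Measure.dirac_apply' _ hm, indicator_of_notMem]
      rintro ⟨⟨-, h1⟩, -⟩
      have := (jumpTime_le_iff hw hs _).1 ((toReal_jumpTime_le_iff hw h s).1 h1)
      exact hj (Finset.mem_range.2 this)

/-- Makes the current jump index observable from `p`, the starting point of adaptedness. -/
theorem jumpMeasure_univ (hw : w.IsCounting) {s : ℝ} (hs : 0 ≤ s) :
    jumpMeasure C Φ x₀ w (Icc 0 s ×ˢ univ) = (jumpIndex C Φ x₀ w s : ℝ≥0∞) := by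
  rw [jumpMeasure_eq_sum_range hw hs MeasurableSet.univ]
  simp

/-- A jump before `t` can be separated from the other jumps by rational times or `t`. -/
theorem exists_separating_times (hw : w.IsCounting) {t : ℝ} {n : ℕ}
    (h : jumpTime C Φ x₀ w (n + 1) ≤ t) :
    ∃ r ∈ insert t (Icc 0 t ∩ range ((↑) : ℚ → ℝ)), ∃ s ∈ insert t (Icc 0 t ∩ range ((↑) : ℚ → ℝ)),
      jumpIndex C Φ x₀ w r = n ∧ jumpIndex C Φ x₀ w s = n + 1 := by
  have htop := ne_top_of_le_coe h
  have htop' : jumpTime C Φ x₀ w n ≠ ⊤ :=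
    ne_top_of_le_coe ((jumpTime_monotone hw n.le_succ).trans h)
  have hlt := jumpTime_lt_succ hw htop'
  have hlt2 := jumpTime_lt_succ hw htop
  obtain ⟨q, hq1, hq2⟩ := EReal.exists_rat_btwn_of_lt hlt
  have hq1' : jumpTime C Φ x₀ w n < ((q : ℝ) : EReal) := hq1
  have hq2' : ((q : ℝ) : EReal) < jumpTime C Φ x₀ w (n + 1) := hq2
  refine ⟨q, Or.inr ⟨⟨?_, ?_⟩, q, rfl⟩, ?_⟩
  · exact EReal.coe_le_coe_iff.1 ((jumpTime_nonneg hw n).trans hq1'.le)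
  · exact EReal.coe_le_coe_iff.1 (hq2'.le.trans h)
  have hr := jumpIndex_eq_of_mem hw hq1'.le hq2'
  -- If the jump occurs at `t` itself, no time of `[0, t]` lies after it, which is why `t` is
  -- adjoined to the rationals.
  rcases h.lt_or_eq with h' | h'
  · obtain ⟨p, hp1, hp2⟩ := EReal.exists_rat_btwn_of_lt (lt_min h' hlt2)
    have hp1' : jumpTime C Φ x₀ w (n + 1) < ((p : ℝ) : EReal) := hp1
    have hp2' : ((p : ℝ) : EReal) < min (t : EReal) (jumpTime C Φ x₀ w (n + 1 + 1)) := hp2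
    refine ⟨p, Or.inr ⟨⟨?_, ?_⟩, p, rfl⟩, hr, ?_⟩
    · exact EReal.coe_le_coe_iff.1 ((jumpTime_nonneg hw (n + 1)).trans hp1'.le)
    · exact EReal.coe_le_coe_iff.1 (hp2'.le.trans (min_le_left _ _))
    · exact jumpIndex_eq_of_mem hw hp1'.le (hp2'.trans_le (min_le_right _ _))
  · exact ⟨t, mem_insert _ _, hr, jumpIndex_eq_of_mem hw h'.le (h' ▸ hlt2)⟩

end JumpIndex

/-! ### Adaptedness to the jump filtration, and the martingale. -/

section Adapted

variable {Θ : Type*} {d : ℕ} [MeasurableSpace Θ] {C : JumpCharacteristics Θ d}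
  {Φ : FlowFamily Θ d} {x₀ : State Θ d} {g : ℝ → State Θ d → ℝ}
  {Ω : Type*} {W : Ω → NoisePath}

theorem measurable_jumpMeasure_jumpSigma {s t : ℝ} (hs : s ∈ Icc 0 t) {A : Set (State Θ d)}
    (hA : MeasurableSet A) : Measurable[jumpSigma C Φ x₀ W t]
      fun ω => jumpMeasure C Φ x₀ (W ω) (Icc 0 s ×ˢ A) := by
  refine Measurable.of_comap_le ?_
  refine le_trans ?_ (le_biSup (fun s => ⨆ A ∈ {A : Set (State Θ d) | MeasurableSet A},
    MeasurableSpace.comap (fun ω => jumpMeasure C Φ x₀ (W ω) (Icc 0 s ×ˢ A)) inferInstance) hs)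
  exact le_biSup (fun A : Set (State Θ d) =>
    MeasurableSpace.comap (fun ω => jumpMeasure C Φ x₀ (W ω) (Icc 0 s ×ˢ A)) inferInstance)
      (show A ∈ {A : Set (State Θ d) | MeasurableSet A} from hA)

theorem measurableSet_jumpIndex (hw : ∀ ω, (W ω).IsCounting) {s t : ℝ} (hs : s ∈ Icc 0 t) (n : ℕ) :
    MeasurableSet[jumpSigma C Φ x₀ W t] {ω | jumpIndex C Φ x₀ (W ω) s = n} := by
  have h := measurable_jumpMeasure_jumpSigma (C := C) (Φ := Φ) (x₀ := x₀) (W := W) hs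
    MeasurableSet.univ
  have : {ω | jumpIndex C Φ x₀ (W ω) s = n} =
      (fun ω => jumpMeasure C Φ x₀ (W ω) (Icc 0 s ×ˢ univ)) ⁻¹' {(n : ℝ≥0∞)} := by
    ext ω
    simp [jumpMeasure_univ (hw ω) hs.1]
  rw [this]
  exact h (measurableSet_singleton _)

theorem measurableSet_jumpTime_le (hw : ∀ ω, (W ω).IsCounting) {s t : ℝ} (hs : s ∈ Icc 0 t)
    (n : ℕ) : MeasurableSet[jumpSigma C Φ x₀ W t] {ω | jumpTime C Φ x₀ (W ω) n ≤ s} := by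
  have : {ω | jumpTime C Φ x₀ (W ω) n ≤ s} =
      ⋃ i ∈ {i | n ≤ i}, {ω | jumpIndex C Φ x₀ (W ω) s = i} := by
    ext ω
    simp [jumpTime_le_iff (hw ω) hs.1]
  rw [this]
  exact MeasurableSet.biUnion (to_countable _) fun i _ => measurableSet_jumpIndex hw hs i

/-- If `r` and `s` have exactly the `(n+1)`-st jump between them, its location is in `A` if and only
if `p([0,r] × A)` and `p([0,s] × A)` differ. Countably many pairs suffice. -/
theorem measurableSet_postJump (hw : ∀ ω, (W ω).IsCounting) {t : ℝ} (ht : 0 ≤ t) (n : ℕ)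
    {A : Set (State Θ d)} (hA : MeasurableSet A) : MeasurableSet[jumpSigma C Φ x₀ W t]
      {ω | jumpTime C Φ x₀ (W ω) (n + 1) ≤ t ∧ postJump C Φ x₀ (W ω) (n + 1) ∈ A} := by
  classical
  set D : Set ℝ := insert t (Icc 0 t ∩ range ((↑) : ℚ → ℝ)) with hD
  have hDc : D.Countable := ((countable_range _).mono inter_subset_right).insert _
  have hDt : D ⊆ Icc 0 t := insert_subset ⟨ht, le_rfl⟩ inter_subset_left
  have hval : ∀ ω, ∀ r ∈ D, ∀ s ∈ D, jumpIndex C Φ x₀ (W ω) r = n →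
      jumpIndex C Φ x₀ (W ω) s = n + 1 →
      (jumpMeasure C Φ x₀ (W ω) (Icc 0 r ×ˢ A) ≠ jumpMeasure C Φ x₀ (W ω) (Icc 0 s ×ˢ A) ↔
        postJump C Φ x₀ (W ω) (n + 1) ∈ A) := by
    intro ω r hr s hs h1 h2
    rw [jumpMeasure_eq_sum_range (hw ω) (hDt hr).1 hA, jumpMeasure_eq_sum_range (hw ω) (hDt hs).1 hA,
      h1, h2, Finset.sum_range_succ]
    have hfin : ∑ j ∈ Finset.range n, (if postJump C Φ x₀ (W ω) (j + 1) ∈ A then (1 : ℝ≥0∞) else 0)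
        ≠ ⊤ := by
      refine ENNReal.sum_ne_top.2 fun j _ => ?_
      split_ifs <;> simp
    by_cases h : postJump C Φ x₀ (W ω) (n + 1) ∈ A
    · simp only [h, if_true, iff_true]
      exact (ENNReal.lt_add_right hfin one_ne_zero).ne
    · simp [h]
  have heq : {ω | jumpTime C Φ x₀ (W ω) (n + 1) ≤ t ∧ postJump C Φ x₀ (W ω) (n + 1) ∈ A} =
      ⋃ r ∈ D, ⋃ s ∈ D, {ω | jumpIndex C Φ x₀ (W ω) r = n} ∩
        ({ω | jumpIndex C Φ x₀ (W ω) s = n + 1} ∩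
          {ω | jumpMeasure C Φ x₀ (W ω) (Icc 0 r ×ˢ A) =
            jumpMeasure C Φ x₀ (W ω) (Icc 0 s ×ˢ A)}ᶜ) := by
    ext ω
    simp only [mem_ofPred_eq, mem_iUnion, mem_inter_iff, mem_compl_iff, exists_prop]
    constructor
    · rintro ⟨h1, h2⟩
      obtain ⟨r, hr, s, hs, e1, e2⟩ := exists_separating_times (hw ω) h1
      exact ⟨r, hr, s, hs, e1, e2, (hval ω r hr s hs e1 e2).2 h2⟩
    · rintro ⟨r, hr, s, hs, e1, e2, h⟩
      refine ⟨?_, (hval ω r hr s hs e1 e2).1 h⟩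
      exact ((jumpTime_le_iff (hw ω) (hDt hs).1 _).2 e2.ge).trans
        (EReal.coe_le_coe_iff.2 (hDt hs).2)
  rw [heq]
  refine MeasurableSet.biUnion hDc fun r hr => MeasurableSet.biUnion hDc fun s hs => ?_
  refine (measurableSet_jumpIndex hw (hDt hr) n).inter ((measurableSet_jumpIndex hw (hDt hs) (n + 1)).inter
    (MeasurableSet.compl ?_))
  exact measurableSet_eq_fun (measurable_jumpMeasure_jumpSigma (hDt hr) hA)
    (measurable_jumpMeasure_jumpSigma (hDt hs) hA)

variable (C Φ x₀) in
open Classical in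
/-- The `n`-th jump time if it comes before `t`, and `t` otherwise. -/
def stoppedTime (w : NoisePath) (t : ℝ) (n : ℕ) : ℝ :=
  if jumpTime C Φ x₀ w n ≤ t then (jumpTime C Φ x₀ w n).toReal else t

variable (C Φ x₀) in
open Classical in
/-- The `n`-th post-jump location if the jump comes before `t`, and `x₀` otherwise. -/
def stoppedState (w : NoisePath) (t : ℝ) (n : ℕ) : State Θ d :=
  if jumpTime C Φ x₀ w n ≤ t then postJump C Φ x₀ w n else x₀

theorem lt_stoppedTime_iff {w : NoisePath} (hw : w.IsCounting) {s t : ℝ} (hst : s < t) (n : ℕ) :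
    s < stoppedTime C Φ x₀ w t n ↔ (s : EReal) < jumpTime C Φ x₀ w n := by
  rw [stoppedTime]
  split_ifs with h
  · rw [← not_le, toReal_jumpTime_le_iff hw (ne_top_of_le_coe h), not_le]
  · simp only [hst, true_iff]
    exact (EReal.coe_lt_coe_iff.2 hst).trans (not_le.1 h)

theorem measurable_stoppedTime (hw : ∀ ω, (W ω).IsCounting) (t : ℝ) (n : ℕ) :
    Measurable[jumpSigma C Φ x₀ W t] fun ω => stoppedTime C Φ x₀ (W ω) t n := by
  let mt : MeasurableSpace Ω := jumpSigma C Φ x₀ W t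
  refine measurable_of_Ioi fun s => ?_
  by_cases hst : s < t
  · by_cases hs : 0 ≤ s
    · have : (fun ω => stoppedTime C Φ x₀ (W ω) t n) ⁻¹' Ioi s =
          {ω | jumpTime C Φ x₀ (W ω) n ≤ s}ᶜ := by
        ext ω
        simp [lt_stoppedTime_iff (hw ω) hst]
      rw [this]
      exact (measurableSet_jumpTime_le hw ⟨hs, hst.le⟩ n).compl
    · have : (fun ω => stoppedTime C Φ x₀ (W ω) t n) ⁻¹' Ioi s = univ := by
        ext ω
        simp only [mem_preimage, mem_Ioi, mem_univ, iff_true, lt_stoppedTime_iff (hw ω) hst]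
        refine lt_of_lt_of_le ?_ (jumpTime_nonneg (hw ω) n)
        exact_mod_cast not_le.1 hs
      rw [this]
      exact MeasurableSet.univ
  · have : (fun ω => stoppedTime C Φ x₀ (W ω) t n) ⁻¹' Ioi s = ∅ := by
      ext ω
      simp only [mem_preimage, mem_Ioi, mem_empty_iff_false, iff_false, not_lt]
      refine le_trans ?_ (not_lt.1 hst)
      rw [stoppedTime]
      split_ifs with h
      · exact (toReal_jumpTime_le_iff (hw ω) (ne_top_of_le_coe h) t).2 h
      · exact le_rfl
    rw [this]
    exact MeasurableSet.empty

theorem measurable_stoppedState (hw : ∀ ω, (W ω).IsCounting) {t : ℝ} (ht : 0 ≤ t) (n : ℕ) :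
    Measurable[jumpSigma C Φ x₀ W t] fun ω => stoppedState C Φ x₀ (W ω) t n := by
  cases n with
  | zero =>
    have : (fun ω => stoppedState C Φ x₀ (W ω) t 0) = fun _ => x₀ := by
      ext1 ω
      rw [stoppedState]
      split_ifs <;> rfl
    rw [this]
    exact measurable_const
  | succ n =>
    intro A hA
    have : (fun ω => stoppedState C Φ x₀ (W ω) t (n + 1)) ⁻¹' A =
        {ω | jumpTime C Φ x₀ (W ω) (n + 1) ≤ t ∧ postJump C Φ x₀ (W ω) (n + 1) ∈ A} ∪
          ({ω | jumpTime C Φ x₀ (W ω) (n + 1) ≤ t}ᶜ ∩ {_ω | x₀ ∈ A}) := by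
      ext ω
      by_cases h : jumpTime C Φ x₀ (W ω) (n + 1) ≤ t <;> simp [stoppedState, h]
    rw [this]
    exact (measurableSet_postJump hw ht n hA).union
      ((measurableSet_jumpTime_le hw ⟨ht, le_rfl⟩ (n + 1)).compl.inter (MeasurableSet.const _))

theorem process_eq_stopped {w : NoisePath} (hw : w.IsCounting) {ρ t : ℝ} (hρ : 0 ≤ ρ)
    (hρt : ρ ≤ t) :
    process C Φ x₀ w ρ = flowFrom Φ (stoppedTime C Φ x₀ w t (jumpIndex C Φ x₀ w ρ),
      stoppedState C Φ x₀ w t (jumpIndex C Φ x₀ w ρ)) ρ := by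
  obtain ⟨h1, -⟩ := jumpIndex_spec (C := C) (Φ := Φ) (x₀ := x₀) hw hρ
  have h2 : jumpTime C Φ x₀ w (jumpIndex C Φ x₀ w ρ) ≤ t :=
    h1.trans (EReal.coe_le_coe_iff.2 hρt)
  have h3 : (jumpTime C Φ x₀ w (jumpIndex C Φ x₀ w ρ)).toReal ≤ ρ :=
    (toReal_jumpTime_le_iff hw (ne_top_of_le_coe h1) ρ).2 h1
  rw [stoppedTime, if_pos h2, stoppedState, if_pos h2, flowFrom, process, lastJump,
    max_eq_left (sub_nonneg.2 h3)]

/-- Stopped times never exceed `t`, so the alternative `t ≤ ρ` is needed for the search over `n` to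
terminate at every `ρ`. -/
theorem exists_jumpTime_gt {w : NoisePath} (hw : w.IsCounting) {t ρ : ℝ} :
    ∃ n, ρ < stoppedTime C Φ x₀ w t (n + 1) ∨ t ≤ ρ := by
  rcases le_or_gt t ρ with h | h
  · exact ⟨0, Or.inr h⟩
  · rcases le_or_gt 0 ρ with h0 | h0
    · exact ⟨jumpIndex C Φ x₀ w ρ, Or.inl ((lt_stoppedTime_iff hw h _).2 (jumpIndex_spec hw h0).2)⟩
    · refine ⟨0, Or.inl ((lt_stoppedTime_iff hw h _).2 (lt_of_lt_of_le ?_ (jumpTime_nonneg hw 1)))⟩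
      exact_mod_cast h0

theorem find_eq_jumpIndex {w : NoisePath} (hw : w.IsCounting) {t ρ : ℝ} (h0 : 0 ≤ ρ) (h : ρ < t)
    {n : ℕ} (h1 : ρ < stoppedTime C Φ x₀ w t (n + 1) ∨ t ≤ ρ)
    (h2 : ∀ m < n, ¬ (ρ < stoppedTime C Φ x₀ w t (m + 1) ∨ t ≤ ρ)) :
    n = jumpIndex C Φ x₀ w ρ := by
  have h1' := (lt_stoppedTime_iff hw h _).1 (h1.resolve_right (not_le.2 h))
  refine (jumpIndex_eq_of_mem hw ?_ h1').symm
  cases n with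
  | zero => rw [jumpTime_zero hw]; exact_mod_cast h0
  | succ n =>
    have := h2 n n.lt_succ_self
    rw [not_or, lt_stoppedTime_iff hw h, not_lt] at this
    exact this.1

variable [DiscreteMeasurableSpace Θ] [Countable Θ]

/-- The path on `[0, t[` is rebuilt from the stopped times and states, which are known at time `t`.
This gives an integrand jointly measurable in `ω` and time; the excluded time `t` is negligible. -/
theorem measurable_integral_opS_jumpSigma (hw : ∀ ω, (W ω).IsCounting) (hΦ : IsRegularFlow Φ)
    (hg : IsBoundedC1 g) {t : ℝ} (ht : 0 ≤ t) :
    Measurable[jumpSigma C Φ x₀ W t]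
      fun ω => ∫ s in (0 : ℝ)..t, opS C g s (process C Φ x₀ (W ω) s) := by
  classical
  let mt : MeasurableSpace Ω := jumpSigma C Φ x₀ W t
  have hT : ∀ n, Measurable fun ω => stoppedTime C Φ x₀ (W ω) t n := measurable_stoppedTime hw t
  have hY : ∀ n, Measurable fun ω => stoppedState C Φ x₀ (W ω) t n := measurable_stoppedState hw ht
  have hex : ∀ z : Ω × ℝ, ∃ n, z.2 < stoppedTime C Φ x₀ (W z.1) t (n + 1) ∨ t ≤ z.2 := fun z =>
    exists_jumpTime_gt (hw z.1)
  have hm := Measurable.find (f := fun n (z : Ω × ℝ) => opS C g (max z.2 0)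
      (flowFrom Φ (stoppedTime C Φ x₀ (W z.1) t n, stoppedState C Φ x₀ (W z.1) t n) z.2))
    (p := fun n z => z.2 < stoppedTime C Φ x₀ (W z.1) t (n + 1) ∨ t ≤ z.2)
    (fun n => (measurable_opS hg).comp (measurable_snd.prodMk ((measurable_flowFrom hΦ).comp
      ((((hT n).comp measurable_fst).prodMk ((hY n).comp measurable_fst)).prodMk measurable_snd))))
    (fun n => (measurableSet_lt measurable_snd ((hT (n + 1)).comp measurable_fst)).union
      (measurableSet_le measurable_const measurable_snd)) hex
  have hI := measurable_integral_Ioc (b := fun ω ρ => opS C g (max ρ 0)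
      (flowFrom Φ (stoppedTime C Φ x₀ (W ω) t (Nat.find (hex (ω, ρ))),
        stoppedState C Φ x₀ (W ω) t (Nat.find (hex (ω, ρ)))) ρ)) (σ := fun _ => t) hm
    measurable_const
  convert hI using 2 with ω
  rw [intervalIntegral.integral_of_le ht]
  refine setIntegral_congr_ae measurableSet_Ioc ?_
  have : ∀ᵐ ρ ∂(volume : Measure ℝ), ρ ≠ t := by simp [ae_iff]
  filter_upwards [this] with ρ h1 h2
  have hlt : ρ < t := lt_of_le_of_ne h2.2 h1
  have hf := find_eq_jumpIndex (hw ω) h2.1.le hlt (Nat.find_spec (hex (ω, ρ)))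
    (fun m hm => Nat.find_min (hex (ω, ρ)) hm)
  rw [hf, ← process_eq_stopped (hw ω) h2.1.le h2.2, max_eq_left h2.1.le]

variable [TopologicalSpace Θ] [DiscreteTopology Θ]

-- Poisson points are useless here, as rejected ones are not seen by `jumpSigma`, so the sum runs
-- over jumps. Since a jump leaves `ν` unchanged, the left limit pairs the old mode with the new
-- `ν`, and the sum involves only observable quantities.
open Classical in
theorem integral_jumpMeasure_eq_tsum_jumps {w : NoisePath} (hw : w.IsCounting)
    (hΦ : IsRegularFlow Φ) (t : ℝ) :
    ∫ z in Ioc 0 t ×ˢ univ, jumpIntegrand C Φ x₀ w g z ∂(jumpMeasure C Φ x₀ w) =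
      ∑' n, if jumpTime C Φ x₀ w (n + 1) ≤ t then
        g (stoppedTime C Φ x₀ w t (n + 1)) (stoppedState C Φ x₀ w t (n + 1)) -
          g (stoppedTime C Φ x₀ w t (n + 1)) ((stoppedState C Φ x₀ w t n).1,
            (stoppedState C Φ x₀ w t (n + 1)).2) else 0 := by
  have hmeas : jumpMeasure C Φ x₀ w = Measure.sum fun n =>
      if jumpTime C Φ x₀ w (n + 1) ≠ ⊤ then Measure.dirac
        ((jumpTime C Φ x₀ w (n + 1)).toReal, postJump C Φ x₀ w (n + 1)) else 0 := by
    rw [jumpMeasure]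
    congr 1
    ext1 n
    split_ifs <;> simp_all
  have hpos : ∀ n, jumpTime C Φ x₀ w (n + 1) ≠ ⊤ → 0 < (jumpTime C Φ x₀ w (n + 1)).toReal := by
    intro n hn
    rw [← EReal.coe_lt_coe_iff, coe_toReal_jumpTime hw hn]
    have h0 : jumpTime C Φ x₀ w 0 < jumpTime C Φ x₀ w 1 :=
      jumpTime_lt_succ hw (by rw [jumpTime_zero hw]; exact EReal.zero_ne_top)
    rw [jumpTime_zero hw] at h0
    exact h0.trans_le (jumpTime_monotone hw (by omega))
  have hiff : ∀ n, (jumpTime C Φ x₀ w (n + 1) ≠ ⊤ ∧ ((jumpTime C Φ x₀ w (n + 1)).toReal,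
      postJump C Φ x₀ w (n + 1)) ∈ Ioc 0 t ×ˢ (univ : Set (State Θ d))) ↔
      jumpTime C Φ x₀ w (n + 1) ≤ t := by
    intro n
    constructor
    · rintro ⟨h1, ⟨-, h2⟩, -⟩
      exact (toReal_jumpTime_le_iff hw h1 t).1 h2
    · intro h
      have h1 := ne_top_of_le_coe h
      exact ⟨h1, ⟨hpos n h1, (toReal_jumpTime_le_iff hw h1 t).2 h⟩, mem_univ _⟩
  have hfin : {n | jumpTime C Φ x₀ w (n + 1) ≠ ⊤ ∧ ((jumpTime C Φ x₀ w (n + 1)).toReal,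
      postJump C Φ x₀ w (n + 1)) ∈ Ioc 0 t ×ˢ (univ : Set (State Θ d))}.Finite := by
    simp only [hiff]
    rcases lt_or_ge t 0 with h | h
    · convert finite_empty
      ext n
      simp only [mem_ofPred_eq, mem_empty_iff_false, iff_false, not_le]
      refine lt_of_lt_of_le ?_ (jumpTime_nonneg hw _)
      exact_mod_cast h
    · refine (finite_lt_nat (jumpIndex C Φ x₀ w t)).subset fun n hn => ?_
      exact (jumpTime_le_iff hw h _).1 hn
  rw [hmeas, (integrableOn_sum_dirac (measurableSet_Ioc.prod MeasurableSet.univ) hfin _).2]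
  refine tsum_congr fun n => ?_
  simp only [hiff]
  split_ifs with h
  · have h' : jumpTime C Φ x₀ w n ≤ t := (jumpTime_monotone hw n.le_succ).trans h
    rw [jumpIntegrand, stoppedTime, if_pos h, stoppedState, if_pos h, stoppedState, if_pos h']
    have htop := ne_top_of_le_coe h
    induction he : (embedded C Φ x₀ w (n + 1)).1 using ENat.recTopCoe with
    | top => exact absurd (jumpTime_eq_top_iff.2 he) htop
    | coe m =>
      have hm : m ≠ 0 := by
        rintro rfl
        have := hpos n htop
        rw [jumpTime_of_eq he, EReal.toReal_coe, hw.zero] at this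
        exact absurd this (lt_irrefl _)
      obtain ⟨k, rfl⟩ := Nat.exists_eq_succ_of_ne_zero hm
      obtain ⟨hacc, hn⟩ := (embedded_succ_eq_iff hw).1 he
      obtain ⟨_, -, e2, -⟩ := embedded_thinned (C := C) (Φ := Φ) (x₀ := x₀) hw k
      obtain ⟨_, -, e2', -⟩ := embedded_thinned (C := C) (Φ := Φ) (x₀ := x₀) hw (k + 1)
      have hn' : (thinned C Φ x₀ w (k + 1)).1 = n + 1 := by
        rw [thinned_succ_of_accepts hacc, hn]
      rw [hn] at e2
      rw [hn'] at e2'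
      rw [jumpTime_of_eq he, EReal.toReal_coe,
        leftLim_process hw hΦ (hw.strictMono k.lt_succ_self) le_rfl, postJump, postJump, e2, e2',
        thinned_succ_of_accepts hacc]
      rfl
  · rfl

theorem measurable_martingalePart_jumpSigma (hw : ∀ ω, (W ω).IsCounting) (hΦ : IsRegularFlow Φ)
    (hg : IsBoundedC1 g) {t : ℝ} (ht : 0 ≤ t) :
    Measurable[jumpSigma C Φ x₀ W t] fun ω => martingalePart C Φ x₀ (W ω) g t := by
  classical
  let mt : MeasurableSpace Ω := jumpSigma C Φ x₀ W t
  have hT : ∀ n, Measurable fun ω => stoppedTime C Φ x₀ (W ω) t n := measurable_stoppedTime hw t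
  have hY : ∀ n, Measurable fun ω => stoppedState C Φ x₀ (W ω) t n := measurable_stoppedState hw ht
  have hT0 : ∀ n ω, 0 ≤ stoppedTime C Φ x₀ (W ω) t n := fun n ω => by
    rw [stoppedTime]
    split_ifs
    · exact EReal.toReal_nonneg (jumpTime_nonneg (hw ω) n)
    · exact ht
  have h1 : (fun ω => martingalePart C Φ x₀ (W ω) g t) = fun ω =>
      (∑' n, if jumpTime C Φ x₀ (W ω) (n + 1) ≤ t then
        g (max (stoppedTime C Φ x₀ (W ω) t (n + 1)) 0) (stoppedState C Φ x₀ (W ω) t (n + 1)) -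
          g (max (stoppedTime C Φ x₀ (W ω) t (n + 1)) 0) ((stoppedState C Φ x₀ (W ω) t n).1,
            (stoppedState C Φ x₀ (W ω) t (n + 1)).2) else 0) -
      ∫ s in (0 : ℝ)..t, opS C g s (process C Φ x₀ (W ω) s) := by
    ext1 ω
    rw [martingalePart, compensatedIntegral, integral_jumpMeasure_eq_tsum_jumps (hw ω) hΦ,
      (integral_compensator (hw ω) hΦ hg ht).2]
    simp only [max_eq_left (hT0 _ ω)]
  rw [h1]
  refine Measurable.sub (Measurable.tsum fun n => Measurable.ite ?_ (Measurable.sub ?_ ?_)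
    measurable_const) (measurable_integral_opS_jumpSigma hw hΦ hg ht)
  · exact measurableSet_jumpTime_le hw ⟨ht, le_rfl⟩ (n + 1)
  · exact hg.measurable.comp ((hT (n + 1)).prodMk (hY (n + 1)))
  · exact hg.measurable.comp ((hT (n + 1)).prodMk ((hY n).fst.prodMk (hY (n + 1)).snd))

variable {mΩ : MeasurableSpace Ω} {P : Measure Ω} [IsProbabilityMeasure P]

/-- The compensated integral is a martingale for the filtration of the jump measure. -/
theorem exists_filtration_martingale (hW : IsThinningNoise P C.bound W) (hΦ : IsRegularFlow Φ)
    (hg : IsBoundedC1 g) :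
    ∃ ℱ : Filtration ℝ≥0 mΩ, (∀ t : ℝ≥0, ℱ t = jumpSigma C Φ x₀ W t) ∧
      Martingale (fun (t : ℝ≥0) ω => martingalePart C Φ x₀ (W ω) g t) ℱ P := by
  refine ⟨⟨fun t => jumpSigma C Φ x₀ W t, fun s t hst => jumpSigma_mono W (by exact_mod_cast hst),
    fun t => jumpSigma_le hW hΦ t⟩, fun t => rfl, fun t => ?_, fun s t hst => ?_⟩
  · exact (measurable_martingalePart_jumpSigma hW.isCounting hΦ hg t.2).stronglyMeasurable
  · have hst' : (s : ℝ) ≤ t := by exact_mod_cast hst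
    refine (ae_eq_condExp_of_forall_setIntegral_eq (jumpSigma_le hW hΦ s)
      (integrable_martingalePart hW hΦ hg t.2)
      (fun B _ _ => (integrable_martingalePart hW hΦ hg s.2).integrableOn)
      (fun B hB _ => setIntegral_martingalePart hW hΦ hg s.2 hst' hB) ?_).symm
    exact (measurable_martingalePart_jumpSigma hW.isCounting hΦ hg
      s.2).stronglyMeasurable.aestronglyMeasurable

end Adapted

/-! ### The exact flow. -/

section ODE

variable {d : ℕ} {F : EuclideanSpace ℝ (Fin d) → EuclideanSpace ℝ (Fin d)} {L : ℝ≥0}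

/-- A solution cannot move further than `K N` in time `N`, so Picard–Lindelöf with that radius
covers the whole interval at once, without continuation. -/
theorem exists_solution_Icc (hF : LipschitzWith L F) {K : ℝ} (hK : ∀ ν, ‖F ν‖ ≤ K)
    (ν : EuclideanSpace ℝ (Fin d)) (N : ℕ) :
    ∃ y : ℝ → EuclideanSpace ℝ (Fin d), y 0 = ν ∧
      ∀ t ∈ Icc (0 : ℝ) N, HasDerivWithinAt y (F (y t)) (Icc 0 N) t := by
  have hPL : IsPicardLindelof (fun _ => F) (⟨0, le_rfl, N.cast_nonneg⟩ : Icc (0 : ℝ) N) ν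
      (K.toNNReal * N) 0 K.toNNReal L :=
    { lipschitzOnWith := fun _ _ => hF.lipschitzOnWith
      continuousOn := fun _ _ => continuousOn_const
      norm_le := fun _ _ x _ => (hK x).trans (Real.le_coe_toNNReal K)
      mul_max_le := by simp }
  exact hPL.exists_eq_forall_mem_Icc_hasDerivWithinAt (by simp)

theorem hasDerivWithinAt_Ici_of_Icc {E : Type*} [NormedAddCommGroup E] [NormedSpace ℝ E]
    {y : ℝ → E} {y' : E} {a b t : ℝ} (h : HasDerivWithinAt y y' (Icc a b) t) (ht : t ∈ Ico a b) :
    HasDerivWithinAt y y' (Ici t) t :=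
  h.mono_of_mem_nhdsWithin (mem_of_superset (Icc_mem_nhdsGE ht.2) (Icc_subset_Icc_left ht.1))

/-- By uniqueness the solutions on the intervals `[0, N]` extend one another and glue together. -/
theorem exists_isODESolution (hF : LipschitzWith L F) {K : ℝ} (hK : ∀ ν, ‖F ν‖ ≤ K)
    (ν : EuclideanSpace ℝ (Fin d)) : ∃ y, IsODESolution F ν y := by
  choose α hα0 hα using exists_solution_Icc hF hK ν
  have huniq : ∀ {N M : ℕ}, N ≤ M → EqOn (α N) (α M) (Icc 0 N) := by
    intro N M hNM
    have hsub : Icc (0 : ℝ) N ⊆ Icc 0 M := Icc_subset_Icc_right (by exact_mod_cast hNM)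
    refine ODE_solution_unique (v := fun _ => F) (fun _ => hF)
      (fun t ht => (hα N t ht).continuousWithinAt)
      (fun t ht => hasDerivWithinAt_Ici_of_Icc (hα N t (Ico_subset_Icc_self ht)) ht)
      (fun t ht => ((hα M t (hsub ht)).mono hsub).continuousWithinAt)
      (fun t ht => hasDerivWithinAt_Ici_of_Icc
        ((hα M t (hsub (Ico_subset_Icc_self ht))).mono hsub) ht)
      ((hα0 N).trans (hα0 M).symm)
  refine ⟨fun t => α (⌈t⌉₊) t, by simp [hα0], fun t ht => ?_⟩
  -- The extra unit makes `[0, N]` a neighbourhood of `t` in `[0, ∞[`.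
  set N := ⌈t⌉₊ + 1 with hN
  have htN : t < N := (Nat.le_ceil t).trans_lt (by rw [hN]; exact_mod_cast Nat.lt_succ_self _)
  have heq : ∀ s ∈ Icc (0 : ℝ) N, α ⌈s⌉₊ s = α N s := fun s hs =>
    huniq (Nat.ceil_le.2 hs.2) ⟨hs.1, Nat.le_ceil s⟩
  have hmem : Icc (0 : ℝ) N ∈ 𝓝[Ici 0] t :=
    mem_of_superset (inter_mem_nhdsWithin _ (Iic_mem_nhds htN)) fun s hs => ⟨hs.1, hs.2⟩
  have h1 := (hα N t ⟨ht, htN.le⟩).mono_of_mem_nhdsWithin hmem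
  have h2 := heq t ⟨ht, htN.le⟩
  simp only [h2]
  exact h1.congr_of_eventuallyEq (mem_of_superset hmem heq) h2

theorem IsODESolution.continuousOn {ν : EuclideanSpace ℝ (Fin d)}
    {y : ℝ → EuclideanSpace ℝ (Fin d)} (hy : IsODESolution F ν y) : ContinuousOn y (Ici 0) :=
  fun t ht => (hy.2 t ht).continuousWithinAt

theorem IsODESolution.hasDerivWithinAt_Ici {ν : EuclideanSpace ℝ (Fin d)}
    {y : ℝ → EuclideanSpace ℝ (Fin d)} (hy : IsODESolution F ν y) {t : ℝ} (ht : 0 ≤ t) :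
    HasDerivWithinAt y (F (y t)) (Ici t) t :=
  (hy.2 t ht).mono (Ici_subset_Ici.2 ht)

theorem IsODESolution.dist_le (hF : LipschitzWith L F) {ν ν' : EuclideanSpace ℝ (Fin d)}
    {y y' : ℝ → EuclideanSpace ℝ (Fin d)} (hy : IsODESolution F ν y) (hy' : IsODESolution F ν' y')
    {t : ℝ} (ht : 0 ≤ t) : dist (y t) (y' t) ≤ dist ν ν' * Real.exp (L * t) := by
  have h := dist_le_of_trajectories_ODE (v := fun _ => F) (fun _ => hF)
    (hy.continuousOn.mono Icc_subset_Ici_self) (fun s hs => hy.hasDerivWithinAt_Ici hs.1)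
    (hy'.continuousOn.mono Icc_subset_Ici_self) (fun s hs => hy'.hasDerivWithinAt_Ici hs.1)
    (by rw [hy.1, hy'.1]) t ⟨ht, le_rfl⟩
  simpa using h

variable {Θ : Type*} {f : Θ → EuclideanSpace ℝ (Fin d) → EuclideanSpace ℝ (Fin d)}

theorem isODESolution_odeFlow (hf_bdd : ∀ θ, ∃ K : ℝ, ∀ ν, ‖f θ ν‖ ≤ K)
    (hf_lip : ∀ θ, LipschitzWith L (f θ)) (θ : Θ) (ν : EuclideanSpace ℝ (Fin d)) :
    IsODESolution (f θ) ν fun t => odeFlow f θ t ν := by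
  obtain ⟨K, hK⟩ := hf_bdd θ
  have hex := exists_isODESolution (hf_lip θ) hK ν
  have : (fun t => odeFlow f θ t ν) = hex.choose := by
    ext1 t
    rw [odeFlow, dif_pos hex]
  rw [this]
  exact hex.choose_spec

/-- Joint measurability comes from continuity in time for each starting point and, by Grönwall's
inequality, Lipschitz dependence on the starting point for each time. -/
theorem isRegularFlow_odeFlow (hf_bdd : ∀ θ, ∃ K : ℝ, ∀ ν, ‖f θ ν‖ ≤ K)
    (hf_lip : ∀ θ, LipschitzWith L (f θ)) : IsRegularFlow (odeFlow f) where
  zero θ ν := (isODESolution_odeFlow hf_bdd hf_lip θ ν).1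
  continuousOn θ ν := (isODESolution_odeFlow hf_bdd hf_lip θ ν).continuousOn
  measurable θ := by
    refine measurable_uncurry_of_continuous_of_measurable
      (u := fun (t : ℝ) ν => odeFlow f θ (max t 0) ν) (fun ν => ?_) (fun t => ?_)
    · exact (isODESolution_odeFlow hf_bdd hf_lip θ ν).continuousOn.comp_continuous
        (continuous_id.max continuous_const) fun t => mem_Ici.2 (le_max_right _ _)
    · refine Continuous.measurable (LipschitzWith.continuous
        (K := (Real.exp (L * max t 0)).toNNReal) (LipschitzWith.of_dist_le_mul fun ν ν' => ?_))
      rw [Real.coe_toNNReal _ (Real.exp_pos _).le, mul_comm]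
      exact (isODESolution_odeFlow hf_bdd hf_lip θ ν).dist_le (hf_lip θ)
        (isODESolution_odeFlow hf_bdd hf_lip θ ν') (le_max_right _ _)

theorem hasVelocity_odeFlow (hf_bdd : ∀ θ, ∃ K : ℝ, ∀ ν, ‖f θ ν‖ ≤ K)
    (hf_lip : ∀ θ, LipschitzWith L (f θ)) :
    HasVelocity (odeFlow f) fun θ t ν => f θ (odeFlow f θ t ν) where
  hasDerivWithinAt θ ν t ht :=
    ((isODESolution_odeFlow hf_bdd hf_lip θ ν).hasDerivWithinAt_Ici ht).mono Ioi_subset_Ici_self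
  measurable θ ν := ((hf_lip θ).continuous.comp
    ((isODESolution_odeFlow hf_bdd hf_lip θ ν).continuousOn.comp_continuous
        (continuous_id.max continuous_const) fun t => mem_Ici.2 (le_max_right _ _))).measurable
  bounded θ := by
    obtain ⟨K, hK⟩ := hf_bdd θ
    exact ⟨K, fun t _ ν => hK _⟩

end ODE

/-! ### The Euler polygon. -/

section Euler

variable {d : ℕ} {Θ : Type*} {f : Θ → EuclideanSpace ℝ (Fin d) → EuclideanSpace ℝ (Fin d)} {h : ℝ}

/-- At the right end the floor already selects the next segment, which starts where this one stops.
The closed interval is what left continuity at grid points requires. -/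
theorem eulerFlow_eq_of_mem (hh : 0 < h) (θ : Θ) (ν : EuclideanSpace ℝ (Fin d)) {i : ℕ} {t : ℝ}
    (h1 : i * h ≤ t) (h2 : t ≤ (i + 1) * h) :
    eulerFlow f h θ t ν =
      eulerSeq (f θ) h ν i + (t - i * h) • f θ (eulerSeq (f θ) h ν i) := by
  rw [eulerFlow]
  rcases h2.lt_or_eq with h2 | rfl
  · have : ⌊t / h⌋₊ = i := by
      rw [Nat.floor_eq_iff (div_nonneg ((by positivity : (0 : ℝ) ≤ i * h).trans h1) hh.le)]
      exact ⟨(le_div_iff₀ hh).2 h1, (div_lt_iff₀ hh).2 h2⟩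
    simp only [this]
  · have : ⌊((i : ℝ) + 1) * h / h⌋₊ = i + 1 := by
      rw [mul_div_cancel_right₀ _ hh.ne']
      exact_mod_cast Nat.floor_natCast (i + 1)
    simp only [this, eulerSeq]
    push_cast
    rw [sub_self, zero_smul, add_zero]
    congr 2
    ring

theorem eulerFlow_mul (hh : 0 < h) (θ : Θ) (ν : EuclideanSpace ℝ (Fin d)) (i : ℕ) :
    eulerFlow f h θ (i * h) ν = eulerSeq (f θ) h ν i := by
  rw [eulerFlow_eq_of_mem hh θ ν le_rfl (by nlinarith)]
  simp

theorem floor_mul_le (hh : 0 < h) {t : ℝ} (ht : 0 ≤ t) : ⌊t / h⌋₊ * h ≤ t :=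
  (le_div_iff₀ hh).1 (Nat.floor_le (div_nonneg ht hh.le))

theorem lt_floor_add_one_mul (hh : 0 < h) (t : ℝ) : t < (⌊t / h⌋₊ + 1) * h :=
  (div_lt_iff₀ hh).1 (Nat.lt_floor_add_one _)

theorem hasDerivWithinAt_eulerFlow (hh : 0 < h) (θ : Θ) (ν : EuclideanSpace ℝ (Fin d)) {t : ℝ}
    (ht : 0 ≤ t) : HasDerivWithinAt (fun s => eulerFlow f h θ s ν)
      (f θ (eulerSeq (f θ) h ν ⌊t / h⌋₊)) (Ici t) t := by
  set i := ⌊t / h⌋₊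
  have h1 : HasDerivWithinAt (fun s => eulerSeq (f θ) h ν i +
      (s - i * h) • f θ (eulerSeq (f θ) h ν i)) (f θ (eulerSeq (f θ) h ν i)) (Ici t) t := by
    have := (((hasDerivAt_id t).sub_const ((i : ℝ) * h)).smul_const
      (f θ (eulerSeq (f θ) h ν i))).const_add (eulerSeq (f θ) h ν i)
    simpa using this.hasDerivWithinAt
  refine h1.congr_of_eventuallyEq ?_ ?_
  · filter_upwards [Icc_mem_nhdsGE (lt_floor_add_one_mul hh t)] with s hs
    exact eulerFlow_eq_of_mem hh θ ν ((floor_mul_le hh ht).trans hs.1) hs.2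
  · exact eulerFlow_eq_of_mem hh θ ν (floor_mul_le hh ht) (lt_floor_add_one_mul hh t).le

theorem continuousOn_eulerFlow (hh : 0 < h) (θ : Θ) (ν : EuclideanSpace ℝ (Fin d)) :
    ContinuousOn (fun s => eulerFlow f h θ s ν) (Ici 0) := by
  intro t ht
  have ht0 : 0 ≤ t := ht
  have hright := (hasDerivWithinAt_eulerFlow (f := f) hh θ ν ht0).continuousWithinAt
  have hleft : ContinuousWithinAt (fun s => eulerFlow f h θ s ν) (Icc 0 t) t := by
    rcases ht0.eq_or_lt with rfl | hpos
    · rw [Icc_self]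
      exact continuousWithinAt_singleton
    -- The ceiling minus one indexes the segment arriving at `t` from the left; at a grid point the
    -- floor would give the one that leaves it.
    · obtain ⟨i, hi⟩ : ∃ i : ℕ, ⌈t / h⌉₊ = i + 1 :=
        Nat.exists_eq_succ_of_ne_zero (Nat.ceil_pos.2 (div_pos hpos hh)).ne'
      have h1 : i * h < t := by
        rw [← lt_div_iff₀ hh]
        exact Nat.lt_ceil.1 (by omega)
      have h2 : t ≤ (i + 1) * h := by
        rw [← div_le_iff₀ hh]
        have := Nat.le_ceil (t / h)
        rw [hi] at this
        exact_mod_cast this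
      have hc : ContinuousWithinAt (fun s => eulerSeq (f θ) h ν i +
          (s - i * h) • f θ (eulerSeq (f θ) h ν i)) (Icc (i * h) t) t :=
        Continuous.continuousWithinAt (by fun_prop)
      have hc' : ContinuousWithinAt (fun s => eulerFlow f h θ s ν) (Icc (i * h) t) t :=
        hc.congr (fun s hs => eulerFlow_eq_of_mem hh θ ν hs.1 (hs.2.trans h2))
          (eulerFlow_eq_of_mem hh θ ν h1.le h2)
      refine hc'.mono_of_mem_nhdsWithin ?_
      filter_upwards [inter_mem_nhdsWithin (Icc 0 t) (Ici_mem_nhds h1)] with s hs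
      exact ⟨hs.2, hs.1.2⟩
  refine (hleft.union hright).mono fun s hs => ?_
  rcases le_total s t with h' | h'
  · exact Or.inl ⟨hs, h'⟩
  · exact Or.inr h'

theorem measurable_eulerSeq (θ : Θ) (hf : Continuous (f θ)) :
    Measurable fun z : ℝ × EuclideanSpace ℝ (Fin d) =>
      eulerSeq (f θ) h z.2 ⌊max z.1 0 / h⌋₊ := by
  have hc : ∀ i, Continuous fun ν => eulerSeq (f θ) h ν i := by
    intro i
    induction i with
    | zero => exact continuous_id
    | succ i ih => exact ih.add ((hf.comp ih).const_smul h)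
  have h1 := measurable_of_slices (F := fun i ν => eulerSeq (f θ) h ν i) fun i => (hc i).measurable
  have h2 : Measurable fun z : ℝ × EuclideanSpace ℝ (Fin d) => ⌊max z.1 0 / h⌋₊ :=
    Nat.measurable_floor.comp ((measurable_fst.max measurable_const).div_const h)
  exact h1.comp (h2.prodMk measurable_snd)

theorem isRegularFlow_eulerFlow (hh : 0 < h) (hf : ∀ θ, Continuous (f θ)) :
    IsRegularFlow (eulerFlow f h) where
  zero θ ν := by
    have := eulerFlow_mul (f := f) hh θ ν 0
    simpa [eulerSeq] using this
  continuousOn θ ν := continuousOn_eulerFlow hh θ ν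
  measurable θ := by
    have h1 := measurable_eulerSeq (h := h) θ (hf θ)
    have h2 : Measurable fun z : ℝ × EuclideanSpace ℝ (Fin d) =>
        max z.1 0 - (⌊max z.1 0 / h⌋₊ : ℝ) * h := by
      have h3 : Measurable fun z : ℝ × EuclideanSpace ℝ (Fin d) => ⌊max z.1 0 / h⌋₊ :=
        Nat.measurable_floor.comp ((measurable_fst.max measurable_const).div_const h)
      exact (measurable_fst.max measurable_const).sub
        (((measurable_of_countable _).comp h3).mul_const h)
    exact h1.add (h2.smul ((hf θ).measurable.comp h1))

theorem hasVelocity_eulerFlow (hh : 0 < h) (hf : ∀ θ, Continuous (f θ))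
    (hf_bdd : ∀ θ, ∃ K : ℝ, ∀ ν, ‖f θ ν‖ ≤ K) :
    HasVelocity (eulerFlow f h) fun θ t ν => f θ (eulerSeq (f θ) h ν ⌊t / h⌋₊) where
  hasDerivWithinAt θ ν t ht := (hasDerivWithinAt_eulerFlow hh θ ν ht).mono Ioi_subset_Ici_self
  measurable θ ν := (hf θ).measurable.comp
    ((measurable_eulerSeq θ (hf θ)).comp (measurable_id.prodMk measurable_const))
  bounded θ := by
    obtain ⟨K, hK⟩ := hf_bdd θ
    exact ⟨K, fun t _ ν => hK _⟩

end Euler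

/-! ### Identification of the Euler drift with the frozen generator. -/

section Generators

variable {Θ : Type*} {d : ℕ} [MeasurableSpace Θ] {C : JumpCharacteristics Θ d}
  {f : Θ → EuclideanSpace ℝ (Fin d) → EuclideanSpace ℝ (Fin d)} {x₀ : State Θ d} {w : NoisePath}
  {g : ℝ → State Θ d → ℝ}

/-- The grid time lies between the last jump and `s`, so jump index and last jump are unchanged. The
time elapsed since the jump is a multiple of `h`, so the polygon is at a vertex there, and `f` at
that vertex is the velocity in force at time `s`. -/
theorem process_gridTime (hw : w.IsCounting) {h : ℝ} (hh : 0 < h) {s : ℝ} (hs : 0 ≤ s) :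
    process C (eulerFlow f h) x₀ w (gridTime C (eulerFlow f h) x₀ w h s) =
      ((process C (eulerFlow f h) x₀ w s).1,
        eulerSeq (f (process C (eulerFlow f h) x₀ w s).1) h
          (postJump C (eulerFlow f h) x₀ w (jumpIndex C (eulerFlow f h) x₀ w s)).2
          ⌊(s - lastJump C (eulerFlow f h) x₀ w s) / h⌋₊) := by
  obtain ⟨h1, h2⟩ := jumpIndex_spec (C := C) (Φ := eulerFlow f h) (x₀ := x₀) hw hs
  have htop := ne_top_of_le_coe h1
  have hlast : lastJump C (eulerFlow f h) x₀ w s ≤ s := (toReal_jumpTime_le_iff hw htop s).2 h1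
  have hgrid : gridTime C (eulerFlow f h) x₀ w h s ≤ s := by
    have := floor_mul_le hh (sub_nonneg.2 hlast)
    rw [gridTime]
    linarith
  have hgrid' : lastJump C (eulerFlow f h) x₀ w s ≤ gridTime C (eulerFlow f h) x₀ w h s := by
    rw [gridTime, le_add_iff_nonneg_right]
    positivity
  have hidx : jumpIndex C (eulerFlow f h) x₀ w (gridTime C (eulerFlow f h) x₀ w h s) =
      jumpIndex C (eulerFlow f h) x₀ w s :=
    jumpIndex_eq_of_mem hw ((toReal_jumpTime_le_iff hw htop _).1 hgrid')
      ((EReal.coe_le_coe_iff.2 hgrid).trans_lt h2)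
  have hlast' : lastJump C (eulerFlow f h) x₀ w (gridTime C (eulerFlow f h) x₀ w h s) =
      lastJump C (eulerFlow f h) x₀ w s := by
    rw [lastJump, hidx, lastJump]
  rw [process]
  simp only [hlast', hidx]
  rw [gridTime, add_sub_cancel_left, eulerFlow_mul hh]
  rfl

theorem driftAlong_eulerFlow_add_opS (hw : w.IsCounting) {h : ℝ} (hh : 0 < h) {s : ℝ}
    (hs : 0 ≤ s) :
    driftAlong C (eulerFlow f h) (fun θ t ν => f θ (eulerSeq (f θ) h ν ⌊t / h⌋₊)) x₀ w g s +
      opS C g s (process C (eulerFlow f h) x₀ w s) =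
    opAbar C f g s (process C (eulerFlow f h) x₀ w s)
      (process C (eulerFlow f h) x₀ w (gridTime C (eulerFlow f h) x₀ w h s)) := by
  rw [opAbar, opTbar, process_gridTime hw hh hs, driftAlong]

end Generators

end PDMP

end

theorem theorem4 {Θ : Type*} [TopologicalSpace Θ] [DiscreteTopology Θ] [MeasurableSpace Θ]
    [BorelSpace Θ] {d : ℕ} {Ω : Type*} {mΩ : MeasurableSpace Ω} (P : Measure Ω)
    [IsProbabilityMeasure P]
    (C : PDMP.JumpCharacteristics Θ d)
    (W : Ω → PDMP.NoisePath) (hW : PDMP.IsThinningNoise P C.bound W)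
    (f : Θ → EuclideanSpace ℝ (Fin d) → EuclideanSpace ℝ (Fin d))
    (hf_bdd : ∀ θ, ∃ K : ℝ, ∀ ν, ‖f θ ν‖ ≤ K)
    (hf_lip : ∃ L : ℝ≥0, ∀ θ, LipschitzWith L (f θ))
    (h : ℝ) (hh : 0 < h) (x : PDMP.State Θ d)
    (g : ℝ → PDMP.State Θ d → ℝ) (hg : PDMP.IsBoundedC1 g) :
    -- the piecewise deterministic Markov process
    ((∀ ω, ∀ t : ℝ, 0 ≤ t →
        IntegrableOn (PDMP.jumpIntegrand C (PDMP.odeFlow f) x (W ω) g) (Ioc 0 t ×ˢ univ)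
          (PDMP.jumpMeasure C (PDMP.odeFlow f) x (W ω)) ∧
        IntegrableOn (PDMP.jumpIntegrand C (PDMP.odeFlow f) x (W ω) g) (Ioc 0 t ×ˢ univ)
          (PDMP.compensator C (PDMP.odeFlow f) x (W ω)) ∧
        IntervalIntegrable (fun s => PDMP.opA C f g s (PDMP.process C (PDMP.odeFlow f) x (W ω) s)) volume 0 t ∧
        g t (PDMP.process C (PDMP.odeFlow f) x (W ω) t) =
          g 0 x + (∫ s in (0 : ℝ)..t, PDMP.opA C f g s (PDMP.process C (PDMP.odeFlow f) x (W ω) s)) +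
            PDMP.martingalePart C (PDMP.odeFlow f) x (W ω) g t) ∧
      ∃ ℱ : Filtration ℝ≥0 mΩ,
        (∀ t : ℝ≥0, ℱ t = PDMP.jumpSigma C (PDMP.odeFlow f) x W t) ∧
        Martingale (fun (t : ℝ≥0) ω => PDMP.martingalePart C (PDMP.odeFlow f) x (W ω) g t) ℱ P) ∧
    -- its Euler approximation
    ((∀ ω, ∀ t : ℝ, 0 ≤ t →
        IntegrableOn (PDMP.jumpIntegrand C (PDMP.eulerFlow f h) x (W ω) g) (Ioc 0 t ×ˢ univ)
          (PDMP.jumpMeasure C (PDMP.eulerFlow f h) x (W ω)) ∧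
        IntegrableOn (PDMP.jumpIntegrand C (PDMP.eulerFlow f h) x (W ω) g) (Ioc 0 t ×ˢ univ)
          (PDMP.compensator C (PDMP.eulerFlow f h) x (W ω)) ∧
        IntervalIntegrable (fun s => PDMP.opAbar C f g s (PDMP.process C (PDMP.eulerFlow f h) x (W ω) s)
            (PDMP.process C (PDMP.eulerFlow f h) x (W ω) (PDMP.gridTime C (PDMP.eulerFlow f h) x (W ω) h s))) volume 0 t ∧
        g t (PDMP.process C (PDMP.eulerFlow f h) x (W ω) t) =
          g 0 x + (∫ s in (0 : ℝ)..t, PDMP.opAbar C f g s (PDMP.process C (PDMP.eulerFlow f h) x (W ω) s)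
            (PDMP.process C (PDMP.eulerFlow f h) x (W ω) (PDMP.gridTime C (PDMP.eulerFlow f h) x (W ω) h s))) +
            PDMP.martingalePart C (PDMP.eulerFlow f h) x (W ω) g t) ∧
      ∃ ℱ : Filtration ℝ≥0 mΩ,
        (∀ t : ℝ≥0, ℱ t = PDMP.jumpSigma C (PDMP.eulerFlow f h) x W t) ∧
        Martingale (fun (t : ℝ≥0) ω => PDMP.martingalePart C (PDMP.eulerFlow f h) x (W ω) g t) ℱ P) := by
  have := C.countable
  have : DiscreteMeasurableSpace Θ := ⟨fun s => (isOpen_discrete s).measurableSet⟩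
  obtain ⟨L, hL⟩ := hf_lip
  have hcont : ∀ θ, Continuous (f θ) := fun θ => (hL θ).continuous
  have hΦ := PDMP.isRegularFlow_odeFlow hf_bdd hL
  have hΨ := PDMP.isRegularFlow_eulerFlow hh hcont
  refine ⟨⟨fun ω t ht => ⟨(PDMP.integral_jumpMeasure (hW.isCounting ω) hΦ g t).1,
      (PDMP.integral_compensator (hW.isCounting ω) hΦ hg ht).1,
      PDMP.ito_path (hW.isCounting ω) hΦ (PDMP.hasVelocity_odeFlow hf_bdd hL) hg ht⟩,
    PDMP.exists_filtration_martingale hW hΦ hg⟩,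
    fun ω t ht => ⟨(PDMP.integral_jumpMeasure (hW.isCounting ω) hΨ g t).1,
      (PDMP.integral_compensator (hW.isCounting ω) hΨ hg ht).1, ?_⟩,
    PDMP.exists_filtration_martingale hW hΨ hg⟩
  obtain ⟨hinteg, heq⟩ := PDMP.ito_path (x₀ := x) (hW.isCounting ω) hΨ
    (PDMP.hasVelocity_eulerFlow hh hcont hf_bdd) hg ht
  have hdrift := fun s (hs : 0 ≤ s) => PDMP.driftAlong_eulerFlow_add_opS (C := C) (f := f)
    (x₀ := x) (g := g) (hW.isCounting ω) hh hs
  refine ⟨hinteg.congr fun s hs => hdrift s ?_, heq.trans ?_⟩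
  · rw [uIoc_of_le ht] at hs
    exact hs.1.le
  · congr 2
    refine intervalIntegral.integral_congr fun s hs => hdrift s ?_
    rw [uIcc_of_le ht] at hs
    exact hs.1
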